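/- Let $n\in\mathbb N$ and let $\delta,\gamma,\lambda,p$ be real numbers with $0<\delta<\frac{n-1}{2}$, $1\le p<\frac{2n}{n-1-2\delta}$ and $\frac{n-1}{2}-\delta<\lambda\le\gamma$. Write $\widehat f(\xi)=\int_{\mathbb R^n}f(x)e^{-2\pi i x\cdot\xi}\,dx$. *The space.* $I_\lambda(L^p)(\mathbb R^n)$ is the homogeneous Sobolev space of all $f$ with $I_{-\lambda}f\in L^p$, where $(I_{-\lambda}f)^\wedge(\xi)=|\xi|^{\lambda}\widehat f(\xi)$. Precisely, it consists of the measurable functions $f:\mathbb R^n\to\mathbb C$ with $\int_{\mathbb R^n}|f(x)|(1+|x|)^{-n-\lambda}\,dx<\infty$ for which there is a $g\in L^p(\mathbb R^n)$ such that $$\int_{\mathbb R^n} f\, I_{-\lambda}\varphi\,dx=\int_{\mathbb R^n} g\,\varphi\,dx\qquad\text{for all Schwartz functions }\varphi,\qquad (I_{-\lambda}\varphi)^\wedge(\xi)=|\xi|^{\lambda}\widehat\varphi(\xi).$$ *The means.* For $R>0$ let $S_R^{\delta,\gamma}f$ be the generalized Bochner–Riesz mean, with multiplier $\left(1-\frac{|\xi|^\gamma}{R^\gamma}\right)_+^{\delta}$,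 that is $$S_R^{\delta,\gamma}f=B_R^{\delta,\gamma}*f,\qquad B_R^{\delta,\gamma}(x)=\int_{\mathbb R^n}\Bigl(1-\frac{|\xi|^\gamma}{R^\gamma}\Bigr)_+^{\delta}e^{2\pi i\xi\cdot x}\,d\xi,$$ where the convolution is understood as $\lim_{\varepsilon\to0^+}\int_{\mathbb R^n}e^{-\varepsilon|y|^2}B_R^{\delta,\gamma}(y)f(x-y)\,dy$. *Claim.* Let $f\in I_\lambda(L^p)(\mathbb R^n)$. Then this limit exists for all $R>0$ and all $x\in\mathbb R^n$, and for almost every $x\in\mathbb R^n$ $$S_R^{\delta,\gamma}f(x)-f(x)=o\!\left(R^{-\left(\lambda+\delta-\frac{n-1}{2}\right)}\right)\qquad\text{as }R\to\infty .$$ -/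

import Mathlib

open MeasureTheory Filter Topology Asymptotics
open scoped FourierTransform SchwartzMap

noncomputable section

/-- Euclidean space `ℝⁿ`. -/
abbrev Rn (n : ℕ) : Type := EuclideanSpace ℝ (Fin n)

/-- The multiplier `(1 - |ξ|^γ / R^γ)_+^δ` of the generalized Bochner-Riesz mean. -/
def bochnerRieszMultiplier {n : ℕ} (δ γ R : ℝ) (ξ : Rn n) : ℝ :=
  (max (1 - ‖ξ‖ ^ γ / R ^ γ) 0) ^ δ

/-- The kernel `B_R(x) = ∫ (1 - |ξ|^γ / R^γ)_+^δ e^{2πi ξ·x} dξ`. -/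
def bochnerRieszKernel {n : ℕ} (δ γ R : ℝ) : Rn n → ℂ :=
  𝓕⁻ (fun ξ : Rn n => (bochnerRieszMultiplier δ γ R ξ : ℂ))

/-- The Gauss regularization `∫ e^{-ε|y|²} B_R(y) f(x - y) dy` of the convolution `B_R * f`. It
converges absolutely, for every `ε > 0`, as soon as `f` has polynomial growth on average. -/
def bochnerRieszGauss {n : ℕ} (δ γ R : ℝ) (f : Rn n → ℂ) (x : Rn n) (ε : ℝ) : ℂ :=
  ∫ y : Rn n, (Real.exp (-ε * ‖y‖ ^ 2) : ℂ) * bochnerRieszKernel δ γ R y * f (x - y)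

/-- The generalized Bochner-Riesz mean `S_R f = B_R * f`, at the point `x`. As `B_R` is in general
not integrable and `f` may grow, the convolution is understood as the limit of its Gauss
regularizations as `ε → 0+`. By dominated convergence, this is the ordinary convolution whenever
the latter converges absolutely; in particular it is `𝓕⁻ (m_R 𝓕 f)` with the multiplier
`m_R` above if `f` is integrable. The existence of the limit is asserted separately wherever the
value of this function is used. -/
def bochnerRieszMean {n : ℕ} (δ γ R : ℝ) (f : Rn n → ℂ) (x : Rn n) : ℂ :=
  limUnder (𝓝[>] (0 : ℝ)) (bochnerRieszGauss δ γ R f x)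

/-- The Riesz potential operator of real order `s`, on a nice function `φ`:
`(I_s φ)^(ξ) = |ξ|^{-s} φ^(ξ)`. It is used for `s < 0` and `φ` a Schwartz function, when
`|ξ|^{-s} φ^` is integrable. -/
def rieszPotential {n : ℕ} (s : ℝ) (φ : Rn n → ℂ) : Rn n → ℂ :=
  𝓕⁻ (fun ξ : Rn n => ((‖ξ‖ ^ (-s) : ℝ) : ℂ) * 𝓕 φ ξ)

/-- `IsRieszDerivative lam f g`: the function `f` lies in the domain
`{f : ∫ |f(x)| (1 + |x|)^{-n-lam} dx < ∞}` of the operator `I_{-lam}` and `I_{-lam} f = g`, that is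
`|ξ|^lam f^ = g^`, in the sense of tempered distributions: `⟨f, I_{-lam} φ⟩ = ⟨g, φ⟩` for all Schwartz
functions `φ`. The integral on the left converges absolutely, because `I_{-lam} φ` is
`O((1 + |x|)^{-n-lam})` for `lam > 0`. -/
def IsRieszDerivative {n : ℕ} (lam : ℝ) (f g : Rn n → ℂ) : Prop :=
  Integrable (fun x : Rn n => (((1 + ‖x‖) ^ (-((n : ℝ) + lam)) : ℝ) : ℂ) * f x) ∧
    ∀ φ : 𝓢(Rn n, ℂ), ∫ x, f x * rieszPotential (-lam) φ x = ∫ x, g x * φ x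

/-- The homogeneous Sobolev space `I_lam(L^p)(ℝⁿ)`, `lam > 0`: the functions `f` with
`I_{-lam} f ∈ L^p`. -/
def MemRieszSobolev {n : ℕ} (lam p : ℝ) (f : Rn n → ℂ) : Prop :=
  ∃ g : Rn n → ℂ, MemLp g (ENNReal.ofReal p) ∧ IsRieszDerivative lam f g

end

/-! Put g = I_{-lam} f, a = δ + (n+1)/2, and let m be the multiplier at R = 1. On the Fourier side
the error of the mean is (m(ξ/R) - 1)|ξ|^(-lam) applied to g, so by scaling S_R f(x) - f(x) =
R^(-lam) ∫ g(x - y/R) K(y) dy, where K has symbol (m - 1)|ξ|^(-lam).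

The central estimate is |K(y)| ≤ C|y|^(-a) (`norm_errorKernel_le`). Near ξ = 0 the symbol is of size
|ξ|^(γ-lam), which gives decay of order n + γ - lam ≥ n > a. Away from 0, m|ξ|^(-lam) is singular on
the unit sphere like (1 - |ξ|²)₊^δ, whose transform decays with order a; this is proved by slicing
down to one dimension and an energy estimate for Bessel's equation. The remaining term -|ξ|^(-lam)
at high frequencies gives a kernel that decreases rapidly and is less singular than |y|^(-a) at 0,
because n - lam < a.

The bound on p says p(n - a) < n, so by Hölder g is integrable against (1 + |y|)^(-a); as a < n,
Tonelli makes |z|^(-a) g(x - z) integrable in z for almost every x (`ae_integrable_riesz`). At such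
x, scaling bounds ∫ g(x - y/R) K(y) dy by a multiple of R^(n-a), and n - a = (n-1)/2 - δ > 0. To
gain the little o, g(x - ·) is approximated by a Schwartz function h in L¹(|z|^(-a) dz): for h the
integral stays bounded in R, since K is the sum of a function with bounded symbol and an integrable
function (`exists_norm_integral_errorKernel_le`).

The error formula needs care, because f B_R need not be integrable. Test functions are split by a
smooth cutoff: low frequencies are paired with f, high frequencies with g through the kernel
`highRiesz` of symbol |ξ|^(-lam)(1 - cutoff). Gauss regularizations of B_1 are Schwartz functions,
so the definition of g applies to them. Dominated convergence as ε → 0 works because multiplication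
by a Gaussian carries the singularity of the sphere into the low band only up to a uniformly rapidly
decreasing error (`exists_gaussian_split`). The same splitting recovers f(x) for almost every x
(`IsRieszDerivative.ae_smoothMean_eq`), and the recovered value does not depend on the cutoff scale
(`IsRieszDerivative.smoothMean_eq`), so one null set serves all R. -/

noncomputable section

/-! ### Fourier integrals: scaling, Fubini, multiplication formulas. -/

section FourierTools

open Real

variable {n : ℕ}

theorem continuous_coe_fourierChar : Continuous fun t : ℝ => (𝐞 t : ℂ) :=
  continuous_fourierChar.subtype_val

theorem norm_fourierInv_le_integral (u : Rn n → ℂ) (y : Rn n) :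
    ‖𝓕⁻ u y‖ ≤ ∫ ξ, ‖u ξ‖ := by
  rw [fourierInv_eq]
  refine (norm_integral_le_integral_norm _).trans (le_of_eq ?_)
  simp

theorem continuous_fourierInv_of_integrable {u : Rn n → ℂ} (hu : Integrable u) :
    Continuous (𝓕⁻ u) := by
  have h : Continuous (𝓕 u) :=
    VectorFourier.fourierIntegral_continuous Real.continuous_fourierChar
      (by exact continuous_inner) hu
  have : 𝓕⁻ u = fun y => 𝓕 u (-y) := by
    ext y; exact fourierInv_eq_fourier_neg u y
  rw [this]
  exact h.comp continuous_neg

theorem fourierInv_comp_inv_smul (u : Rn n → ℂ) {σ : ℝ} (hσ : 0 < σ) (y : Rn n) :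
    𝓕⁻ (fun ξ => u (σ⁻¹ • ξ)) y = ((σ ^ n : ℝ) : ℂ) * 𝓕⁻ u (σ • y) := by
  simp only [fourierInv_eq]
  have h := Measure.integral_comp_inv_smul_of_nonneg (volume : Measure (Rn n))
    (fun ξ => 𝐞 (inner ℝ ξ (σ • y)) • u ξ) hσ.le
  rw [finrank_euclideanSpace_fin] at h
  rw [← Complex.real_smul, ← h]
  congr 1
  ext ξ
  rw [inner_smul_left, inner_smul_right]
  simp [hσ.ne']

theorem fourier_comp_smul (u : Rn n → ℂ) {σ : ℝ} (hσ : 0 < σ) (ξ : Rn n) :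
    𝓕 (fun y => u (σ • y)) ξ = (((σ ^ n)⁻¹ : ℝ) : ℂ) * 𝓕 u (σ⁻¹ • ξ) := by
  simp only [fourier_eq]
  have h := Measure.integral_comp_smul_of_nonneg (volume : Measure (Rn n))
    (fun y => 𝐞 (-inner ℝ y (σ⁻¹ • ξ)) • u y) σ (hR := hσ.le)
  rw [finrank_euclideanSpace_fin] at h
  rw [← Complex.real_smul, ← h]
  congr 1
  ext y
  rw [inner_smul_left, inner_smul_right]
  simp [hσ.ne']

theorem fourierInv_even {u : Rn n → ℂ} (hu : ∀ ξ, u (-ξ) = u ξ) (y : Rn n) :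
    𝓕⁻ u (-y) = 𝓕⁻ u y := by
  have h := fourierInv_comp_linearIsometry (LinearIsometryEquiv.neg ℝ (E := Rn n)) u y
  rw [LinearIsometryEquiv.coe_neg] at h
  rw [← h, show (u ∘ fun x => -x) = u from funext hu]

theorem integral_mul_fourierInv_sub {k w : Rn n → ℂ} (hk : Integrable k) (hw : Integrable w)
    (y : Rn n) :
    ∫ z, k z * 𝓕⁻ w (y - z) = 𝓕⁻ (fun ξ => 𝓕 k ξ * w ξ) y := by
  have hI : Integrable (Function.uncurry fun z ξ : Rn n =>
      k z * ((𝐞 (inner ℝ ξ (y - z)) : ℂ) * w ξ)) (volume.prod volume) := by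
    have h := hk.mul_prod hw
    refine (h.bdd_mul (f := fun p : Rn n × Rn n => (𝐞 (inner ℝ p.2 (y - p.1)) : ℂ)) (c := 1)
      ?_ ?_).congr ?_
    · exact (continuous_coe_fourierChar.comp (by fun_prop)).aestronglyMeasurable
    · exact .of_forall fun p => (Circle.norm_coe _).le
    · exact .of_forall fun p => by simp only [Function.uncurry]; ring
  have h1 : ∀ z, k z * 𝓕⁻ w (y - z) = ∫ ξ, k z * ((𝐞 (inner ℝ ξ (y - z)) : ℂ) * w ξ) := by
    intro z
    rw [fourierInv_eq, ← integral_const_mul]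
    rfl
  simp_rw [h1]
  rw [integral_integral_swap hI, fourierInv_eq]
  congr 1
  ext ξ
  rw [fourier_eq, Circle.smul_def, smul_eq_mul, ← mul_assoc, ← integral_const_mul,
    ← integral_mul_const]
  congr 1
  ext z
  rw [Circle.smul_def, smul_eq_mul, inner_sub_right, sub_eq_add_neg, AddChar.map_add_eq_mul,
    Circle.coe_mul, real_inner_comm ξ z]
  ring

theorem fourierInv_integral {μ : Measure ℝ} [SFinite μ] {u : ℝ → Rn n → ℂ}
    (hu : Integrable (Function.uncurry u) (μ.prod volume)) (y : Rn n) :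
    𝓕⁻ (fun ξ => ∫ σ, u σ ξ ∂μ) y = ∫ σ, 𝓕⁻ (u σ) y ∂μ := by
  have hI : Integrable (Function.uncurry fun (σ : ℝ) (ξ : Rn n) =>
      (𝐞 (inner ℝ ξ y) : ℂ) * u σ ξ) (μ.prod volume) := by
    refine hu.bdd_mul (f := fun p : ℝ × Rn n => (𝐞 (inner ℝ p.2 y) : ℂ)) (c := 1) ?_ ?_
    · exact (continuous_coe_fourierChar.comp (by fun_prop)).aestronglyMeasurable
    · exact .of_forall fun p => (Circle.norm_coe _).le
  simp_rw [fourierInv_eq, Circle.smul_def, smul_eq_mul]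
  rw [integral_integral_swap hI]
  congr 1
  ext ξ
  rw [integral_const_mul]

theorem fourier_integral {μ : Measure ℝ} [SFinite μ] {u : ℝ → Rn n → ℂ}
    (hu : Integrable (Function.uncurry u) (μ.prod volume)) (ξ : Rn n) :
    𝓕 (fun y => ∫ σ, u σ y ∂μ) ξ = ∫ σ, 𝓕 (u σ) ξ ∂μ := by
  have h := fourierInv_integral hu (-ξ)
  simpa [fourierInv_eq_fourier_neg] using h

theorem fourierInv_mul_fourierInv {u v : Rn n → ℂ} (hu : Integrable u) (hv : Integrable v)
    (y : Rn n) :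
    𝓕⁻ u y * 𝓕⁻ v y = 𝓕⁻ (fun ξ => ∫ η, u η * v (ξ - η)) y := by
  have h := Real.fourier_mul_convolution_eq hu hv (-y)
  rw [← fourierInv_eq_fourier_neg, ← fourierInv_eq_fourier_neg, ← fourierInv_eq_fourier_neg] at h
  rw [← h]
  rfl

theorem integral_fourierInv_mul_eq_flip {u v : Rn n → ℂ} (hu : Integrable u)
    (hv : Integrable v) : ∫ y, 𝓕⁻ u y * v y = ∫ ξ, u ξ * 𝓕⁻ v ξ := by
  have h := VectorFourier.integral_fourierIntegral_smul_eq_flip (L := innerₗ (Rn n))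
    (μ := volume) (ν := volume) Real.continuous_fourierChar continuous_inner hu
    (hv.comp_neg)
  simp only [flip_innerₗ, smul_eq_mul] at h
  have e : ∀ (w : Rn n → ℂ) x, VectorFourier.fourierIntegral 𝐞 volume (innerₗ (Rn n)) w x
    = 𝓕 w x := fun _ _ => rfl
  simp only [e] at h
  have h2 : ∀ ξ, 𝓕 (fun t => v (-t)) ξ = 𝓕⁻ v ξ := fun ξ => by
    rw [fourierInv_eq_fourier_comp_neg]
  simp only [h2] at h
  rw [← h, ← integral_neg_eq_self]
  congr 1
  ext y
  rw [fourierInv_eq_fourier_neg, neg_neg]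

/-- Finite moments bound every derivative of the transform uniformly. This allows such transforms to
act as multipliers on Schwartz functions. -/
theorem hasTemperateGrowth_fourier {u : Rn n → ℂ} (hu : AEStronglyMeasurable u)
    (h : ∀ k : ℕ, Integrable (fun y => ‖y‖ ^ k * ‖u y‖)) :
    (𝓕 u).HasTemperateGrowth := by
  refine ⟨contDiff_fourier (N := ⊤) fun k _ => h k, fun k => ⟨0,
    (∫ v, ‖VectorFourier.fourierPowSMulRight (innerSL ℝ) u v k‖), fun x => ?_⟩⟩
  rw [iteratedFDeriv_fourier (N := ⊤) (fun k _ => h k) hu (n := k) (by exact_mod_cast le_top)]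
  simp only [pow_zero, mul_one]
  rw [fourier_eq]
  refine (norm_integral_le_integral_norm _).trans (le_of_eq ?_)
  simp

theorem hasTemperateGrowth_fourierInv {u : Rn n → ℂ} (hu : AEStronglyMeasurable u)
    (h : ∀ k : ℕ, Integrable (fun y => ‖y‖ ^ k * ‖u y‖)) :
    (𝓕⁻ u).HasTemperateGrowth := by
  rw [fourierInv_eq_fourier_comp_neg]
  refine hasTemperateGrowth_fourier (hu.comp_quasiMeasurePreserving
    (Measure.measurePreserving_neg volume).quasiMeasurePreserving) fun k => ?_
  simpa using (h k).comp_neg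

end FourierTools

/-! ### Polynomial weights and absolute convergence of Riesz potentials. -/

section Weights

variable {n : ℕ}

/-- Peetre's inequality. It is the reason why convolution with a kernel having enough moments
preserves polynomial decay. -/
theorem one_add_norm_sub_rpow_neg_le {a : ℝ} (ha : 0 ≤ a) (y z : Rn n) :
    (1 + ‖y - z‖) ^ (-a) ≤ (1 + ‖y‖) ^ (-a) * (1 + ‖z‖) ^ a := by
  have h : 1 + ‖y‖ ≤ (1 + ‖y - z‖) * (1 + ‖z‖) := by
    have := norm_add_le (y - z) z
    rw [sub_add_cancel] at this
    nlinarith [norm_nonneg (y - z), norm_nonneg z]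
  have h1 := Real.rpow_le_rpow (by positivity) h ha
  rw [Real.mul_rpow (by positivity) (by positivity)] at h1
  rw [Real.rpow_neg (by positivity), Real.rpow_neg (by positivity)]
  have hA : 0 < (1 + ‖y - z‖) ^ a := by positivity
  have hB : 0 < (1 + ‖y‖) ^ a := by positivity
  rw [inv_mul_eq_div, le_div_iff₀ hB, inv_mul_le_iff₀ hA]
  exact h1

theorem continuous_one_add_norm_rpow (a : ℝ) : Continuous fun y : Rn n => (1 + ‖y‖) ^ a :=
  (continuous_const.add continuous_norm).rpow_const fun y =>
    Or.inl (by linarith [norm_nonneg y] : 0 < 1 + ‖y‖).ne'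

theorem integral_norm_mul_norm_sub_le {E F : Type*} [NormedAddCommGroup E]
    [NormedAddCommGroup F] {k : Rn n → E} {b : Rn n → F} {a C : ℝ} (ha : 0 ≤ a)
    (hk : Integrable fun z => ‖k z‖ * (1 + ‖z‖) ^ a)
    (hb : ∀ y, ‖b y‖ ≤ C * (1 + ‖y‖) ^ (-a)) (y : Rn n) :
    ∫ z, ‖k z‖ * ‖b (y - z)‖ ≤ C * (∫ z, ‖k z‖ * (1 + ‖z‖) ^ a) * (1 + ‖y‖) ^ (-a) := by
  have hC : 0 ≤ C := by
    have := (norm_nonneg _).trans (hb 0)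
    simpa using this
  calc ∫ z, ‖k z‖ * ‖b (y - z)‖
      ≤ ∫ z, C * (1 + ‖y‖) ^ (-a) * (‖k z‖ * (1 + ‖z‖) ^ a) := by
        refine integral_mono_of_nonneg (.of_forall fun z => by positivity) (hk.const_mul _)
          (.of_forall fun z => ?_)
        calc ‖k z‖ * ‖b (y - z)‖ ≤ ‖k z‖ * (C * ((1 + ‖y‖) ^ (-a) * (1 + ‖z‖) ^ a)) := by
              refine mul_le_mul_of_nonneg_left ((hb _).trans ?_) (norm_nonneg _)
              exact mul_le_mul_of_nonneg_left (one_add_norm_sub_rpow_neg_le ha y z) hC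
          _ = _ := by ring
    _ = _ := by rw [integral_const_mul]; ring

theorem norm_integral_mul_sub_le {k b : Rn n → ℂ} {a C : ℝ} (ha : 0 ≤ a)
    (hk : Integrable fun z => ‖k z‖ * (1 + ‖z‖) ^ a)
    (hb : ∀ y, ‖b y‖ ≤ C * (1 + ‖y‖) ^ (-a)) (y : Rn n) :
    ‖∫ z, k z * b (y - z)‖ ≤ C * (∫ z, ‖k z‖ * (1 + ‖z‖) ^ a) * (1 + ‖y‖) ^ (-a) := by
  refine (norm_integral_le_integral_norm _).trans ?_
  simp_rw [norm_mul]
  exact integral_norm_mul_norm_sub_le ha hk hb y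

theorem integrable_of_integrable_weight {k : Rn n → ℂ} {a : ℝ} (ha : 0 ≤ a)
    (hm : AEStronglyMeasurable k) (hk : Integrable fun z => ‖k z‖ * (1 + ‖z‖) ^ a) :
    Integrable k := by
  refine hk.mono' hm (.of_forall fun z => ?_)
  exact le_mul_of_one_le_right (norm_nonneg _)
    (Real.one_le_rpow (by linarith [norm_nonneg z]) ha)

theorem integrable_weight_of_moments {k : Rn n → ℂ} (hm : AEStronglyMeasurable k)
    (h : ∀ j : ℕ, Integrable fun z => ‖z‖ ^ j * ‖k z‖) (a : ℝ) :
    Integrable fun z => ‖k z‖ * (1 + ‖z‖) ^ a := by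
  obtain ⟨j, hj⟩ := exists_nat_ge a
  have hI : Integrable fun z => 2 ^ j * (‖z‖ ^ 0 * ‖k z‖ + ‖z‖ ^ j * ‖k z‖) :=
    ((h 0).add (h j)).const_mul _
  refine hI.mono' (hm.norm.mul (continuous_one_add_norm_rpow a).aestronglyMeasurable)
    (.of_forall fun z => ?_)
  rw [Real.norm_of_nonneg (by positivity)]
  have h1 : (1 + ‖z‖) ^ a ≤ (1 + ‖z‖) ^ j := by
    rw [← Real.rpow_natCast]
    exact Real.rpow_le_rpow_of_exponent_le (by linarith [norm_nonneg z]) hj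
  have h2 : (1 + ‖z‖) ^ j ≤ 2 ^ j * (1 + ‖z‖ ^ j) := by
    rcases le_total ‖z‖ 1 with hz | hz
    · calc (1 + ‖z‖) ^ j ≤ 2 ^ j := by gcongr; linarith
        _ ≤ _ := le_mul_of_one_le_right (by positivity) (by linarith [pow_nonneg (norm_nonneg z) j])
    · calc (1 + ‖z‖) ^ j ≤ (2 * ‖z‖) ^ j := by gcongr; linarith
        _ = 2 ^ j * ‖z‖ ^ j := mul_pow _ _ _
        _ ≤ _ := by gcongr; linarith
  calc ‖k z‖ * (1 + ‖z‖) ^ a ≤ ‖k z‖ * (2 ^ j * (1 + ‖z‖ ^ j)) := by gcongr; exact h1.trans h2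
    _ = _ := by ring

theorem schwartz_integrable_moment (φ : 𝓢(Rn n, ℂ)) (j : ℕ) :
    Integrable fun z => ‖z‖ ^ j * ‖φ z‖ := φ.integrable_pow_mul volume j

theorem schwartz_integrable_weight (φ : 𝓢(Rn n, ℂ)) (a : ℝ) :
    Integrable fun z => ‖φ z‖ * (1 + ‖z‖) ^ a :=
  integrable_weight_of_moments φ.continuous.aestronglyMeasurable (schwartz_integrable_moment φ) a

theorem schwartz_decay (φ : 𝓢(Rn n, ℂ)) (a : ℝ) :
    ∃ C, 0 ≤ C ∧ ∀ y, ‖φ y‖ ≤ C * (1 + ‖y‖) ^ (-a) := by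
  obtain ⟨j, hj⟩ := exists_nat_ge a
  refine ⟨2 ^ j * ((Finset.Iic (j, 0)).sup fun m => SchwartzMap.seminorm ℝ m.1 m.2) φ,
    by positivity, fun y => ?_⟩
  have h := SchwartzMap.one_add_le_sup_seminorm_apply (𝕜 := ℝ) (m := (j, 0)) le_rfl le_rfl φ y
  rw [norm_iteratedFDeriv_zero] at h
  have h1 : (1 + ‖y‖) ^ a ≤ (1 + ‖y‖) ^ j := by
    rw [← Real.rpow_natCast]
    exact Real.rpow_le_rpow_of_exponent_le (by linarith [norm_nonneg y]) hj
  rw [Real.rpow_neg (by positivity), ← div_eq_mul_inv, le_div_iff₀ (by positivity)]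
  calc ‖φ y‖ * (1 + ‖y‖) ^ a ≤ ‖φ y‖ * (1 + ‖y‖) ^ j := by gcongr
    _ = (1 + ‖y‖) ^ j * ‖φ y‖ := mul_comm _ _
    _ ≤ _ := h

/-- Hölder: with q conjugate to p, the weight lies in L^q as soon as aq > n, which is the condition
p(n - a) < n. For p = 1 the weight only has to be bounded. -/
theorem MemLp.integrable_one_add_norm_rpow_mul {p a : ℝ} (hp : 1 ≤ p) (ha : 0 ≤ a)
    (hpa : p * (n - a) < n) {g : Rn n → ℂ} (hg : MemLp g (ENNReal.ofReal p)) :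
    Integrable fun y => (((1 + ‖y‖) ^ (-a) : ℝ) : ℂ) * g y := by
  have hcont : Continuous fun y : Rn n => (((1 + ‖y‖) ^ (-a) : ℝ) : ℂ) :=
    Complex.continuous_ofReal.comp (continuous_one_add_norm_rpow _)
  rcases hp.eq_or_lt with rfl | hp
  · rw [ENNReal.ofReal_one, memLp_one_iff_integrable] at hg
    refine hg.bdd_mul (c := 1) hcont.aestronglyMeasurable (.of_forall fun y => ?_)
    rw [Complex.norm_real, Real.norm_of_nonneg (by positivity)]
    exact Real.rpow_le_one_of_one_le_of_nonpos (by linarith [norm_nonneg y]) (by linarith)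
  · have hq := Real.HolderConjugate.conjExponent hp
    set q := p.conjExponent with hqdef
    have hq0 : 0 < q := hq.symm.pos
    have : ENNReal.HolderConjugate (ENNReal.ofReal p) (ENNReal.ofReal q) := hq.ennrealOfReal
    have hw : MemLp (fun y : Rn n => (((1 + ‖y‖) ^ (-a) : ℝ) : ℂ)) (ENNReal.ofReal q) := by
      rw [← integrable_norm_rpow_iff hcont.aestronglyMeasurable (by simpa using hq0)
        ENNReal.ofReal_ne_top, ENNReal.toReal_ofReal hq0.le]
      have h : Integrable fun y : Rn n => (1 + ‖y‖) ^ (-(a * q)) := by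
        refine integrable_one_add_norm ?_
        rw [finrank_euclideanSpace_fin]
        have h1 : (p - 1) * q = p := hq.sub_one_mul_conj
        nlinarith [hq.pos]
      refine h.congr (.of_forall fun y => ?_)
      simp only
      rw [Complex.norm_real, Real.norm_of_nonneg (by positivity), ← Real.rpow_mul (by positivity)]
      congr 1
      ring
    exact hw.integrable_mul hg

theorem integrable_weight_comp_sub_smul {a : ℝ} (ha : 0 ≤ a) {f : Rn n → ℂ}
    (hf : Integrable fun y => (((1 + ‖y‖) ^ (-a) : ℝ) : ℂ) * f y) (x : Rn n) {r : ℝ}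
    (hr : 0 < r) :
    Integrable fun y => (((1 + ‖y‖) ^ (-a) : ℝ) : ℂ) * f (x - r • y) := by
  have h1 : Integrable fun y => (((1 + ‖x - r • y‖) ^ (-a) : ℝ) : ℂ) * f (x - r • y) :=
    (hf.comp_sub_left x).comp_smul hr.ne'
  have hc : ∀ b : ℝ, Continuous fun y : Rn n => (((1 + ‖y‖) ^ b : ℝ) : ℂ) := fun b =>
    Complex.continuous_ofReal.comp (continuous_one_add_norm_rpow _)
  have hcomp : Continuous fun y : Rn n => x - r • y := by fun_prop
  have h2 : (fun y => (((1 + ‖y‖) ^ (-a) : ℝ) : ℂ) * f (x - r • y)) = fun y =>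
      ((((1 + ‖y‖) ^ (-a) : ℝ) : ℂ) * (((1 + ‖x - r • y‖) ^ a : ℝ) : ℂ)) *
        ((((1 + ‖x - r • y‖) ^ (-a) : ℝ) : ℂ) * f (x - r • y)) := by
    ext y
    have : (((1 + ‖x - r • y‖) ^ a : ℝ) : ℂ) * (((1 + ‖x - r • y‖) ^ (-a) : ℝ) : ℂ) = 1 := by
      rw [← Complex.ofReal_mul, ← Real.rpow_add (by positivity)]
      simp
    calc _ = (((1 + ‖y‖) ^ (-a) : ℝ) : ℂ) * f (x - r • y) * 1 := by ring
      _ = _ := by rw [← this]; ring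
  rw [h2]
  -- The constant comes from 1 + ‖x - r y‖ ≤ (1 + ‖x‖ + r)(1 + ‖y‖).
  refine h1.bdd_mul (c := (1 + ‖x‖ + r) ^ a)
    ((hc _).mul ((hc a).comp hcomp)).aestronglyMeasurable (.of_forall fun y => ?_)
  rw [← Complex.ofReal_mul, Complex.norm_real, Real.norm_of_nonneg (by positivity),
    Real.rpow_neg (by positivity), inv_mul_le_iff₀ (by positivity),
    ← Real.mul_rpow (by positivity) (by positivity)]
  refine Real.rpow_le_rpow (by positivity) ?_ ha
  have h3 := norm_sub_le x (r • y)
  rw [norm_smul, Real.norm_of_nonneg hr.le] at h3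
  nlinarith [norm_nonneg x, norm_nonneg y, mul_nonneg (norm_nonneg x) (norm_nonneg y)]

theorem integrableOn_ball_norm_rpow_neg {a : ℝ} (hn : 0 < n) (ha : a < n) (r : ℝ) :
    IntegrableOn (fun z : Rn n => ‖z‖ ^ (-a)) (Metric.ball 0 r) := by
  have : Nonempty (Fin n) := ⟨⟨0, hn⟩⟩
  rw [integrableOn_fun_norm_addHaar (volume : Measure (Rn n)) (f := fun t => t ^ (-a)),
    finrank_euclideanSpace_fin]
  rcases le_or_gt r 0 with hr | hr
  · simp [Set.Ioo_eq_empty (not_lt.2 hr)]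
  have h := (intervalIntegral.intervalIntegrable_rpow' (a := 0) (b := r) (r := n - 1 - a)
    (by linarith)).1
  rw [integrableOn_Ioc_iff_integrableOn_Ioo] at h
  refine h.congr_fun (fun t ht => ?_) measurableSet_Ioo
  simp only [smul_eq_mul]
  rw [← Real.rpow_natCast, ← Real.rpow_add ht.1]
  congr 1
  rw [Nat.cast_sub hn]
  simp; ring

theorem locallyIntegrable_norm_rpow_neg {a : ℝ} (hn : 0 < n) (ha : a < n) :
    LocallyIntegrable fun z : Rn n => ‖z‖ ^ (-a) := by
  rw [locallyIntegrable_iff]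
  intro K hK
  obtain ⟨r, hr⟩ := hK.isBounded.subset_ball 0
  exact (integrableOn_ball_norm_rpow_neg hn ha r).mono_set hr

theorem norm_rpow_neg_le_indicator_add {a : ℝ} (ha : 0 ≤ a) (z : Rn n) :
    ‖z‖ ^ (-a) ≤ (Metric.ball (0 : Rn n) 1).indicator (fun z => ‖z‖ ^ (-a)) z +
      2 ^ a * (1 + ‖z‖) ^ (-a) := by
  by_cases hz : z ∈ Metric.ball (0 : Rn n) 1
  · rw [Set.indicator_of_mem hz]
    have : 0 ≤ 2 ^ a * (1 + ‖z‖) ^ (-a) := by positivity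
    linarith
  · rw [Set.indicator_of_notMem hz, zero_add]
    rw [mem_ball_zero_iff, not_lt] at hz
    have h0 : 0 < ‖z‖ := by linarith
    have := Real.rpow_le_rpow (by positivity) (show 1 + ‖z‖ ≤ 2 * ‖z‖ by linarith) ha
    rw [Real.mul_rpow (by norm_num) h0.le] at this
    rw [Real.rpow_neg h0.le, Real.rpow_neg (by positivity), ← div_eq_mul_inv, inv_eq_one_div,
      div_le_div_iff₀ (by positivity) (by positivity)]
    linarith

/-- The exponent n + 1 + a leaves the weight integrable after multiplication by (1 + ‖x‖)^a. The
Riesz kernel splits into an integrable part on the unit ball and a tail comparable to (1 +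
‖z‖)^(-a); Peetre's inequality applies to both. -/
theorem integral_norm_rpow_neg_sub_le {a : ℝ} (hn : 0 < n) (ha : 0 ≤ a) (han : a < n) :
    ∃ C, ∀ w : Rn n, Integrable (fun x : Rn n => ‖x - w‖ ^ (-a) * (1 + ‖x‖) ^ (-(n + 1 + a))) ∧
      ∫ x : Rn n, ‖x - w‖ ^ (-a) * (1 + ‖x‖) ^ (-(n + 1 + a)) ≤ C * (1 + ‖w‖) ^ (-a) := by
  set k₁ : Rn n → ℝ := (Metric.ball (0 : Rn n) 1).indicator fun z => ‖z‖ ^ (-a) with hk₁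
  set v : Rn n → ℝ := fun x => (1 + ‖x‖) ^ (-(n + 1 + a)) with hv
  have hvc : Continuous v := continuous_one_add_norm_rpow _
  have hk₁0 : ∀ z, 0 ≤ k₁ z := fun z => Set.indicator_nonneg (fun z _ => by positivity) z
  have hk₁I : Integrable k₁ :=
    (integrableOn_ball_norm_rpow_neg hn han 1).integrable_indicator measurableSet_ball
  have hk₁W : Integrable fun z => ‖k₁ z‖ * (1 + ‖z‖) ^ a := by
    refine (hk₁I.const_mul (2 ^ a)).mono' (hk₁I.1.norm.mul
      (continuous_one_add_norm_rpow a).aestronglyMeasurable) (.of_forall fun z => ?_)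
    rw [Real.norm_of_nonneg (by positivity), Real.norm_of_nonneg (hk₁0 z), mul_comm]
    by_cases hz : z ∈ Metric.ball (0 : Rn n) 1
    · have := mem_ball_zero_iff.1 hz
      exact mul_le_mul_of_nonneg_right (Real.rpow_le_rpow (by positivity) (by linarith) ha)
        (hk₁0 z)
    · simp [hk₁, Set.indicator_of_notMem hz]
  have hv0 : ∀ x, 0 ≤ v x := fun x => by positivity
  have hv1 : ∀ x, ‖v x‖ ≤ 1 * (1 + ‖x‖) ^ (-a) := fun x => by
    rw [Real.norm_of_nonneg (hv0 x), one_mul]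
    exact Real.rpow_le_rpow_of_exponent_le (by linarith [norm_nonneg x])
      (by linarith [(Nat.cast_nonneg n : (0 : ℝ) ≤ n)])
  have hvW : Integrable fun x => ‖v x‖ * (1 + ‖x‖) ^ a := by
    have h : Integrable fun y : Rn n => (1 + ‖y‖) ^ (-((n : ℝ) + 1)) :=
      integrable_one_add_norm (by rw [finrank_euclideanSpace_fin]; linarith)
    refine h.congr (.of_forall fun y => ?_)
    simp only
    rw [Real.norm_of_nonneg (hv0 y), ← Real.rpow_add (by positivity)]
    congr 1; ring
  have hvI : Integrable v := by
    refine hvW.mono' hvc.aestronglyMeasurable (.of_forall fun z => ?_)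
    exact le_mul_of_one_le_right (norm_nonneg _)
      (Real.one_le_rpow (by linarith [norm_nonneg z]) ha)
  set b : Rn n → ℝ := fun z => (1 + ‖z‖) ^ (-a) with hb
  have hb0 : ∀ z, 0 ≤ b z := fun z => by positivity
  have hb1 : ∀ z, b z ≤ 1 := fun z =>
    Real.rpow_le_one_of_one_le_of_nonpos (by linarith [norm_nonneg z]) (by linarith)
  refine ⟨1 * (∫ z, ‖k₁ z‖ * (1 + ‖z‖) ^ a) + 2 ^ a * (1 * ∫ z, ‖v z‖ * (1 + ‖z‖) ^ a),
    fun w => ?_⟩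
  have hI1 : Integrable fun x => k₁ (x - w) * v x := by
    refine (hk₁I.comp_sub_right w).mul_bdd (c := 1) hvc.aestronglyMeasurable
      (.of_forall fun x => (hv1 x).trans ?_)
    rw [one_mul]; exact hb1 x
  have hI2 : Integrable fun x => 2 ^ a * (b (x - w) * v x) := by
    refine (hvI.bdd_mul (c := 1) (((continuous_one_add_norm_rpow (-a)).comp
      (continuous_id.sub continuous_const)).aestronglyMeasurable)
      (.of_forall fun x => ?_)).const_mul _
    change ‖b (x - w)‖ ≤ 1
    rw [Real.norm_of_nonneg (hb0 _)]
    exact hb1 _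
  have hle : ∀ x, ‖x - w‖ ^ (-a) * v x ≤ k₁ (x - w) * v x + 2 ^ a * (b (x - w) * v x) := by
    intro x
    have := mul_le_mul_of_nonneg_right (norm_rpow_neg_le_indicator_add ha (x - w)) (hv0 x)
    linarith
  have hmeas : AEStronglyMeasurable (fun x : Rn n => ‖x - w‖ ^ (-a) * v x) :=
    (((continuous_id.sub continuous_const).norm.measurable.pow_const (-a)).mul
      hvc.measurable).aestronglyMeasurable
  refine ⟨(hI1.add hI2).mono' hmeas (.of_forall fun x => ?_), ?_⟩
  · rw [Real.norm_of_nonneg (by positivity)]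
    exact hle x
  calc ∫ x, ‖x - w‖ ^ (-a) * v x
      ≤ ∫ x, (k₁ (x - w) * v x + 2 ^ a * (b (x - w) * v x)) :=
        integral_mono_of_nonneg (.of_forall fun x => by positivity) (hI1.add hI2)
          (.of_forall hle)
    _ = (∫ x, k₁ (x - w) * v x) + 2 ^ a * ∫ x, b (x - w) * v x := by
        rw [integral_add hI1 hI2, integral_const_mul]
    _ ≤ (1 * (∫ z, ‖k₁ z‖ * (1 + ‖z‖) ^ a) * (1 + ‖w‖) ^ (-a)) +
        2 ^ a * (1 * (∫ z, ‖v z‖ * (1 + ‖z‖) ^ a) * (1 + ‖w‖) ^ (-a)) := by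
        gcongr
        · refine le_trans (le_of_eq ?_)
            ((integral_norm_mul_norm_sub_le (b := fun y => v (-y)) (C := 1) ha hk₁W
            (fun y => by simpa using hv1 (-y)) (-w)).trans (by rw [norm_neg]))
          rw [← integral_sub_right_eq_self (fun x => k₁ (x - w) * v x) (-w)]
          congr 1; ext x
          rw [Real.norm_of_nonneg (hk₁0 _), Real.norm_of_nonneg (hv0 _)]
          congr 2 <;> abel
        · refine le_trans (le_of_eq ?_)
            (integral_norm_mul_norm_sub_le (b := b) ha hvW
            (fun y => by rw [Real.norm_of_nonneg (hb0 y), one_mul]) w)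
          congr 1; ext x
          rw [Real.norm_of_nonneg (hb0 _), Real.norm_of_nonneg (hv0 _), mul_comm, hb]
          simp only
          rw [norm_sub_rev]
    _ = _ := by ring

/-- Tonelli: after integration in x against the positive weight v, the double integral is bounded by
the weighted norm of g. Hence almost every slice is integrable, and v(x) can be divided out. -/
theorem ae_integrable_riesz {a : ℝ} (hn : 0 < n) (ha : 0 ≤ a) (han : a < n) {g : Rn n → ℂ}
    (hg : Integrable fun y => (((1 + ‖y‖) ^ (-a) : ℝ) : ℂ) * g y) :
    ∀ᵐ x : Rn n, Integrable fun z : Rn n => ((‖z‖ ^ (-a) : ℝ) : ℂ) * g (x - z) := by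
  obtain ⟨C, hC⟩ := integral_norm_rpow_neg_sub_le hn ha han
  have hgm : AEStronglyMeasurable g := by
    have hc : Continuous fun y : Rn n => (((1 + ‖y‖) ^ a : ℝ) : ℂ) :=
      Complex.continuous_ofReal.comp (continuous_one_add_norm_rpow _)
    refine (hc.aestronglyMeasurable.mul hg.1).congr (.of_forall fun y => ?_)
    simp only [Pi.mul_apply]
    rw [← mul_assoc, ← Complex.ofReal_mul, ← Real.rpow_add (by positivity)]
    simp
  set v : Rn n → ℝ := fun x => (1 + ‖x‖) ^ (-(n + 1 + a)) with hv
  have hv0 : ∀ x, 0 < v x := fun x => by positivity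
  have hvc : Continuous v := continuous_one_add_norm_rpow _
  have hmeas : AEStronglyMeasurable (fun p : Rn n × Rn n =>
      ((‖p.1 - p.2‖ ^ (-a) * v p.1 : ℝ) : ℂ) * g p.2) (volume.prod volume) := by
    have h1 : Measurable fun p : Rn n × Rn n => ((‖p.1 - p.2‖ ^ (-a) * v p.1 : ℝ) : ℂ) :=
      Complex.measurable_ofReal.comp (((measurable_fst.sub measurable_snd).norm.pow_const _).mul
        (hvc.measurable.comp measurable_fst))
    exact h1.aestronglyMeasurable.mul hgm.comp_snd
  have hI : Integrable (fun p : Rn n × Rn n =>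
      ((‖p.1 - p.2‖ ^ (-a) * v p.1 : ℝ) : ℂ) * g p.2) (volume.prod volume) := by
    rw [integrable_prod_iff' hmeas]
    refine ⟨.of_forall fun w => ((hC w).1.ofReal (𝕜 := ℂ)).mul_const (g w), ?_⟩
    refine (hg.norm.const_mul C).mono' hmeas.norm.prod_swap.integral_prod_right' (.of_forall fun w => ?_)
    simp only [norm_mul, Complex.norm_real]
    rw [integral_mul_const, Real.norm_of_nonneg (by positivity),
      Real.norm_of_nonneg (show 0 ≤ (1 + ‖w‖) ^ (-a) by positivity), ← mul_assoc]
    refine mul_le_mul_of_nonneg_right ?_ (norm_nonneg _)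
    refine le_trans (le_of_eq ?_) (hC w).2
    congr 1; ext x
    rw [Real.norm_of_nonneg (by positivity), Real.norm_of_nonneg (by positivity)]
  filter_upwards [hI.prod_right_ae] with x hx
  have h1 : Integrable fun w => ((‖x - w‖ ^ (-a) : ℝ) : ℂ) * g w := by
    refine (hx.const_mul (((v x)⁻¹ : ℝ) : ℂ)).congr (.of_forall fun w => ?_)
    simp only
    rw [← mul_assoc, ← Complex.ofReal_mul]
    congr 2
    field_simp [(hv0 x).ne']
  refine (h1.comp_sub_left x).congr (.of_forall fun z => ?_)
  simp

end Weights

/-! ### Smooth frequency cutoffs and the high frequency Riesz kernel. -/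

section Cutoffs

open Set

variable {n : ℕ}

/-- A smooth function on the line, equal to `1` on `(-∞, 1]` and to `0` on `[2, ∞)`. -/
def cutoffProfile (u : ℝ) : ℝ := Real.smoothTransition (2 - u)

/-- A smooth radial cutoff, equal to `1` for `|ξ| ≤ s` and to `0` for `|ξ|² ≥ 2 s²`. -/
def cutoff (s : ℝ) (ξ : Rn n) : ℝ := cutoffProfile (‖ξ‖ ^ 2 / s ^ 2)

/-- A smooth radial function supported in `1 ≤ |ξ|² ≤ 2`, the logarithmic derivative in `s` of the
dilated cutoffs. -/
def annulus (ξ : Rn n) : ℝ := -2 * ‖ξ‖ ^ 2 * deriv cutoffProfile (‖ξ‖ ^ 2)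

theorem contDiff_cutoffProfile_infty {k : ℕ∞} : ContDiff ℝ k cutoffProfile :=
  Real.smoothTransition.contDiff.comp (contDiff_const.sub contDiff_id)

theorem contDiff_deriv_cutoffProfile {k : ℕ∞} : ContDiff ℝ k (deriv cutoffProfile) := by
  have h : ContDiff ℝ (⊤ : ℕ∞) cutoffProfile := contDiff_cutoffProfile_infty
  exact ((contDiff_infty_iff_deriv.1 h).2).of_le (by exact_mod_cast le_top)

theorem cutoffProfile_of_le {u : ℝ} (hu : u ≤ 1) : cutoffProfile u = 1 :=
  Real.smoothTransition.one_of_one_le (by linarith)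

theorem cutoffProfile_of_ge {u : ℝ} (hu : 2 ≤ u) : cutoffProfile u = 0 :=
  Real.smoothTransition.zero_of_nonpos (by linarith)

theorem deriv_cutoffProfile_of_lt {u : ℝ} (hu : u < 1) : deriv cutoffProfile u = 0 := by
  have : cutoffProfile =ᶠ[𝓝 u] fun _ => 1 := by
    filter_upwards [Iio_mem_nhds hu] with v hv using cutoffProfile_of_le (le_of_lt hv)
  rw [this.deriv_eq, deriv_const]

theorem deriv_cutoffProfile_of_gt {u : ℝ} (hu : 2 < u) : deriv cutoffProfile u = 0 := by
  have : cutoffProfile =ᶠ[𝓝 u] fun _ => 0 := by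
    filter_upwards [Ioi_mem_nhds hu] with v hv using cutoffProfile_of_ge (le_of_lt hv)
  rw [this.deriv_eq, deriv_const]

theorem cutoff_nonneg (s : ℝ) (ξ : Rn n) : 0 ≤ cutoff s ξ := Real.smoothTransition.nonneg _

theorem cutoff_le_one (s : ℝ) (ξ : Rn n) : cutoff s ξ ≤ 1 := Real.smoothTransition.le_one _

theorem cutoff_of_norm_le {s : ℝ} (hs : 0 < s) {ξ : Rn n} (h : ‖ξ‖ ≤ s) : cutoff s ξ = 1 :=
  cutoffProfile_of_le (by rw [div_le_one (by positivity)]; gcongr)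

theorem cutoff_of_le_norm {s : ℝ} (hs : 0 < s) {ξ : Rn n} (h : 3 / 2 * s ≤ ‖ξ‖) :
    cutoff s ξ = 0 :=
  cutoffProfile_of_ge (by rw [le_div_iff₀ (by positivity)]; nlinarith)

theorem annulus_of_norm_lt {ξ : Rn n} (h : ‖ξ‖ < 1) : annulus ξ = 0 := by
  rw [annulus, deriv_cutoffProfile_of_lt (by nlinarith [norm_nonneg ξ]), mul_zero]

theorem annulus_of_lt_norm {ξ : Rn n} (h : 3 / 2 ≤ ‖ξ‖) : annulus ξ = 0 := by
  rw [annulus, deriv_cutoffProfile_of_gt (by nlinarith [norm_nonneg ξ]), mul_zero]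

theorem annulus_neg (ξ : Rn n) : annulus (-ξ) = annulus ξ := by simp [annulus]

theorem contDiff_cutoff {k : ℕ∞} (s : ℝ) : ContDiff ℝ k (cutoff s : Rn n → ℝ) :=
  contDiff_cutoffProfile_infty.comp ((contDiff_norm_sq ℝ).div_const _)

theorem contDiff_annulus {k : ℕ∞} : ContDiff ℝ k (annulus : Rn n → ℝ) :=
  (contDiff_const.mul (contDiff_norm_sq ℝ)).mul
    (contDiff_deriv_cutoffProfile.comp (contDiff_norm_sq ℝ))

theorem hasCompactSupport_of_norm {E : Type*} [Zero E] {u : Rn n → E} {r : ℝ}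
    (h : ∀ ξ, r ≤ ‖ξ‖ → u ξ = 0) : HasCompactSupport u := by
  refine HasCompactSupport.intro (isCompact_closedBall (0 : Rn n) r) fun ξ hξ => h ξ ?_
  rw [mem_closedBall_zero_iff, not_le] at hξ
  exact hξ.le

/-- The inverse Fourier transform of the cutoff. -/
def lowPass (s : ℝ) (hs : 0 < s) : 𝓢(Rn n, ℂ) :=
  𝓕⁻ (HasCompactSupport.toSchwartzMap (f := fun ξ : Rn n => (cutoff s ξ : ℂ))
    (hasCompactSupport_of_norm (r := 3 / 2 * s) fun ξ h => by simp [cutoff_of_le_norm hs h])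
    (Complex.ofRealCLM.contDiff.comp (contDiff_cutoff (k := ⊤) s)))

theorem lowPass_eq {s : ℝ} (hs : 0 < s) :
    (lowPass s hs : Rn n → ℂ) = 𝓕⁻ fun ξ : Rn n => (cutoff s ξ : ℂ) := by
  rw [lowPass, SchwartzMap.fourierInv_coe]; rfl

theorem fourier_lowPass {s : ℝ} (hs : 0 < s) (ξ : Rn n) :
    𝓕 (lowPass s hs : Rn n → ℂ) ξ = (cutoff s ξ : ℂ) := by
  rw [← SchwartzMap.fourier_coe, lowPass, FourierTransform.fourier_fourierInv_eq]
  rfl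

theorem contDiff_mul_norm_rpow {k : ℕ∞} {u : Rn n → ℝ} (hu : ContDiff ℝ k u) {r : ℝ} (hr : 0 < r)
    (h0 : ∀ ξ, ‖ξ‖ < r → u ξ = 0) (a : ℝ) : ContDiff ℝ k fun ξ => u ξ * ‖ξ‖ ^ a := by
  rw [contDiff_iff_contDiffAt]
  intro ξ
  rcases eq_or_ne ξ 0 with rfl | hξ
  · have : (fun ξ => u ξ * ‖ξ‖ ^ a) =ᶠ[𝓝 0] fun _ => 0 := by
      filter_upwards [Metric.ball_mem_nhds (0 : Rn n) hr] with η hη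
      rw [h0 η (by simpa using hη), zero_mul]
    exact contDiffAt_const.congr_of_eventuallyEq this
  · exact hu.contDiffAt.mul
      ((contDiffAt_norm ℝ hξ).rpow_const_of_ne (norm_ne_zero_iff.2 hξ))

/-- The function `annulus ξ * |ξ|^(-a)`. -/
def annulusPow (a : ℝ) : 𝓢(Rn n, ℂ) :=
  HasCompactSupport.toSchwartzMap (f := fun ξ : Rn n => ((annulus ξ * ‖ξ‖ ^ (-a) : ℝ) : ℂ))
    (hasCompactSupport_of_norm (r := 3 / 2) fun ξ h => by simp [annulus_of_lt_norm h])
    (Complex.ofRealCLM.contDiff.comp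
      (contDiff_mul_norm_rpow (k := ⊤) contDiff_annulus one_pos (fun _ => annulus_of_norm_lt) _))

theorem annulusPow_apply (a : ℝ) (ξ : Rn n) :
    annulusPow a ξ = ((annulus ξ * ‖ξ‖ ^ (-a) : ℝ) : ℂ) := rfl

/-- The inverse Fourier transform of `annulus ξ * |ξ|^(-a)`. -/
def annulusKernel (a : ℝ) : 𝓢(Rn n, ℂ) := 𝓕⁻ (annulusPow a)

theorem fourier_annulusKernel (a : ℝ) (ξ : Rn n) :
    𝓕 (annulusKernel a : Rn n → ℂ) ξ = annulusPow a ξ := by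
  rw [← SchwartzMap.fourier_coe, annulusKernel, FourierTransform.fourier_fourierInv_eq]

theorem annulusKernel_neg (a : ℝ) (y : Rn n) : annulusKernel a (-y) = annulusKernel a y := by
  rw [annulusKernel, SchwartzMap.fourierInv_coe]
  exact fourierInv_even (fun ξ => by simp [annulusPow_apply, annulus_neg]) y

theorem annulusKernel_decay (a b : ℝ) (hb : 0 ≤ b) :
    ∃ C, 0 ≤ C ∧ ∀ y : Rn n, y ≠ 0 → ‖annulusKernel a y‖ ≤ C * ‖y‖ ^ (-b) := by
  obtain ⟨C, hC0, hC⟩ := schwartz_decay (annulusKernel a : 𝓢(Rn n, ℂ)) b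
  refine ⟨C, hC0, fun y hy => (hC y).trans ?_⟩
  refine mul_le_mul_of_nonneg_left ?_ hC0
  exact Real.rpow_le_rpow_of_nonpos (norm_pos_iff.2 hy) (by linarith) (by linarith)

theorem hasDerivAt_cutoff {σ : ℝ} (hσ : 0 < σ) (ξ : Rn n) :
    HasDerivAt (fun σ => cutoff σ ξ) (annulus (σ⁻¹ • ξ) / σ) σ := by
  have h1 : HasDerivAt (fun σ : ℝ => ‖ξ‖ ^ 2 / σ ^ 2) (-2 * ‖ξ‖ ^ 2 / σ ^ 3) σ := by
    have := (hasDerivAt_const σ (‖ξ‖ ^ 2)).div (hasDerivAt_pow 2 σ) (by positivity)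
    refine this.congr_deriv ?_
    field_simp
    push_cast
    ring
  have h2 : HasDerivAt cutoffProfile (deriv cutoffProfile (‖ξ‖ ^ 2 / σ ^ 2)) (‖ξ‖ ^ 2 / σ ^ 2) :=
    ((contDiff_cutoffProfile_infty (k := 1)).differentiable (by norm_num) _).hasDerivAt
  refine (h2.comp σ h1).congr_deriv ?_
  rw [annulus, norm_smul, norm_inv, Real.norm_of_nonneg hσ.le]
  have : (σ⁻¹ * ‖ξ‖) ^ 2 = ‖ξ‖ ^ 2 / σ ^ 2 := by field_simp
  rw [this]
  field_simp

theorem continuousOn_annulus_div (ξ : Rn n) :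
    ContinuousOn (fun σ : ℝ => annulus (σ⁻¹ • ξ) / σ) (Ioi 0) := by
  have h : Continuous (annulus : Rn n → ℝ) := (contDiff_annulus (k := 0)).continuous
  have h1 : ContinuousOn (fun σ : ℝ => σ⁻¹ • ξ) (Ioi 0) :=
    (continuousOn_inv₀.mono fun σ hσ => (ne_of_gt hσ)).smul continuousOn_const
  exact ContinuousOn.div (h.comp_continuousOn h1) continuousOn_id fun σ hσ => (ne_of_gt hσ)

theorem intervalIntegral_annulus {s t : ℝ} (hs : 0 < s) (hst : s ≤ t) (ξ : Rn n) :
    ∫ σ in Ioc s t, annulus (σ⁻¹ • ξ) / σ = cutoff t ξ - cutoff s ξ := by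
  rw [← intervalIntegral.integral_of_le hst]
  refine intervalIntegral.integral_eq_sub_of_hasDerivAt (f := fun σ => cutoff σ ξ) (fun σ hσ => ?_) ?_
  · rw [uIcc_of_le hst] at hσ
    exact hasDerivAt_cutoff (hs.trans_le hσ.1) ξ
  · refine ((continuousOn_annulus_div ξ).mono fun σ hσ => ?_).intervalIntegrable
    rw [uIcc_of_le hst] at hσ
    exact hs.trans_le hσ.1

theorem annulus_inv_smul_of_lt {σ : ℝ} (hσ : 0 < σ) {ξ : Rn n} (h : ‖ξ‖ < σ) :
    annulus (σ⁻¹ • ξ) = 0 :=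
  annulus_of_norm_lt (by
    rw [norm_smul, norm_inv, Real.norm_of_nonneg hσ.le, inv_mul_lt_iff₀ hσ]; linarith)

theorem annulus_inv_smul_of_gt {σ : ℝ} (hσ : 0 < σ) {ξ : Rn n} (h : 3 / 2 * σ ≤ ‖ξ‖) :
    annulus (σ⁻¹ • ξ) = 0 :=
  annulus_of_lt_norm (by
    rw [norm_smul, norm_inv, Real.norm_of_nonneg hσ.le, inv_mul_eq_div, le_div_iff₀ hσ]; exact h)

/-- The fundamental theorem of calculus in the scale: the cutoff has reached 1 once σ ≥ ‖ξ‖, and the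
integrand vanishes from there on. -/
theorem integral_Ioi_annulus {s : ℝ} (hs : 0 < s) (ξ : Rn n) :
    ∫ σ in Ioi s, annulus (σ⁻¹ • ξ) / σ = 1 - cutoff s ξ := by
  have ht : s ≤ max s ‖ξ‖ := le_max_left _ _
  have h := intervalIntegral_annulus hs ht ξ
  rw [cutoff_of_norm_le (hs.trans_le ht) (le_max_right _ _)] at h
  rw [← h]
  refine setIntegral_eq_of_subset_of_forall_sdiff_eq_zero measurableSet_Ioi Ioc_subset_Ioi_self
    fun σ hσ => ?_
  have h1 : max s ‖ξ‖ < σ := by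
    by_contra hc
    exact hσ.2 ⟨hσ.1, not_lt.1 hc⟩
  rw [annulus_inv_smul_of_lt (hs.trans hσ.1) ((le_max_right _ _).trans_lt h1), zero_div]

/-- For ξ ≠ 0 the cutoff vanishes at small scales, so there is no boundary term at σ = 0. At ξ = 0
the identity fails: the integrand is 0 while the cutoff is 1. -/
theorem integral_Ioc_annulus {s : ℝ} (hs : 0 < s) {ξ : Rn n} (hξ : ξ ≠ 0) :
    ∫ σ in Ioc 0 s, annulus (σ⁻¹ • ξ) / σ = cutoff s ξ := by
  have hξ' := norm_pos_iff.2 hξ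
  have ht : min s (‖ξ‖ / 2) ≤ s := min_le_left _ _
  have ht0 : 0 < min s (‖ξ‖ / 2) := lt_min hs (by positivity)
  have hle : min s (‖ξ‖ / 2) ≤ ‖ξ‖ / 2 := min_le_right _ _
  have h := intervalIntegral_annulus ht0 ht ξ
  rw [cutoff_of_le_norm (s := min s (‖ξ‖ / 2)) ht0 (by linarith), sub_zero] at h
  rw [← h]
  refine setIntegral_eq_of_subset_of_forall_sdiff_eq_zero measurableSet_Ioc
    (Ioc_subset_Ioc_left ht0.le) fun σ hσ => ?_
  have h1 : σ ≤ min s (‖ξ‖ / 2) := by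
    by_contra hc
    exact hσ.2 ⟨not_le.1 hc, hσ.1.2⟩
  rw [annulus_inv_smul_of_gt hσ.1.1 (by linarith), zero_div]

/-- The high frequency part of the kernel of the Riesz potential of order `a`: its Fourier
transform is `|ξ|^(-a) (1 - cutoff s ξ)`. -/
def highRiesz (a s : ℝ) (y : Rn n) : ℂ :=
  ∫ σ in Ioi s, ((σ ^ (n - a - 1) : ℝ) : ℂ) * annulusKernel a (σ • y)

theorem measurable_highRiesz_integrand (a : ℝ) :
    Measurable fun p : ℝ × Rn n => ((p.1 ^ (n - a - 1) : ℝ) : ℂ) * annulusKernel a (p.1 • p.2) :=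
  (Complex.measurable_ofReal.comp (measurable_fst.pow_const _)).mul
    ((annulusKernel a).continuous.measurable.comp (measurable_fst.smul measurable_snd))

/-- Dilation turns the k-th moment at scale σ into a constant times σ^(-a-1-k), which is integrable
at infinity because a > 0. Thus `highRiesz` has moments of all orders. -/
theorem integrable_highRiesz_prod {a s : ℝ} (ha : 0 < a) (hs : 0 < s) (k : ℕ) :
    Integrable (fun p : ℝ × Rn n =>
      ‖p.2‖ ^ k * ‖((p.1 ^ (n - a - 1) : ℝ) : ℂ) * annulusKernel a (p.1 • p.2)‖)
      ((volume.restrict (Ioi s)).prod volume) := by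
  have hm : Measurable fun p : ℝ × Rn n =>
      ‖p.2‖ ^ k * ‖((p.1 ^ (n - a - 1) : ℝ) : ℂ) * annulusKernel a (p.1 • p.2)‖ :=
    (measurable_snd.norm.pow_const k).mul (measurable_highRiesz_integrand a).norm
  have hq := schwartz_integrable_moment (annulusKernel a : 𝓢(Rn n, ℂ)) k
  set M := ∫ y : Rn n, ‖y‖ ^ k * ‖annulusKernel a y‖ with hM
  have key : ∀ σ : ℝ, 0 < σ → ∀ y : Rn n,
      ‖y‖ ^ k * ‖((σ ^ (n - a - 1) : ℝ) : ℂ) * annulusKernel a (σ • y)‖ =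
      (σ ^ (n - a - 1) * (σ ^ k)⁻¹) * (‖σ • y‖ ^ k * ‖annulusKernel a (σ • y)‖) := by
    intro σ hσ y
    rw [norm_mul, Complex.norm_real, Real.norm_of_nonneg (by positivity), norm_smul,
      Real.norm_of_nonneg hσ.le, mul_pow]
    field_simp
  rw [integrable_prod_iff hm.aestronglyMeasurable]
  constructor
  · filter_upwards [ae_restrict_mem measurableSet_Ioi] with σ hσ
    have hσ0 : 0 < σ := hs.trans hσ
    refine ((hq.comp_smul hσ0.ne').const_mul (σ ^ (n - a - 1) * (σ ^ k)⁻¹)).congr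
      (.of_forall fun y => ?_)
    exact (key σ hσ0 y).symm
  · have h1 : IntegrableOn (fun σ : ℝ => M * σ ^ (-a - 1 - k)) (Ioi s) :=
      (integrableOn_Ioi_rpow_of_lt (by linarith [(Nat.cast_nonneg k : (0 : ℝ) ≤ k)]) hs).const_mul _
    refine h1.congr_fun (fun σ hσ => ?_) measurableSet_Ioi
    have hσ0 : 0 < σ := hs.trans hσ
    simp only [norm_mul, norm_pow, norm_norm]
    simp only [norm_mul] at key
    simp_rw [key σ hσ0]
    rw [integral_const_mul, Measure.integral_comp_smul_of_nonneg (volume : Measure (Rn n))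
      (fun y => ‖y‖ ^ k * ‖annulusKernel a y‖) σ (hR := hσ0.le), finrank_euclideanSpace_fin, ← hM,
      smul_eq_mul, ← Real.rpow_natCast, ← Real.rpow_natCast, ← Real.rpow_neg hσ0.le,
      ← Real.rpow_neg hσ0.le, show -a - 1 - (k : ℝ) = (n - a - 1) + (-k) + (-n) by ring,
      Real.rpow_add hσ0, Real.rpow_add hσ0]
    ring

theorem integrable_highRiesz_uncurry {a s : ℝ} (ha : 0 < a) (hs : 0 < s) :
    Integrable (Function.uncurry fun (σ : ℝ) (y : Rn n) =>
      ((σ ^ (n - a - 1) : ℝ) : ℂ) * annulusKernel a (σ • y))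
      ((volume.restrict (Ioi s)).prod volume) := by
  refine (integrable_highRiesz_prod (n := n) ha hs 0).mono'
    (measurable_highRiesz_integrand a).aestronglyMeasurable (.of_forall fun p => ?_)
  simp [Function.uncurry]

theorem integrable_highRiesz {a s : ℝ} (ha : 0 < a) (hs : 0 < s) :
    Integrable (highRiesz a s : Rn n → ℂ) :=
  (integrable_highRiesz_uncurry ha hs).integral_prod_right

theorem integrable_highRiesz_moment {a s : ℝ} (ha : 0 < a) (hs : 0 < s) (k : ℕ) :
    Integrable fun y : Rn n => ‖y‖ ^ k * ‖highRiesz a s y‖ := by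
  refine (integrable_highRiesz_prod (n := n) ha hs k).integral_prod_right.mono'
    ((continuous_norm.pow k).aestronglyMeasurable.mul (integrable_highRiesz ha hs).1.norm)
    (.of_forall fun y => ?_)
  simp only
  rw [Real.norm_of_nonneg (by positivity), integral_const_mul]
  gcongr
  exact norm_integral_le_integral_norm _

theorem integrable_highRiesz_weight {a s : ℝ} (ha : 0 < a) (hs : 0 < s) (b : ℝ) :
    Integrable fun y : Rn n => ‖highRiesz a s y‖ * (1 + ‖y‖) ^ b :=
  integrable_weight_of_moments (integrable_highRiesz ha hs).1 (integrable_highRiesz_moment ha hs) b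

theorem fourier_highRiesz {a s : ℝ} (ha : 0 < a) (hs : 0 < s) (ξ : Rn n) :
    𝓕 (highRiesz a s : Rn n → ℂ) ξ = ((‖ξ‖ ^ (-a) * (1 - cutoff s ξ) : ℝ) : ℂ) := by
  unfold highRiesz
  rw [fourier_integral (integrable_highRiesz_uncurry ha hs), ← integral_Ioi_annulus hs,
    ← integral_const_mul, ← integral_complex_ofReal]
  refine setIntegral_congr_fun measurableSet_Ioi fun σ hσ => ?_
  have hσ0 : 0 < σ := hs.trans hσ
  have h1 : 𝓕 (fun y : Rn n => ((σ ^ (n - a - 1) : ℝ) : ℂ) * annulusKernel a (σ • y)) ξ =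
      ((σ ^ (n - a - 1) : ℝ) : ℂ) * 𝓕 (fun y : Rn n => annulusKernel a (σ • y)) ξ := by
    simp only [Real.fourier_eq, Circle.smul_def, smul_eq_mul]
    rw [← integral_const_mul]
    congr 1; ext y; ring
  rw [h1, fourier_comp_smul _ hσ0, fourier_annulusKernel, annulusPow_apply,
    ← Complex.ofReal_mul, ← Complex.ofReal_mul]
  congr 1
  rw [norm_smul, norm_inv, Real.norm_of_nonneg hσ0.le,
    Real.mul_rpow (by positivity) (norm_nonneg _), Real.inv_rpow hσ0.le, Real.rpow_neg hσ0.le,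
    inv_inv, ← Real.rpow_natCast]
  rw [show (n : ℝ) - a - 1 = n + (-a) + (-1) by ring, Real.rpow_add hσ0, Real.rpow_add hσ0,
    Real.rpow_neg hσ0.le a, Real.rpow_neg_one]
  field_simp

theorem hasTemperateGrowth_fourier_highRiesz {a s : ℝ} (ha : 0 < a) (hs : 0 < s) :
    (𝓕 (highRiesz a s : Rn n → ℂ)).HasTemperateGrowth :=
  hasTemperateGrowth_fourier (integrable_highRiesz ha hs).1 (integrable_highRiesz_moment ha hs)

theorem highRiesz_neg (a s : ℝ) (y : Rn n) : highRiesz a s (-y) = highRiesz a s y := by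
  simp [highRiesz, annulusKernel_neg]

theorem norm_highRiesz_integrand_le (a : ℝ) {b : ℝ} (hb : 0 ≤ b) :
    ∃ C, 0 ≤ C ∧ ∀ σ : ℝ, 0 < σ → ∀ y : Rn n, y ≠ 0 →
      ‖((σ ^ (n - a - 1) : ℝ) : ℂ) * annulusKernel a (σ • y)‖ ≤
        C * ‖y‖ ^ (-b) * σ ^ (n - a - 1 - b) := by
  obtain ⟨C, hC0, hC⟩ := annulusKernel_decay (n := n) a b hb
  refine ⟨C, hC0, fun σ hσ y hy => ?_⟩
  have h := hC (σ • y) (smul_ne_zero hσ.ne' hy)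
  rw [norm_smul, Real.norm_of_nonneg hσ.le, Real.mul_rpow hσ.le (norm_nonneg _)] at h
  rw [norm_mul, Complex.norm_real, Real.norm_of_nonneg (by positivity)]
  calc σ ^ (n - a - 1) * ‖annulusKernel a (σ • y)‖
      ≤ σ ^ (n - a - 1) * (C * (σ ^ (-b) * ‖y‖ ^ (-b))) := by gcongr
    _ = C * ‖y‖ ^ (-b) * (σ ^ (n - a - 1) * σ ^ (-b)) := by ring
    _ = _ := by rw [← Real.rpow_add hσ]; rfl

theorem integrableOn_highRiesz_integrand {a s : ℝ} (ha : 0 < a) (hs : 0 < s) {y : Rn n}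
    (hy : y ≠ 0) :
    IntegrableOn (fun σ : ℝ => ((σ ^ (n - a - 1) : ℝ) : ℂ) * annulusKernel a (σ • y)) (Ioi s) := by
  obtain ⟨C, hC0, hC⟩ := norm_highRiesz_integrand_le (n := n) a (Nat.cast_nonneg n)
  have h1 : IntegrableOn (fun σ : ℝ => C * ‖y‖ ^ (-(n : ℝ)) * σ ^ (n - a - 1 - n)) (Ioi s) :=
    (integrableOn_Ioi_rpow_of_lt (by linarith) hs).const_mul _
  refine h1.mono' ((measurable_highRiesz_integrand a).comp
    (measurable_id.prodMk measurable_const)).aestronglyMeasurable ?_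
  filter_upwards [ae_restrict_mem measurableSet_Ioi] with σ hσ
  exact hC σ (hs.trans hσ) y hy

/-- Bounding the Schwartz kernel by ‖σ y‖^(-b) leaves σ^(n-a-1-b), integrable at infinity exactly
when b > n - a. Every such b is allowed, so the bound controls both the singularity at 0 and the
decay. -/
theorem norm_highRiesz_le {a s b : ℝ} (hs : 0 < s) (hb : 0 ≤ b) (hab : n - a < b) :
    ∃ C, 0 ≤ C ∧ ∀ y : Rn n, y ≠ 0 → ‖highRiesz a s y‖ ≤ C * ‖y‖ ^ (-b) := by
  obtain ⟨C, hC0, hC⟩ := norm_highRiesz_integrand_le (n := n) a hb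
  refine ⟨C * ∫ σ in Ioi s, σ ^ (n - a - 1 - b), mul_nonneg hC0 (setIntegral_nonneg
    measurableSet_Ioi fun σ hσ => Real.rpow_nonneg (hs.trans hσ).le _), fun y hy => ?_⟩
  have h1 : IntegrableOn (fun σ : ℝ => C * ‖y‖ ^ (-b) * σ ^ (n - a - 1 - b)) (Ioi s) :=
    (integrableOn_Ioi_rpow_of_lt (by linarith) hs).const_mul _
  calc ‖highRiesz a s y‖ ≤ ∫ σ in Ioi s, C * ‖y‖ ^ (-b) * σ ^ (n - a - 1 - b) :=
        norm_integral_le_of_norm_le h1 (by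
          filter_upwards [ae_restrict_mem measurableSet_Ioi] with σ hσ
          exact hC σ (hs.trans hσ) y hy)
    _ = _ := by rw [integral_const_mul]; ring

theorem highRiesz_smul (a s : ℝ) {R : ℝ} (hR : 0 < R) (hs : 0 < s) (y : Rn n) :
    highRiesz a s (R • y) = ((R ^ (a - n) : ℝ) : ℂ) * highRiesz a (s * R) y := by
  have h := integral_comp_mul_right_Ioi
    (fun τ : ℝ => ((τ ^ (n - a - 1) : ℝ) : ℂ) * annulusKernel a (τ • y)) s hR
  rw [highRiesz, highRiesz, ← inv_smul_eq_iff₀ (inv_ne_zero hR.ne')] at *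
  rw [← h, inv_inv, Complex.real_smul, ← mul_assoc, ← Complex.ofReal_mul, ← integral_const_mul]
  refine setIntegral_congr_fun measurableSet_Ioi fun σ hσ => ?_
  have hσ0 : 0 < σ := hs.trans hσ
  rw [smul_smul, ← mul_assoc, ← Complex.ofReal_mul, Real.mul_rpow hσ0.le hR.le]
  congr 2
  have : R ^ (a - n) * R * R ^ (n - a - 1) = 1 := by
    nth_rw 2 [← Real.rpow_one R]
    rw [← Real.rpow_add hR, ← Real.rpow_add hR]
    ring_nf
    exact Real.rpow_zero R
  linear_combination (-σ ^ (n - a - 1)) * this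

theorem integrable_annulusPow_prod (a c : ℝ) {s t : ℝ} (hs : 0 < s) :
    Integrable (Function.uncurry fun (σ : ℝ) (ξ : Rn n) =>
      ((σ ^ c : ℝ) : ℂ) * annulusPow a (σ⁻¹ • ξ)) ((volume.restrict (Ioc s t)).prod volume) := by
  have hm : Measurable fun p : ℝ × Rn n => ((p.1 ^ c : ℝ) : ℂ) * annulusPow a (p.1⁻¹ • p.2) :=
    (Complex.measurable_ofReal.comp (measurable_fst.pow_const _)).mul
      ((annulusPow a).continuous.measurable.comp (measurable_fst.inv.smul measurable_snd))
  refine (integrable_prod_iff hm.aestronglyMeasurable).2 ?_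
  have hI : Integrable (annulusPow a : Rn n → ℂ) := (annulusPow a).integrable
  constructor
  · filter_upwards [ae_restrict_mem measurableSet_Ioc] with σ hσ
    exact (hI.comp_smul (inv_ne_zero (hs.trans hσ.1).ne')).const_mul _
  · have h1 : IntegrableOn (fun σ : ℝ => σ ^ c * σ ^ n * ∫ ξ : Rn n, ‖annulusPow a ξ‖)
        (Ioc s t) := by
      refine (ContinuousOn.integrableOn_Icc (a := s) (b := t) ?_).mono_set Ioc_subset_Icc_self
      refine ((continuousOn_id.rpow_const fun σ hσ => Or.inl (hs.trans_le hσ.1).ne').mul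
        (continuousOn_id.pow n)).mul continuousOn_const
    refine h1.congr_fun (fun σ hσ => ?_) measurableSet_Ioc
    have hσ0 : 0 < σ := hs.trans hσ.1
    have h2 := Measure.integral_comp_inv_smul_of_nonneg (volume : Measure (Rn n))
      (fun ξ => ‖annulusPow a ξ‖) hσ0.le
    rw [finrank_euclideanSpace_fin, smul_eq_mul] at h2
    simp only [norm_mul, Complex.norm_real]
    rw [integral_const_mul, h2, Real.norm_of_nonneg (by positivity), mul_assoc]

theorem annulusPow_inv_smul (a : ℝ) {σ : ℝ} (hσ : 0 < σ) (ξ : Rn n) :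
    ((σ ^ (-a - 1) : ℝ) : ℂ) * annulusPow a (σ⁻¹ • ξ) =
      ((‖ξ‖ ^ (-a) * (annulus (σ⁻¹ • ξ) / σ) : ℝ) : ℂ) := by
  rw [annulusPow_apply, ← Complex.ofReal_mul]
  congr 1
  rw [norm_smul, norm_inv, Real.norm_of_nonneg hσ.le,
    Real.mul_rpow (by positivity) (norm_nonneg _), Real.inv_rpow hσ.le, Real.rpow_neg hσ.le,
    inv_inv, show -a - 1 = (-a) + (-1) by ring, Real.rpow_add hσ, Real.rpow_neg hσ.le a,
    Real.rpow_neg_one]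
  field_simp

/-- The difference only involves scales in (s, t], where Fubini on the Fourier side is harmless. The
point y = 0 is excluded because the two defining integrals may diverge there. -/
theorem highRiesz_sub {a s t : ℝ} (ha : 0 < a) (hs : 0 < s) (hst : s ≤ t) {y : Rn n}
    (hy : y ≠ 0) :
    highRiesz a s y - highRiesz a t y =
      𝓕⁻ (fun ξ : Rn n => ((‖ξ‖ ^ (-a) * (cutoff t ξ - cutoff s ξ) : ℝ) : ℂ)) y := by
  have h1 : (fun ξ : Rn n => ((‖ξ‖ ^ (-a) * (cutoff t ξ - cutoff s ξ) : ℝ) : ℂ)) =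
      fun ξ => ∫ σ in Ioc s t, ((σ ^ (-a - 1) : ℝ) : ℂ) * annulusPow a (σ⁻¹ • ξ) := by
    ext ξ
    rw [← intervalIntegral_annulus hs hst, ← integral_const_mul, ← integral_complex_ofReal]
    exact setIntegral_congr_fun measurableSet_Ioc fun σ hσ =>
      (annulusPow_inv_smul a (hs.trans hσ.1) ξ).symm
  rw [h1, fourierInv_integral (integrable_annulusPow_prod a (-a - 1) hs), highRiesz, highRiesz,
    sub_eq_iff_eq_add, ← Ioc_union_Ioi_eq_Ioi hst, setIntegral_union
      (Ioc_disjoint_Ioi le_rfl) measurableSet_Ioi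
      ((integrableOn_highRiesz_integrand ha hs hy).mono_set Ioc_subset_Ioi_self)
      (integrableOn_highRiesz_integrand ha (hs.trans_le hst) hy)]
  congr 1
  refine setIntegral_congr_fun measurableSet_Ioc fun σ hσ => ?_
  have hσ0 : 0 < σ := hs.trans hσ.1
  have h2 : 𝓕⁻ (fun ξ : Rn n => ((σ ^ (-a - 1) : ℝ) : ℂ) * annulusPow a (σ⁻¹ • ξ)) y =
      ((σ ^ (-a - 1) : ℝ) : ℂ) * 𝓕⁻ (fun ξ : Rn n => annulusPow a (σ⁻¹ • ξ)) y := by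
    simp only [Real.fourierInv_eq, Circle.smul_def, smul_eq_mul]
    rw [← integral_const_mul]
    congr 1; ext y; ring
  rw [h2, fourierInv_comp_inv_smul _ hσ0, annulusKernel, SchwartzMap.fourierInv_coe, ← mul_assoc,
    ← Complex.ofReal_mul]
  congr 2
  rw [← Real.rpow_natCast, ← Real.rpow_add hσ0]
  congr 1
  ring

theorem lowPass_neg {s : ℝ} (hs : 0 < s) (y : Rn n) :
    lowPass s hs (-y) = lowPass s hs y := by
  rw [lowPass_eq]
  exact fourierInv_even (fun ξ => by simp [cutoff]) y

theorem lowPass_smul {s R : ℝ} (hs : 0 < s) (hR : 0 < R) (y : Rn n) :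
    lowPass (s * R) (mul_pos hs hR) y = ((R ^ n : ℝ) : ℂ) * lowPass s hs (R • y) := by
  rw [lowPass_eq, lowPass_eq, ← fourierInv_comp_inv_smul _ hR]
  refine congrArg (fun u : Rn n → ℂ => 𝓕⁻ u y) (funext fun ξ => ?_)
  simp only [cutoff]
  rw [norm_smul, norm_inv, Real.norm_of_nonneg hR.le]
  congr 2
  field_simp

end Cutoffs

/-! ### Decay of the transform of (1 - |ξ|²)₊^δ through Bessel's equation. -/

section BallKernel

open Real Set

/-- The truncated cosine transform of `w`, with phase `θ`. -/
def cosTransform (w : ℝ → ℝ) (θ r : ℝ) : ℝ := ∫ s in (-1)..1, w s * cos (r * s + θ)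

theorem hasDerivAt_cosTransform {w : ℝ → ℝ} (hw : Continuous w) (θ r : ℝ) :
    HasDerivAt (cosTransform w θ) (cosTransform (fun s => s * w s) (θ + π / 2) r) r := by
  refine (intervalIntegral.hasDerivAt_integral_of_dominated_loc_of_deriv_le
    (F := fun r s => w s * cos (r * s + θ))
    (F' := fun r s => s * w s * cos (r * s + (θ + π / 2))) (bound := fun s => |s * w s|)
    univ_mem (.of_forall fun r => ?_) ?_ ?_ (.of_forall fun s _ r _ => ?_) ?_
    (.of_forall fun s _ r _ => ?_)).2
  · exact Continuous.aestronglyMeasurable (by fun_prop)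
  · exact Continuous.intervalIntegrable (by fun_prop) _ _
  · exact Continuous.aestronglyMeasurable (by fun_prop)
  · rw [norm_mul, Real.norm_eq_abs]
    exact mul_le_of_le_one_right (abs_nonneg _) (abs_cos_le_one _)
  · exact Continuous.intervalIntegrable (by fun_prop) _ _
  · have h1 : HasDerivAt (fun r => r * s + θ) s r := by
      simpa using ((hasDerivAt_id r).mul_const s).add_const θ
    refine (h1.cos.const_mul (w s)).congr_deriv ?_
    rw [← add_assoc, cos_add_pi_div_two]
    ring

/-- The profile `(1 - s²)₊ ^ a`. -/
def ballProfile (a s : ℝ) : ℝ := (max (1 - s ^ 2) 0) ^ a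

theorem continuous_ballProfile {a : ℝ} (ha : 0 ≤ a) : Continuous (ballProfile a) :=
  Continuous.rpow_const (by fun_prop) fun _ => Or.inr ha

/-- Bessel's equation, from one integration by parts: the derivative of (1 - s²)^(a+1) is a multiple
of s(1 - s²)^a, and the boundary terms vanish at ±1. Shifting the phase by π/2 encodes
differentiation in r. -/
theorem cosTransform_ballProfile_ode {a : ℝ} (ha : 0 ≤ a) (θ r : ℝ) :
    r * (cosTransform (ballProfile a) θ r +
        cosTransform (fun s => s * (s * ballProfile a s)) (θ + π / 2 + π / 2) r) =
      -2 * (a + 1) * cosTransform (fun s => s * ballProfile a s) (θ + π / 2) r := by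
  have hwc := continuous_ballProfile ha
  have hu : ∀ s ∈ uIcc (-1 : ℝ) 1, HasDerivAt (fun s : ℝ => (1 - s ^ 2) ^ (a + 1))
      (-2 * s * (a + 1) * (1 - s ^ 2) ^ a) s := by
    intro s _
    have h1 : HasDerivAt (fun s : ℝ => 1 - s ^ 2) (-2 * s) s := by
      simpa using (hasDerivAt_pow 2 s).const_sub 1
    simpa using h1.rpow_const (p := a + 1) (Or.inr (by linarith))
  have hv : ∀ s ∈ uIcc (-1 : ℝ) 1, HasDerivAt (fun s : ℝ => cos (r * s + (θ + π / 2)))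
      (-r * cos (r * s + θ)) s := by
    intro s _
    have h1 : HasDerivAt (fun s => r * s + (θ + π / 2)) r s := by
      simpa using ((hasDerivAt_id s).const_mul r).add_const (θ + π / 2)
    refine h1.cos.congr_deriv ?_
    rw [← add_assoc, sin_add_pi_div_two]
    ring
  have hc : Continuous fun s : ℝ => (1 - s ^ 2) ^ a :=
    Continuous.rpow_const (by fun_prop) fun _ => Or.inr ha
  have h := intervalIntegral.integral_mul_deriv_eq_deriv_mul hu hv
    (Continuous.intervalIntegrable (by fun_prop) _ _)
    (Continuous.intervalIntegrable (by fun_prop) _ _)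
  have h0 : (0 : ℝ) ^ (a + 1) = 0 := zero_rpow (by linarith)
  norm_num [h0] at h
  have e1 : (∫ s in (-1 : ℝ)..1, (1 - s ^ 2) ^ (a + 1) * (r * cos (r * s + θ))) =
      r * (cosTransform (ballProfile a) θ r +
        cosTransform (fun s => s * (s * ballProfile a s)) (θ + π / 2 + π / 2) r) := by
    rw [cosTransform, cosTransform, ← intervalIntegral.integral_add
      (Continuous.intervalIntegrable (by fun_prop) _ _)
      (Continuous.intervalIntegrable (by fun_prop) _ _), ← intervalIntegral.integral_const_mul]
    refine intervalIntegral.integral_congr fun s hs => ?_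
    rw [uIcc_of_le (by norm_num)] at hs
    have h1 : 0 ≤ 1 - s ^ 2 := by nlinarith [hs.1, hs.2]
    simp only [ballProfile, max_eq_left h1]
    rw [← add_assoc, ← add_assoc, cos_add_pi_div_two, sin_add_pi_div_two,
      rpow_add_one' h1 (by linarith)]
    ring
  have e2 : (∫ s in (-1 : ℝ)..1, 2 * s * (a + 1) * (1 - s ^ 2) ^ a * cos (r * s + (θ + π / 2))) =
      2 * (a + 1) * cosTransform (fun s => s * ballProfile a s) (θ + π / 2) r := by
    rw [cosTransform, ← intervalIntegral.integral_const_mul]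
    refine intervalIntegral.integral_congr fun s hs => ?_
    rw [uIcc_of_le (by norm_num)] at hs
    have h1 : 0 ≤ 1 - s ^ 2 := by nlinarith [hs.1, hs.2]
    simp only [ballProfile, max_eq_left h1]
    ring
  rw [e1, e2] at h
  linarith

/-- Here (u² + v²)' = 2uv c/r² ≤ (u² + v²) c/r², so the energy times exp(c/r) decreases. The
perturbation c/r² is integrable at infinity, hence the factor stays between 1 and e^c. -/
theorem bounded_of_perturbed_oscillator {u v : ℝ → ℝ} {c : ℝ} (hc : 0 ≤ c)
    (hu : ∀ r, 1 ≤ r → HasDerivAt u (v r) r)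
    (hv : ∀ r, 1 ≤ r → HasDerivAt v ((c / r ^ 2 - 1) * u r) r) :
    ∃ C, ∀ r, 1 ≤ r → |u r| ≤ C := by
  set H : ℝ → ℝ := fun r => (u r ^ 2 + v r ^ 2) * exp (c / r) with hH
  have hd : ∀ r, 1 ≤ r → HasDerivAt H
      ((2 * u r * v r * (c / r ^ 2) - (u r ^ 2 + v r ^ 2) * (c / r ^ 2)) * exp (c / r)) r := by
    intro r hr
    have hr0 : r ≠ 0 := by linarith
    have h1 := ((hu r hr).pow 2).add ((hv r hr).pow 2)
    have h2 : HasDerivAt (fun r => exp (c / r)) (exp (c / r) * (-c / r ^ 2)) r := by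
      have := (hasDerivAt_const r c).div (hasDerivAt_id r) hr0
      refine this.exp.congr_deriv ?_
      simp
    refine (h1.mul h2).congr_deriv ?_
    simp only [Pi.add_apply, Pi.pow_apply]
    push_cast
    ring
  have hanti : AntitoneOn H (Ici 1) := by
    refine antitoneOn_of_deriv_nonpos (convex_Ici 1)
      (fun r hr => (hd r hr).continuousAt.continuousWithinAt) (fun r hr => ?_) fun r hr => ?_
    · rw [interior_Ici] at hr
      exact (hd r (le_of_lt hr)).differentiableAt.differentiableWithinAt
    · rw [interior_Ici] at hr
      rw [(hd r (le_of_lt hr)).deriv]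
      refine mul_nonpos_of_nonpos_of_nonneg ?_ (exp_pos _).le
      have : 0 ≤ c / r ^ 2 := by positivity
      nlinarith [sq_nonneg (u r - v r)]
  refine ⟨sqrt (H 1), fun r hr => ?_⟩
  refine abs_le_sqrt ?_
  have h1 : H r ≤ H 1 := hanti self_mem_Ici hr hr
  have h2 : 1 ≤ exp (c / r) := one_le_exp (by positivity)
  refine le_trans ?_ h1
  simp only [hH]
  nlinarith [sq_nonneg (u r), sq_nonneg (v r)]

theorem cosTransform_ballProfile_decay {a : ℝ} (ha : 0 ≤ a) (θ : ℝ) :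
    ∃ C, ∀ r, 1 ≤ r → |cosTransform (ballProfile a) θ r| ≤ C * r ^ (-(a + 1)) := by
  have hwc := continuous_ballProfile ha
  set F := cosTransform (ballProfile a) θ with hF
  set F' := cosTransform (fun s => s * ballProfile a s) (θ + π / 2) with hF'
  set F'' := cosTransform (fun s => s * (s * ballProfile a s)) (θ + π / 2 + π / 2) with hF''
  have h1 : ∀ r, HasDerivAt F (F' r) r := fun r => hasDerivAt_cosTransform hwc θ r
  have h2 : ∀ r, HasDerivAt F' (F'' r) r := fun r =>
    hasDerivAt_cosTransform (continuous_id.mul hwc) _ r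
  have hode : ∀ r, r * (F r + F'' r) = -2 * (a + 1) * F' r := cosTransform_ballProfile_ode ha θ
  -- Liouville's substitution u = r^(a+1) F removes the first order term: u'' = (a(a+1)/r² - 1) u.
  obtain ⟨C, hC⟩ := bounded_of_perturbed_oscillator (c := a * (a + 1))
    (u := fun r => r ^ (a + 1) * F r)
    (v := fun r => (a + 1) * r ^ a * F r + r ^ (a + 1) * F' r) (by positivity)
    (fun r hr => by
      have h3 := hasDerivAt_rpow_const (x := r) (p := a + 1) (Or.inr (by linarith))
      refine (h3.mul (h1 r)).congr_deriv ?_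
      rw [add_sub_cancel_right])
    (fun r hr => by
      have hr0 : 0 < r := by linarith
      have h3 := hasDerivAt_rpow_const (x := r) (p := a + 1) (Or.inr (by linarith))
      have h4 := hasDerivAt_rpow_const (x := r) (p := a) (Or.inl hr0.ne')
      refine (((h4.const_mul (a + 1)).mul (h1 r)).add (h3.mul (h2 r))).congr_deriv ?_
      have h5 : F'' r = -2 * (a + 1) * F' r / r - F r := by
        rw [← hode r]; field_simp; ring
      have h6 : r ^ (a - 1) = r ^ a / r := rpow_sub_one hr0.ne' a
      have h7 : r ^ (a + 1) = r ^ a * r := rpow_add_one hr0.ne' a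
      rw [h5, h6, add_sub_cancel_right, h7]
      field_simp
      ring)
  refine ⟨C, fun r hr => ?_⟩
  have hr0 : 0 < r := by linarith
  have h := hC r hr
  rw [abs_mul, abs_of_nonneg (by positivity : 0 ≤ r ^ (a + 1))] at h
  rw [rpow_neg hr0.le, ← div_eq_mul_inv, le_div_iff₀ (by positivity), mul_comm]
  exact h

/-- The point of `ℝ × ℝᵏ` as a point of `ℝᵏ⁺¹`. -/
def consEquiv (k : ℕ) : ℝ × Rn k ≃ᵐ Rn (k + 1) :=
  ((MeasurableEquiv.refl ℝ).prodCongr (MeasurableEquiv.toLp 2 (Fin k → ℝ)).symm).trans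
    ((MeasurableEquiv.piFinSuccAbove (fun _ : Fin (k + 1) => ℝ) 0).symm.trans
      (MeasurableEquiv.toLp 2 (Fin (k + 1) → ℝ)))

theorem measurePreserving_consEquiv (k : ℕ) :
    MeasurePreserving (consEquiv k) (volume.prod volume) volume := by
  have h1 : MeasurePreserving (MeasurableEquiv.toLp 2 (Fin k → ℝ)).symm :=
    PiLp.volume_preserving_ofLp (Fin k)
  have h2 : MeasurePreserving (MeasurableEquiv.toLp 2 (Fin (k + 1) → ℝ)) :=
    PiLp.volume_preserving_toLp (Fin (k + 1))
  exact h2.comp (((volume_preserving_piFinSuccAbove (fun _ : Fin (k + 1) => ℝ) 0).symm).comp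
    ((MeasurePreserving.id volume).prod h1))

theorem consEquiv_zero {k : ℕ} (p : ℝ × Rn k) : consEquiv k p 0 = p.1 := by
  simp [consEquiv, MeasurableEquiv.piFinSuccAbove_symm_apply]
  rfl

theorem norm_sq_consEquiv {k : ℕ} (p : ℝ × Rn k) :
    ‖consEquiv k p‖ ^ 2 = p.1 ^ 2 + ‖p.2‖ ^ 2 := by
  rw [EuclideanSpace.norm_sq_eq, EuclideanSpace.norm_sq_eq, Fin.sum_univ_succ]
  simp [consEquiv, MeasurableEquiv.piFinSuccAbove_symm_apply]
  rfl

theorem norm_le_one_add_norm_rpow {n : ℕ} {u : Rn n → ℂ} {A B b : ℝ} (hb : 0 ≤ b)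
    (hA : ∀ y, ‖u y‖ ≤ A) (hB : ∀ y, 1 ≤ ‖y‖ → ‖u y‖ ≤ B * ‖y‖ ^ (-b)) :
    ∃ C, 0 ≤ C ∧ ∀ y, ‖u y‖ ≤ C * (1 + ‖y‖) ^ (-b) := by
  have hA0 : 0 ≤ A := (norm_nonneg _).trans (hA 0)
  refine ⟨max A B * 2 ^ b, mul_nonneg (hA0.trans (le_max_left _ _)) (by positivity), fun y => ?_⟩
  have hm : 0 ≤ max A B := hA0.trans (le_max_left _ _)
  rw [mul_assoc]
  rcases le_total ‖y‖ 1 with hy | hy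
  · refine (hA y).trans ((le_max_left A B).trans (le_mul_of_one_le_right hm ?_))
    rw [rpow_neg (by positivity), ← div_eq_mul_inv, one_le_div (by positivity)]
    exact rpow_le_rpow (by positivity) (by linarith) hb
  · have hy0 : 0 < ‖y‖ := by linarith
    refine (hB y hy).trans (mul_le_mul (le_max_right A B) ?_ (by positivity) hm)
    rw [rpow_neg hy0.le, rpow_neg (by positivity), ← div_eq_mul_inv, inv_eq_one_div,
      div_le_div_iff₀ (by positivity) (by positivity), one_mul, ← mul_rpow (by norm_num) hy0.le]
    exact rpow_le_rpow (by positivity) (by linarith) hb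

/-- Scaling η by √(1 - s²) produces the power δ from the profile and k/2 from the volume element. -/
theorem integral_ballProfile_slice (k : ℕ) {δ : ℝ} (hδ : 0 < δ) (s : ℝ) :
    ∫ η : Rn k, (max (1 - (s ^ 2 + ‖η‖ ^ 2)) 0) ^ δ =
      ballProfile (δ + k / 2) s * ∫ η : Rn k, ballProfile δ ‖η‖ := by
  rcases le_or_gt (1 - s ^ 2) 0 with hs | hs
  · rw [ballProfile, max_eq_right hs, zero_rpow (by positivity), zero_mul]
    refine integral_eq_zero_of_ae (.of_forall fun η => ?_)
    simp only [Pi.zero_apply]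
    rw [max_eq_right (by nlinarith [sq_nonneg ‖η‖]), zero_rpow hδ.ne']
  · set t := sqrt (1 - s ^ 2) with ht
    have ht0 : 0 < t := sqrt_pos.2 hs
    have ht2 : t ^ 2 = 1 - s ^ 2 := sq_sqrt hs.le
    have h := Measure.integral_comp_inv_smul_of_nonneg (volume : Measure (Rn k))
      (fun η => ballProfile δ ‖η‖) ht0.le
    rw [finrank_euclideanSpace_fin, smul_eq_mul] at h
    have h1 : ∀ η : Rn k, (max (1 - (s ^ 2 + ‖η‖ ^ 2)) 0) ^ δ =
        (t ^ 2) ^ δ * ballProfile δ ‖t⁻¹ • η‖ := by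
      intro η
      rw [ballProfile, ← mul_rpow (by positivity) (by positivity), mul_max_of_nonneg _ _
        (by positivity), mul_zero, norm_smul, norm_inv, Real.norm_of_nonneg ht0.le]
      congr 2
      field_simp
      rw [ht2]
      ring
    simp_rw [h1]
    rw [integral_const_mul, h, ← mul_assoc, ballProfile, max_eq_left hs.le, ← ht2]
    congr 1
    rw [rpow_add (by positivity), ← rpow_natCast t k, ← rpow_natCast t 2, ← rpow_mul ht0.le,
      ← rpow_mul ht0.le]
    congr 2
    push_cast
    ring

theorem ballProfile_norm_eq_zero {n : ℕ} {δ : ℝ} (hδ : 0 < δ) {ξ : Rn n} (h : 1 ≤ ‖ξ‖) :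
    ballProfile δ ‖ξ‖ = 0 := by
  rw [ballProfile, max_eq_right (by nlinarith), zero_rpow hδ.ne']

theorem integrable_ballProfile_norm (n : ℕ) {δ : ℝ} (hδ : 0 < δ) :
    Integrable fun ξ : Rn n => ((ballProfile δ ‖ξ‖ : ℝ) : ℂ) :=
  (Complex.continuous_ofReal.comp ((continuous_ballProfile hδ.le).comp
    continuous_norm)).integrable_of_hasCompactSupport
    (hasCompactSupport_of_norm (r := 1) fun ξ h => by simp [ballProfile_norm_eq_zero hδ h])

theorem exists_linearIsometryEquiv_apply_eq {n : ℕ} {v w : Rn n} (h : ‖v‖ = ‖w‖) :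
    ∃ A : Rn n ≃ₗᵢ[ℝ] Rn n, A v = w :=
  ⟨(Submodule.span ℝ {v - w})ᗮ.reflection, Submodule.reflection_sub h⟩

/-- Integrating over hyperplanes orthogonal to the first axis leaves a one-dimensional transform.
The sine part is written as a cosine with phase -π/2, so that one decay estimate serves both parts.
-/
theorem fourierInv_ballProfile_single (k : ℕ) {δ : ℝ} (hδ : 0 < δ) (r : ℝ) :
    𝓕⁻ (fun ξ : Rn (k + 1) => ((ballProfile δ ‖ξ‖ : ℝ) : ℂ)) (EuclideanSpace.single 0 r) =
      (∫ η : Rn k, ballProfile δ ‖η‖ : ℝ) *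
        ((cosTransform (ballProfile (δ + k / 2)) 0 (2 * π * r) : ℂ) +
        (cosTransform (ballProfile (δ + k / 2)) (-(π / 2)) (2 * π * r) : ℂ) * Complex.I) := by
  set a := δ + k / 2 with ha
  have ha0 : 0 ≤ a := by positivity
  have hI := (Real.fourierIntegral_convergent_iff (-EuclideanSpace.single 0 r)).2
    (integrable_ballProfile_norm (k + 1) hδ)
  simp only [inner_neg_right, neg_neg] at hI
  have hmp := measurePreserving_consEquiv k
  rw [← hmp.integrable_comp_emb (consEquiv k).measurableEmbedding] at hI
  simp only [Function.comp_def] at hI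
  rw [fourierInv_eq, ← hmp.integral_comp (consEquiv k).measurableEmbedding,
    integral_prod _ hI]
  have h1 : ∀ (s : ℝ) (η : Rn k),
      (𝐞 (inner ℝ (consEquiv k (s, η)) (EuclideanSpace.single 0 r)) •
        ((ballProfile δ ‖consEquiv k (s, η)‖ : ℝ) : ℂ)) =
      Complex.exp (((2 * π * r * s : ℝ) : ℂ) * Complex.I) *
        (((max (1 - (s ^ 2 + ‖η‖ ^ 2)) 0) ^ δ : ℝ) : ℂ) := by
    intro s η
    rw [EuclideanSpace.inner_single_right, consEquiv_zero, ballProfile, norm_sq_consEquiv,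
      Circle.smul_def, Real.fourierChar_apply, smul_eq_mul]
    simp [mul_assoc]
  simp_rw [h1]
  simp_rw [integral_const_mul, integral_complex_ofReal, integral_ballProfile_slice k hδ]
  rw [← ha]
  have h2 : ∀ s : ℝ, Complex.exp (((2 * π * r * s : ℝ) : ℂ) * Complex.I) *
        ((ballProfile a s * ∫ η : Rn k, ballProfile δ ‖η‖ : ℝ) : ℂ) =
      (∫ η : Rn k, ballProfile δ ‖η‖ : ℝ) *
        (((ballProfile a s * cos (2 * π * r * s + 0) : ℝ) : ℂ) +
        ((ballProfile a s * cos (2 * π * r * s + -(π / 2)) : ℝ) : ℂ) * Complex.I) := by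
    intro s
    rw [Complex.exp_mul_I, ← Complex.ofReal_cos, ← Complex.ofReal_sin, add_zero,
      ← sub_eq_add_neg, cos_sub_pi_div_two]
    push_cast
    ring
  simp_rw [h2]
  rw [integral_const_mul]
  congr 1
  have hsupp : ∀ g : ℝ → ℝ, ∫ s : ℝ, ballProfile a s * g s =
      ∫ s in (-1 : ℝ)..1, ballProfile a s * g s := by
    intro g
    rw [intervalIntegral.integral_of_le (by norm_num), ← integral_indicator measurableSet_Ioc]
    congr 1; ext s
    by_cases hs : s ∈ Ioc (-1 : ℝ) 1
    · rw [indicator_of_mem hs]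
    · rw [indicator_of_notMem hs, ballProfile, max_eq_right, zero_rpow (by positivity), zero_mul]
      rw [mem_Ioc, not_and_or, not_lt, not_le] at hs
      rcases hs with hs | hs <;> nlinarith
  have hint : ∀ θ : ℝ, Integrable fun s : ℝ => ballProfile a s * cos (2 * π * r * s + θ) := by
    intro θ
    have hc := continuous_ballProfile ha0
    refine Continuous.integrable_of_hasCompactSupport (by fun_prop)
      (HasCompactSupport.intro (isCompact_Icc (a := -1) (b := 1)) fun s hs => ?_)
    rw [ballProfile, max_eq_right, zero_rpow (by positivity), zero_mul]
    rw [mem_Icc, not_and_or, not_le, not_le] at hs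
    rcases hs with hs | hs <;> nlinarith
  rw [integral_add (hint _).ofReal ((hint _).ofReal.mul_const _), integral_mul_const,
    integral_complex_ofReal, integral_complex_ofReal, hsupp, hsupp]
  rfl

theorem fourierInv_ballProfile_decay {n : ℕ} (hn : 0 < n) {δ : ℝ} (hδ : 0 < δ) :
    ∃ C, 0 ≤ C ∧ ∀ y : Rn n, ‖𝓕⁻ (fun ξ : Rn n => ((ballProfile δ ‖ξ‖ : ℝ) : ℂ)) y‖ ≤
      C * (1 + ‖y‖) ^ (-(δ + (n + 1) / 2)) := by
  obtain ⟨k, rfl⟩ : ∃ k, n = k + 1 := ⟨n - 1, by omega⟩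
  set a := δ + k / 2 with ha
  have ha0 : 0 ≤ a := by positivity
  have hexp : δ + ((k + 1 : ℕ) + 1) / 2 = a + 1 := by push_cast; rw [ha]; ring
  rw [hexp]
  obtain ⟨C₁, hC₁⟩ := cosTransform_ballProfile_decay ha0 0
  obtain ⟨C₂, hC₂⟩ := cosTransform_ballProfile_decay ha0 (-(π / 2))
  set c : ℝ := ∫ η : Rn k, ballProfile δ ‖η‖ with hc
  refine norm_le_one_add_norm_rpow (by positivity) (norm_fourierInv_le_integral _)
    (B := |c| * ((C₁ + C₂) * (2 * π) ^ (-(a + 1)))) fun y hy => ?_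
  -- By radial symmetry y may be moved to the first axis.
  obtain ⟨A, hA⟩ := exists_linearIsometryEquiv_apply_eq
    (v := y) (w := EuclideanSpace.single (0 : Fin (k + 1)) ‖y‖) (by simp)
  have h1 := fourierInv_comp_linearIsometry A
    (fun ξ : Rn (k + 1) => ((ballProfile δ ‖ξ‖ : ℝ) : ℂ)) y
  have h2 : (fun ξ : Rn (k + 1) => ((ballProfile δ ‖ξ‖ : ℝ) : ℂ)) ∘ A =
      fun ξ : Rn (k + 1) => ((ballProfile δ ‖ξ‖ : ℝ) : ℂ) := by
    ext ξ; simp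
  rw [h2, hA, fourierInv_ballProfile_single k hδ] at h1
  rw [h1, norm_mul, Complex.norm_real, Real.norm_eq_abs, mul_assoc |c|]
  refine mul_le_mul_of_nonneg_left ?_ (abs_nonneg c)
  have hr : 1 ≤ 2 * π * ‖y‖ := by nlinarith [pi_gt_three]
  have e1 := hC₁ _ hr
  have e2 := hC₂ _ hr
  refine (norm_add_le _ _).trans ?_
  rw [norm_mul, Complex.norm_I, mul_one, Complex.norm_real, Complex.norm_real, Real.norm_eq_abs,
    Real.norm_eq_abs]
  rw [mul_rpow (by positivity) (norm_nonneg _)] at e1 e2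
  linarith

end BallKernel

/-! ### Uniform decay for smooth families of symbols, and smooth difference quotients. -/

section SmoothFamilies

open Set
open scoped ContDiff

variable {n : ℕ}

theorem iteratedFDeriv_norm_prodMk_le {Θ : ℝ × Rn n → ℂ} (hΘ : ContDiff ℝ ∞ Θ) (v : ℝ) (j : ℕ)
    (ζ : Rn n) :
    ‖iteratedFDeriv ℝ j (fun ζ => Θ (v, ζ)) ζ‖ ≤ ‖iteratedFDeriv ℝ j Θ (v, ζ)‖ := by
  have h1 : (fun ζ => Θ (v, ζ)) =
      (fun p => Θ ((v, 0) + p)) ∘ (ContinuousLinearMap.inr ℝ ℝ (Rn n)) := by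
    ext ζ; simp
  have h2 : ContDiff ℝ ∞ fun p => Θ ((v, 0) + p) := hΘ.comp (contDiff_const.add contDiff_id)
  rw [h1, ContinuousLinearMap.iteratedFDeriv_comp_right _ h2 ζ (i := j) (by exact_mod_cast le_top),
    iteratedFDeriv_comp_add_left]
  refine (ContinuousMultilinearMap.norm_compContinuousLinearMap_le _ _).trans ?_
  have h3 : (v, (0 : Rn n)) + ContinuousLinearMap.inr ℝ ℝ (Rn n) ζ = (v, ζ) := by simp
  rw [h3]
  refine mul_le_of_le_one_right (norm_nonneg _) ?_
  exact Finset.prod_le_one (fun _ _ => norm_nonneg _)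
    fun _ _ => ContinuousLinearMap.norm_inr_le_one ℝ ℝ (Rn n)

/-- The derivatives in ζ are bounded on the compact set [0, 1] × ball, so the integrations by parts
have constants independent of the parameter v. -/
theorem fourierInv_uniform_decay {Θ : ℝ × Rn n → ℂ} (hΘ : ContDiff ℝ ∞ Θ) {r : ℝ}
    (h0 : ∀ v ζ, r ≤ ‖ζ‖ → Θ (v, ζ) = 0) (b : ℝ) :
    ∃ C, 0 ≤ C ∧ ∀ v ∈ Icc (0 : ℝ) 1, ∀ y : Rn n,
      ‖𝓕⁻ (fun ζ => Θ (v, ζ)) y‖ ≤ C * (1 + ‖y‖) ^ (-b) := by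
  have hK : IsCompact (Icc (0 : ℝ) 1 ×ˢ Metric.closedBall (0 : Rn n) r) :=
    isCompact_Icc.prod (isCompact_closedBall _ _)
  have hbd : ∀ j : ℕ, ∃ M, 0 ≤ M ∧ ∀ v ∈ Icc (0 : ℝ) 1, ∀ ζ : Rn n,
      ‖iteratedFDeriv ℝ j (fun ζ => Θ (v, ζ)) ζ‖ ≤
        (Metric.closedBall (0 : Rn n) r).indicator (fun _ => M) ζ := by
    intro j
    obtain ⟨M, hM⟩ := hK.exists_bound_of_continuousOn
      (hΘ.continuous_iteratedFDeriv (m := j) (by exact_mod_cast le_top)).continuousOn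
    refine ⟨max M 0, le_max_right _ _, fun v hv ζ => ?_⟩
    by_cases hζ : ζ ∈ Metric.closedBall (0 : Rn n) r
    · rw [indicator_of_mem hζ]
      exact (iteratedFDeriv_norm_prodMk_le hΘ v j ζ).trans
        ((hM (v, ζ) ⟨hv, hζ⟩).trans (le_max_left _ _))
    · rw [indicator_of_notMem hζ]
      refine le_of_eq (norm_eq_zero.2 ?_)
      by_contra hne
      refine hζ (closure_minimal ?_ Metric.isClosed_closedBall
        (support_iteratedFDeriv_subset (𝕜 := ℝ) j hne))
      intro η hη
      by_contra hη'
      rw [mem_closedBall_zero_iff, not_le] at hη'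
      exact hη (h0 v η hη'.le)
  choose M hM0 hM using hbd
  obtain ⟨k, hk⟩ := exists_nat_ge b
  set V := volume.real (Metric.closedBall (0 : Rn n) r) with hV
  have hsch : ∀ v, ∃ φ : 𝓢(Rn n, ℂ), (φ : Rn n → ℂ) = fun ζ => Θ (v, ζ) := fun v =>
    ⟨HasCompactSupport.toSchwartzMap (hasCompactSupport_of_norm (h0 v))
      (hΘ.comp (contDiff_const.prodMk contDiff_id)), rfl⟩
  have hint : ∀ v ∈ Icc (0 : ℝ) 1, ∀ j,
      ∫ ζ, ‖ζ‖ ^ 0 * ‖iteratedFDeriv ℝ j (fun ζ => Θ (v, ζ)) ζ‖ ≤ M j * V := by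
    intro v hv j
    have hI : Integrable ((Metric.closedBall (0 : Rn n) r).indicator fun _ => M j) :=
      (integrable_indicator_iff Metric.isClosed_closedBall.measurableSet).2
        (integrableOn_const (isCompact_closedBall _ _).measure_ne_top)
    refine (integral_mono_of_nonneg (.of_forall fun ζ => by positivity) hI
      (.of_forall fun ζ => ?_)).trans (le_of_eq ?_)
    · simpa using hM j v hv ζ
    · rw [integral_indicator Metric.isClosed_closedBall.measurableSet, setIntegral_const,
        smul_eq_mul, mul_comm]
  have hfour : ∀ j : ℕ, ∀ v ∈ Icc (0 : ℝ) 1, ∀ y : Rn n,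
      ‖y‖ ^ j * ‖𝓕⁻ (fun ζ => Θ (v, ζ)) y‖ ≤ 2 ^ j * ∑ i ∈ Finset.range (j + 1), M i * V := by
    intro j v hv y
    obtain ⟨φ, hφ⟩ := hsch v
    have h := Real.pow_mul_norm_iteratedFDeriv_fourier_le (K := ⊤) (N := ⊤) (f := φ)
      (φ.smooth ⊤) (fun k m _ _ => φ.integrable_pow_mul_iteratedFDeriv volume k m)
      (k := 0) (n := j) le_top le_top (-y)
    rw [norm_iteratedFDeriv_zero, norm_neg, ← Real.fourierInv_eq_fourier_neg, hφ] at h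
    refine h.trans ?_
    rw [pow_zero, one_mul]
    have : (2 * ((0 : ℕ) : ℝ) + 2) ^ j = 2 ^ j := by norm_num
    rw [this]
    refine mul_le_mul_of_nonneg_left ?_ (by positivity)
    rw [Finset.sum_product]
    simp only [zero_add, Finset.range_one, Finset.sum_singleton]
    exact Finset.sum_le_sum fun i _ => hint v hv i
  set A := ∑ i ∈ Finset.range (0 + 1), M i * V with hA
  set B := 2 ^ k * ∑ i ∈ Finset.range (k + 1), M i * V with hB
  have hA0 : 0 ≤ A := Finset.sum_nonneg fun i _ => mul_nonneg (hM0 i) measureReal_nonneg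
  have hB0 : 0 ≤ B := mul_nonneg (by positivity)
    (Finset.sum_nonneg fun i _ => mul_nonneg (hM0 i) measureReal_nonneg)
  refine ⟨2 ^ k * (A + B), by positivity, fun v hv y => ?_⟩
  have e0 := hfour 0 v hv y
  have e1 := hfour k v hv y
  rw [pow_zero, one_mul, pow_zero, one_mul] at e0
  have h1 : (1 + ‖y‖) ^ b ≤ (1 + ‖y‖) ^ k := by
    rw [← Real.rpow_natCast]
    exact Real.rpow_le_rpow_of_exponent_le (by linarith [norm_nonneg y]) hk
  rw [Real.rpow_neg (by positivity), ← div_eq_mul_inv, le_div_iff₀ (by positivity)]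
  refine (mul_le_mul_of_nonneg_left h1 (norm_nonneg _)).trans ?_
  have h2 : (1 + ‖y‖) ^ k ≤ 2 ^ k * (1 + ‖y‖ ^ k) := by
    rcases le_total ‖y‖ 1 with hz | hz
    · calc (1 + ‖y‖) ^ k ≤ 2 ^ k := by gcongr; linarith
        _ ≤ _ := le_mul_of_one_le_right (by positivity) (by linarith [pow_nonneg (norm_nonneg y) k])
    · calc (1 + ‖y‖) ^ k ≤ (2 * ‖y‖) ^ k := by gcongr; linarith
        _ = 2 ^ k * ‖y‖ ^ k := mul_pow _ _ _
        _ ≤ _ := by gcongr; linarith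
  refine (mul_le_mul_of_nonneg_left h2 (norm_nonneg _)).trans ?_
  calc ‖𝓕⁻ (fun ζ => Θ (v, ζ)) y‖ * (2 ^ k * (1 + ‖y‖ ^ k))
      = 2 ^ k * (‖𝓕⁻ (fun ζ => Θ (v, ζ)) y‖ + ‖y‖ ^ k * ‖𝓕⁻ (fun ζ => Θ (v, ζ)) y‖) := by ring
    _ ≤ _ := by gcongr

/-- Analyticity is required so that the divided power series gives the quotient at the point itself.
-/
theorem contDiffAt_dslope_same {f : ℝ → ℝ} {a : ℝ} (hf : ContDiffAt ℝ ω f a) :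
    ContDiffAt ℝ ∞ (dslope f a) a := by
  obtain ⟨p, hp⟩ := hf.analyticAt
  have h : AnalyticAt ℝ (dslope f a) a := ⟨_, hp.has_fpower_series_dslope_fslope⟩
  exact h.contDiffAt

theorem contDiffAt_dslope_of_ne {f : ℝ → ℝ} {a b : ℝ} (h : b ≠ a) (hf : ContDiffAt ℝ ∞ f b) :
    ContDiffAt ℝ ∞ (dslope f a) b := by
  refine ContDiffAt.congr_of_eventuallyEq ?_ (dslope_eventuallyEq_slope_of_ne f h)
  have : slope f a = fun x => (x - a)⁻¹ * (f x - f a) := by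
    ext x; rw [slope_def_field]; ring
  rw [this]
  exact ((contDiffAt_id.sub contDiffAt_const).inv (sub_ne_zero.2 h)).mul
    (hf.sub contDiffAt_const)

theorem contDiffAt_dslope {f : ℝ → ℝ} (a : ℝ) {b : ℝ} (ha : ContDiffAt ℝ ω f a)
    (hb : ContDiffAt ℝ ω f b) : ContDiffAt ℝ ∞ (dslope f a) b := by
  rcases eq_or_ne b a with rfl | h
  · exact contDiffAt_dslope_same ha
  · exact contDiffAt_dslope_of_ne h (hb.of_le le_top)

theorem contDiffAt_one_sub_rpow (δ : ℝ) {u : ℝ} (hu : u < 1) {k : WithTop ℕ∞} :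
    ContDiffAt ℝ k (fun u : ℝ => (1 - u) ^ δ) u :=
  (contDiffAt_const.sub contDiffAt_id).rpow_const_of_ne (sub_ne_zero.2 hu.ne')

/-- A smooth function equal to `((1 - u) ^ δ - 1) / u` near `[0, u₀]`, where `u₀ < 1`. -/
theorem exists_smooth_low_profile (δ : ℝ) {u₀ : ℝ} (hu₀ : u₀ < 1) :
    ∃ H : ℝ → ℝ, ContDiff ℝ ∞ H ∧ ∀ u ≤ u₀, (1 - u) ^ δ - 1 = u * H u := by
  set h : ℝ → ℝ := fun u => (1 - u) ^ δ with hh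
  set d := (1 - u₀) / 2 with hd
  have hd0 : 0 < d := by rw [hd]; linarith
  have hh1 : ∀ {u : ℝ}, u < 1 → ContDiffAt ℝ ω h u := fun hu => contDiffAt_one_sub_rpow δ hu
  -- The cutoff is 1 up to u₀ and 0 beyond u₀ + d, the midpoint of u₀ and 1, so the singularity of
  -- (1 - u)^δ at u = 1 is never reached.
  refine ⟨fun u => cutoffProfile (1 + (u - u₀) / d) * dslope h 0 u, ?_, fun u hu => ?_⟩
  · rw [contDiff_iff_contDiffAt]
    intro u
    rcases lt_or_ge u 1 with hu | hu
    · refine ContDiffAt.mul ?_ (contDiffAt_dslope 0 (hh1 one_pos) (hh1 hu))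
      exact (contDiff_cutoffProfile_infty (k := ⊤)).contDiffAt.comp u
        (contDiffAt_const.add ((contDiffAt_id.sub contDiffAt_const).div_const _))
    · have : (fun u => cutoffProfile (1 + (u - u₀) / d) * dslope h 0 u) =ᶠ[𝓝 u] fun _ => 0 := by
        have h1 : u₀ + d < u := by rw [hd]; linarith
        filter_upwards [Ioi_mem_nhds h1] with w hw
        rw [cutoffProfile_of_ge, zero_mul]
        have : 1 ≤ (w - u₀) / d := by rw [le_div_iff₀ hd0]; linarith [mem_Ioi.1 hw]
        linarith
      exact contDiffAt_const.congr_of_eventuallyEq this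
  · simp only
    rw [cutoffProfile_of_le, one_mul]
    · have := sub_smul_dslope h 0 u
      simp only [smul_eq_mul, sub_zero] at this
      rw [this]
      simp [hh]
    · have : (u - u₀) / d ≤ 0 := div_nonpos_of_nonpos_of_nonneg (by linarith) hd0.le
      linarith

/-- The quotient `((1 - t ^ c) / (1 - t)) ^ δ` extends smoothly to `t > 0`. -/
theorem exists_smooth_quotient {c : ℝ} (hc : 0 < c) (δ : ℝ) :
    ∃ Q : ℝ → ℝ, (∀ t, 0 < t → ContDiffAt ℝ ∞ Q t) ∧
      ∀ t, 0 < t → (max (1 - t ^ c) 0) ^ δ = (max (1 - t) 0) ^ δ * Q t := by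
  set h : ℝ → ℝ := fun t => t ^ c with hh
  have hh1 : ∀ {t : ℝ}, 0 < t → ContDiffAt ℝ ω h t := fun ht =>
    contDiffAt_id.rpow_const_of_ne ht.ne'
  have hmul : ∀ t, 1 - t ^ c = (1 - t) * dslope h 1 t := by
    intro t
    have := sub_smul_dslope h 1 t
    simp only [smul_eq_mul, hh, Real.one_rpow] at this
    linarith
  -- Monotonicity of t^c makes the quotient positive, with value c at t = 1; this is what makes its
  -- real power smooth.
  have hpos : ∀ t, 0 < t → 0 < dslope h 1 t := by
    intro t ht
    rcases lt_trichotomy t 1 with h1 | rfl | h1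
    · have h2 := hmul t
      have h3 : t ^ c < 1 := Real.rpow_lt_one ht.le h1 hc
      by_contra hneg
      nlinarith
    · rw [dslope_same, hh, Real.deriv_rpow_const]
      simpa using hc
    · have h2 := hmul t
      have h3 : 1 < t ^ c := Real.one_lt_rpow h1 hc
      by_contra hneg
      nlinarith
  refine ⟨fun t => dslope h 1 t ^ δ, fun t ht => ?_, fun t ht => ?_⟩
  · exact (contDiffAt_dslope 1 (hh1 one_pos) (hh1 ht)).rpow_const_of_ne (hpos t ht).ne'
  · rw [hmul, ← Real.mul_rpow (le_max_right _ _) (hpos t ht).le, max_mul_of_nonneg _ _ (hpos t ht).le,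
      zero_mul]

end SmoothFamilies

/-! ### Low frequencies: the kernel of (m - 1)|ξ|^(-c) near ξ = 0. -/

section LowFrequency

open Set
open scoped ContDiff

variable {n : ℕ}

theorem bochnerRieszMultiplier_one (δ γ : ℝ) (ξ : Rn n) :
    bochnerRieszMultiplier δ γ 1 ξ = (max (1 - ‖ξ‖ ^ γ) 0) ^ δ := by
  rw [bochnerRieszMultiplier, Real.one_rpow, div_one]

theorem bochnerRieszMultiplier_nonneg (δ γ R : ℝ) (ξ : Rn n) :
    0 ≤ bochnerRieszMultiplier δ γ R ξ := Real.rpow_nonneg (le_max_right _ _) _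

theorem bochnerRieszMultiplier_one_le_one {δ γ : ℝ} (hδ : 0 < δ) (ξ : Rn n) :
    bochnerRieszMultiplier δ γ 1 ξ ≤ 1 := by
  rw [bochnerRieszMultiplier_one]
  refine Real.rpow_le_one (le_max_right _ _) (max_le ?_ zero_le_one) hδ.le
  linarith [Real.rpow_nonneg (norm_nonneg ξ) γ]

theorem bochnerRieszMultiplier_one_of_one_le {δ γ : ℝ} (hδ : 0 < δ) (hγ : 0 ≤ γ) {ξ : Rn n}
    (h : 1 ≤ ‖ξ‖) : bochnerRieszMultiplier δ γ 1 ξ = 0 := by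
  rw [bochnerRieszMultiplier_one, max_eq_right, Real.zero_rpow hδ.ne']
  linarith [Real.one_le_rpow h hγ]

theorem continuous_bochnerRieszMultiplier_one {δ γ : ℝ} (hδ : 0 ≤ δ) (hγ : 0 ≤ γ) :
    Continuous (bochnerRieszMultiplier δ γ 1 : Rn n → ℝ) := by
  have : (bochnerRieszMultiplier δ γ 1 : Rn n → ℝ) = fun ξ => (max (1 - ‖ξ‖ ^ γ) 0) ^ δ :=
    funext fun ξ => bochnerRieszMultiplier_one δ γ ξ
  rw [this]
  refine Continuous.rpow_const ?_ fun _ => Or.inr hδ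
  exact (continuous_const.sub (continuous_norm.rpow_const fun _ => Or.inr hγ)).max continuous_const

/-- The frequency piece at scale `σ` of the symbol `(m(ξ) - 1) |ξ|^(-c)`, where `m` is the
generalized Bochner-Riesz multiplier. -/
def lowPiece (δ γ c σ : ℝ) (ξ : Rn n) : ℂ :=
  ((annulus (σ⁻¹ • ξ) / σ * (bochnerRieszMultiplier δ γ 1 ξ - 1) * ‖ξ‖ ^ (-c) : ℝ) : ℂ)

/-- Near 0, m - 1 is |ξ|^γ times a smooth function of |ξ|^γ. In the variable ζ = ξ/σ, restricted to
an annulus, |ζ|^γ is smooth, and apart from a power of σ the scale enters only through v = σ^γ ∈ [0,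
1]. This reduces all small scales to one smooth compact family. -/
theorem exists_lowPiece_profile (δ : ℝ) {γ : ℝ} (hγ : 0 < γ) (c : ℝ) :
    ∃ Θ : ℝ × Rn n → ℂ, ContDiff ℝ ∞ Θ ∧ (∀ v ζ, 3 / 2 ≤ ‖ζ‖ → Θ (v, ζ) = 0) ∧
      ∀ σ, 0 < σ → σ ≤ 1 / 2 → ∀ ξ : Rn n,
        lowPiece δ γ c σ ξ = ((σ ^ (γ - c - 1) : ℝ) : ℂ) * Θ (σ ^ γ, σ⁻¹ • ξ) := by
  -- For σ ≤ 1/2 the piece lives in ‖ξ‖ ≤ 3σ/2 ≤ 3/4, away from the unit sphere.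
  have hu₀ : (3 / 4 : ℝ) ^ γ < 1 := Real.rpow_lt_one (by norm_num) (by norm_num) hγ
  obtain ⟨H, hH, hH1⟩ := exists_smooth_low_profile δ hu₀
  refine ⟨fun p => ((annulus p.2 * ‖p.2‖ ^ (γ - c) * H (p.1 * ‖p.2‖ ^ γ) : ℝ) : ℂ), ?_,
    fun v ζ h => by simp [annulus_of_lt_norm h], fun σ hσ hσ2 ξ => ?_⟩
  · refine Complex.ofRealCLM.contDiff.comp ?_
    rw [contDiff_iff_contDiffAt]
    rintro ⟨v, ζ⟩
    rcases eq_or_ne ζ 0 with rfl | hζ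
    · have : (fun p : ℝ × Rn n => annulus p.2 * ‖p.2‖ ^ (γ - c) * H (p.1 * ‖p.2‖ ^ γ))
          =ᶠ[𝓝 (v, 0)] fun _ => 0 := by
        have h1 : ∀ᶠ p : ℝ × Rn n in 𝓝 (v, 0), ‖p.2‖ < 1 := by
          have : Tendsto (fun p : ℝ × Rn n => ‖p.2‖) (𝓝 (v, 0)) (𝓝 ‖(0 : Rn n)‖) :=
            (continuous_norm.comp continuous_snd).tendsto _
          exact this.eventually_lt_const (by simp)
        filter_upwards [h1] with p hp
        rw [annulus_of_norm_lt hp, zero_mul, zero_mul]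
      exact contDiffAt_const.congr_of_eventuallyEq this
    · have hn : ContDiffAt ℝ ∞ (fun p : ℝ × Rn n => ‖p.2‖) (v, ζ) :=
        contDiffAt_snd.norm ℝ hζ
      have hp : ∀ e : ℝ, ContDiffAt ℝ ∞ (fun p : ℝ × Rn n => ‖p.2‖ ^ e) (v, ζ) := fun e =>
        hn.rpow_const_of_ne (norm_ne_zero_iff.2 hζ)
      refine (ContDiffAt.mul ?_ (hp _)).mul ?_
      · exact ((contDiff_annulus (k := ⊤)).comp contDiff_snd).contDiffAt
      · exact hH.contDiffAt.comp (v, ζ) (contDiffAt_fst.mul (hp γ))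
  · simp only [lowPiece]
    rw [← Complex.ofReal_mul]
    congr 1
    rcases lt_or_ge ‖σ⁻¹ • ξ‖ 1 with h1 | h1
    · rw [annulus_of_norm_lt h1]; ring
    rcases le_or_gt (3 / 2) ‖σ⁻¹ • ξ‖ with h2 | h2
    · rw [annulus_of_lt_norm h2]; ring
    set t := ‖σ⁻¹ • ξ‖ with ht
    have ht0 : 0 < t := by linarith
    have hξ : ‖ξ‖ = σ * t := by
      rw [ht, norm_smul, norm_inv, Real.norm_of_nonneg hσ.le]; field_simp
    have h3 : σ ^ γ * t ^ γ ≤ (3 / 4 : ℝ) ^ γ := by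
      rw [← Real.mul_rpow hσ.le ht0.le]
      refine Real.rpow_le_rpow (by positivity) ?_ hγ.le
      nlinarith
    have h4 : 0 ≤ 1 - σ ^ γ * t ^ γ := by linarith
    rw [bochnerRieszMultiplier_one, hξ, Real.mul_rpow hσ.le ht0.le, max_eq_left h4, hH1 _ h3,
      Real.mul_rpow hσ.le ht0.le, show γ - c - 1 = γ + (-c) + (-1) by ring, Real.rpow_add hσ,
      Real.rpow_add hσ, show γ - c = γ + (-c) by ring, Real.rpow_add ht0, Real.rpow_neg_one]
    ring

theorem exists_schwartz_lowPiece (δ : ℝ) {γ : ℝ} (hγ : 0 < γ) (c : ℝ) {σ : ℝ} (hσ : 0 < σ)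
    (hσ2 : σ ≤ 1 / 2) : ∃ φ : 𝓢(Rn n, ℂ), (φ : Rn n → ℂ) = lowPiece δ γ c σ := by
  obtain ⟨Θ, hΘ, h0, h1⟩ := exists_lowPiece_profile (n := n) δ hγ c
  refine ⟨HasCompactSupport.toSchwartzMap (f := lowPiece δ γ c σ)
    (hasCompactSupport_of_norm (r := 3 / 2 * σ) fun ξ h => ?_) ?_, rfl⟩
  · rw [lowPiece, annulus_inv_smul_of_gt hσ h]; simp
  · rw [show lowPiece δ γ c σ = fun ξ : Rn n => ((σ ^ (γ - c - 1) : ℝ) : ℂ) * Θ (σ ^ γ, σ⁻¹ • ξ)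
      from funext (h1 σ hσ hσ2)]
    exact contDiff_const.mul (hΘ.comp (contDiff_const.prodMk (contDiff_id.const_smul σ⁻¹)))

theorem fourierInv_lowPiece_decay (δ : ℝ) {γ : ℝ} (hγ : 0 < γ) (c b : ℝ) :
    ∃ C, 0 ≤ C ∧ ∀ σ, 0 < σ → σ ≤ 1 / 2 → ∀ y : Rn n,
      ‖𝓕⁻ (lowPiece δ γ c σ : Rn n → ℂ) y‖ ≤
        C * (σ ^ (n + γ - c - 1) * (1 + σ * ‖y‖) ^ (-b)) := by
  obtain ⟨Θ, hΘ, h0, h1⟩ := exists_lowPiece_profile (n := n) δ hγ c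
  obtain ⟨C, hC0, hC⟩ := fourierInv_uniform_decay hΘ h0 b
  refine ⟨C, hC0, fun σ hσ hσ2 y => ?_⟩
  have hv : σ ^ γ ∈ Icc (0 : ℝ) 1 :=
    ⟨by positivity, Real.rpow_le_one hσ.le (by linarith) hγ.le⟩
  have h2 : 𝓕⁻ (lowPiece δ γ c σ : Rn n → ℂ) y =
      ((σ ^ (γ - c - 1) : ℝ) : ℂ) * 𝓕⁻ (fun ξ : Rn n => Θ (σ ^ γ, σ⁻¹ • ξ)) y := by
    rw [show lowPiece δ γ c σ = fun ξ : Rn n => ((σ ^ (γ - c - 1) : ℝ) : ℂ) * Θ (σ ^ γ, σ⁻¹ • ξ)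
      from funext (h1 σ hσ hσ2)]
    simp only [Real.fourierInv_eq, Circle.smul_def, smul_eq_mul]
    rw [← integral_const_mul]
    congr 1; ext y; ring
  have h3 := hC _ hv (σ • y)
  rw [norm_smul, Real.norm_of_nonneg hσ.le] at h3
  rw [h2, fourierInv_comp_inv_smul (fun ζ => Θ (σ ^ γ, ζ)) hσ, ← mul_assoc, norm_mul,
    ← Complex.ofReal_mul, Complex.norm_real, Real.norm_of_nonneg (by positivity)]
  have h4 : σ ^ (γ - c - 1) * σ ^ n = σ ^ (n + γ - c - 1) := by
    rw [← Real.rpow_natCast, ← Real.rpow_add hσ]; congr 1; ring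
  rw [h4]
  calc σ ^ (n + γ - c - 1) * ‖𝓕⁻ (fun ζ => Θ (σ ^ γ, ζ)) (σ • y)‖
      ≤ σ ^ (n + γ - c - 1) * (C * (1 + σ * ‖y‖) ^ (-b)) := by gcongr
    _ = _ := by ring

theorem continuousOn_scale_weight {e : ℝ} (he : 1 ≤ e) {r : ℝ} (hr : 0 ≤ r) (s : ℝ) :
    ContinuousOn (fun σ : ℝ => σ ^ (e - 1) * (1 + σ * r) ^ (-(e + 1))) (Icc 0 s) := by
  refine ContinuousOn.mul (continuousOn_id.rpow_const fun _ _ => Or.inr (by linarith)) ?_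
  refine ContinuousOn.rpow_const (by fun_prop) fun σ hσ => Or.inl ?_
  have := mul_nonneg hσ.1 hr
  linarith

/-- The integrand has the explicit primitive σ^e (1 + σ r)^(-e) / e. Summing the pieces over all
scales therefore yields decay of order e. -/
theorem integral_scale_weight_le {e : ℝ} (he : 1 ≤ e) {r s : ℝ} (hr : 0 ≤ r) (hs : 0 ≤ s)
    (hs1 : s ≤ 1) :
    ∫ σ in Ioc 0 s, σ ^ (e - 1) * (1 + σ * r) ^ (-(e + 1)) ≤ (1 + r) ^ (-e) := by
  have hd : ∀ σ ∈ uIcc 0 s, HasDerivAt (fun σ : ℝ => e⁻¹ * (σ ^ e * (1 + σ * r) ^ (-e)))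
      (σ ^ (e - 1) * (1 + σ * r) ^ (-(e + 1))) σ := by
    intro σ hσ
    rw [uIcc_of_le hs] at hσ
    have hpos : 0 < 1 + σ * r := by linarith [mul_nonneg hσ.1 hr]
    have h1 : HasDerivAt (fun σ : ℝ => σ ^ e) (e * σ ^ (e - 1)) σ :=
      Real.hasDerivAt_rpow_const (Or.inr he)
    have h2 : HasDerivAt (fun σ : ℝ => 1 + σ * r) r σ := by
      simpa using ((hasDerivAt_id σ).mul_const r).const_add 1
    have h3 := h2.rpow_const (p := -e) (Or.inl hpos.ne')
    refine ((h1.mul h3).const_mul e⁻¹).congr_deriv ?_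
    have h4 : σ ^ e = σ ^ (e - 1) * σ := by
      rcases hσ.1.eq_or_lt with h0 | h0
      · rw [← h0, Real.zero_rpow (by linarith), mul_zero]
      · rw [← Real.rpow_add_one h0.ne']; congr 1; ring
    have h5 : (1 + σ * r) ^ (-e) = (1 + σ * r) ^ (-(e + 1)) * (1 + σ * r) := by
      rw [← Real.rpow_add_one hpos.ne']; congr 1; ring
    have h6 : -e - 1 = -(e + 1) := by ring
    rw [h6, h4, h5]
    field_simp
    ring
  rw [← intervalIntegral.integral_of_le hs, intervalIntegral.integral_eq_sub_of_hasDerivAt hd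
    ((continuousOn_scale_weight he hr s).intervalIntegrable_of_Icc hs),
    Real.zero_rpow (by linarith), zero_mul, mul_zero, sub_zero]
  have hpos : 0 < 1 + s * r := by linarith [mul_nonneg hs hr]
  have h1 : s ^ e * (1 + s * r) ^ (-e) ≤ (1 + r) ^ (-e) := by
    rw [Real.rpow_neg hpos.le, Real.rpow_neg (by positivity), ← div_eq_mul_inv,
      div_le_iff₀ (by positivity), inv_mul_eq_div, le_div_iff₀ (by positivity),
      ← Real.mul_rpow hs (by positivity)]
    exact Real.rpow_le_rpow (by positivity) (by nlinarith) (by linarith)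
  have h2 : e⁻¹ ≤ 1 := inv_le_one_of_one_le₀ he
  have h3 : 0 ≤ s ^ e * (1 + s * r) ^ (-e) := by positivity
  nlinarith

theorem measurable_lowPiece {δ γ : ℝ} (hδ : 0 ≤ δ) (hγ : 0 ≤ γ) (c : ℝ) :
    Measurable fun p : ℝ × Rn n => lowPiece δ γ c p.1 p.2 := by
  refine Complex.measurable_ofReal.comp ((Measurable.mul (Measurable.div ?_ measurable_fst)
    ?_).mul (measurable_snd.norm.pow_const _))
  · exact (contDiff_annulus (k := 0)).continuous.measurable.comp
      (measurable_fst.inv.smul measurable_snd)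
  · exact ((continuous_bochnerRieszMultiplier_one hδ hγ).measurable.comp measurable_snd).sub_const 1

theorem Measurable.uncurry_fst_fst_snd {G : ℝ → Rn n → ℂ}
    (h : Measurable fun p : ℝ × Rn n => G p.1 p.2) :
    Measurable fun q : (ℝ × Rn n) × Rn n => G q.1.1 q.2 := by
  have h2 : Measurable fun q : (ℝ × Rn n) × Rn n => (q.1.1, q.2) :=
    (measurable_fst.comp measurable_fst).prodMk measurable_snd
  exact h.comp h2

theorem stronglyMeasurable_fourierInv_lowPiece {δ γ : ℝ} (hδ : 0 ≤ δ) (hγ : 0 ≤ γ) (c : ℝ) :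
    StronglyMeasurable fun p : ℝ × Rn n => 𝓕⁻ (lowPiece δ γ c p.1 : Rn n → ℂ) p.2 := by
  have h1 : Measurable fun q : (ℝ × Rn n) × Rn n =>
      (Real.fourierChar (inner ℝ q.2 q.1.2) : ℂ) :=
    (continuous_coe_fourierChar.comp
      (continuous_snd.inner (continuous_snd.comp continuous_fst))).measurable
  have h2 : Measurable fun q : (ℝ × Rn n) × Rn n => lowPiece δ γ c q.1.1 q.2 :=
    Measurable.uncurry_fst_fst_snd (G := lowPiece δ γ c) (measurable_lowPiece hδ hγ c)
  have h3 := (h1.mul h2).stronglyMeasurable.integral_prod_right' (ν := volume)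
  have h4 : (fun p : ℝ × Rn n => 𝓕⁻ (lowPiece δ γ c p.1 : Rn n → ℂ) p.2) = fun p : ℝ × Rn n =>
      ∫ ξ : Rn n, (Real.fourierChar (inner ℝ ξ p.2) : ℂ) * lowPiece δ γ c p.1 ξ := by
    ext p
    rw [Real.fourierInv_eq]
    simp only [Circle.smul_def, smul_eq_mul]
  rw [h4]
  exact h3

/-- The inverse Fourier transform of `cutoff s ξ (m(ξ) - 1) |ξ|^(-c)`, as a superposition of
frequency pieces. -/
def lowKernel (δ γ c s : ℝ) (y : Rn n) : ℂ :=
  ∫ σ in Ioc 0 s, 𝓕⁻ (lowPiece δ γ c σ : Rn n → ℂ) y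

theorem integral_norm_fourierInv_lowPiece_le (hn : 0 < n) {δ γ c : ℝ} (hδ : 0 ≤ δ) (hγ : 0 < γ)
    (hc : c ≤ γ) :
    ∃ C, 0 ≤ C ∧ ∀ s, 0 ≤ s → s ≤ 1 / 2 → ∀ y : Rn n,
      IntegrableOn (fun σ => 𝓕⁻ (lowPiece δ γ c σ : Rn n → ℂ) y) (Ioc 0 s) ∧
      ∫ σ in Ioc 0 s, ‖𝓕⁻ (lowPiece δ γ c σ : Rn n → ℂ) y‖ ≤
        C * (1 + ‖y‖) ^ (-(n + γ - c)) := by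
  have hn1 : (1 : ℝ) ≤ n := by exact_mod_cast hn
  -- One order of decay more than n + γ - c gives the integrand with an explicit primitive.
  obtain ⟨C, hC0, hC⟩ := fourierInv_lowPiece_decay (n := n) δ hγ c (n + γ - c + 1)
  refine ⟨C, hC0, fun s hs hs2 y => ?_⟩
  have he : 1 ≤ n + γ - c := by linarith
  have hI : IntegrableOn (fun σ : ℝ => C * (σ ^ (n + γ - c - 1) *
      (1 + σ * ‖y‖) ^ (-(n + γ - c + 1)))) (Ioc 0 s) :=
    (((continuousOn_scale_weight he (norm_nonneg y) s).integrableOn_Icc).mono_set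
      Ioc_subset_Icc_self).const_mul _
  have hle : ∀ᵐ σ ∂(volume.restrict (Ioc 0 s)), ‖𝓕⁻ (lowPiece δ γ c σ : Rn n → ℂ) y‖ ≤
      C * (σ ^ (n + γ - c - 1) * (1 + σ * ‖y‖) ^ (-(n + γ - c + 1))) := by
    filter_upwards [ae_restrict_mem measurableSet_Ioc] with σ hσ
    exact hC σ hσ.1 (hσ.2.trans hs2) y
  have hm : AEStronglyMeasurable (fun σ => 𝓕⁻ (lowPiece δ γ c σ : Rn n → ℂ) y)
      (volume.restrict (Ioc 0 s)) :=
    ((stronglyMeasurable_fourierInv_lowPiece hδ hγ.le c).comp_measurable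
      (measurable_id.prodMk measurable_const)).aestronglyMeasurable
  have hJ : IntegrableOn (fun σ => 𝓕⁻ (lowPiece δ γ c σ : Rn n → ℂ) y) (Ioc 0 s) :=
    hI.mono' hm hle
  refine ⟨hJ, (integral_mono_ae hJ.norm hI hle).trans ?_⟩
  rw [integral_const_mul]
  gcongr
  exact integral_scale_weight_le he (norm_nonneg y) hs (by linarith)

theorem norm_lowKernel_le (hn : 0 < n) {δ γ c : ℝ} (hδ : 0 ≤ δ) (hγ : 0 < γ) (hc : c ≤ γ) :
    ∃ C, 0 ≤ C ∧ ∀ s, 0 ≤ s → s ≤ 1 / 2 → ∀ y : Rn n,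
      ‖lowKernel δ γ c s y‖ ≤ C * (1 + ‖y‖) ^ (-(n + γ - c)) := by
  obtain ⟨C, hC0, hC⟩ := integral_norm_fourierInv_lowPiece_le hn hδ hγ hc
  exact ⟨C, hC0, fun s hs hs2 y => (norm_integral_le_integral_norm _).trans (hC s hs hs2 y).2⟩

theorem integrable_lowPiece_prod (hn : 0 < n) {δ γ c : ℝ} (hδ : 0 ≤ δ) (hγ : 0 < γ) (hc : c ≤ γ)
    {s : ℝ} (hs2 : s ≤ 1 / 2) :
    Integrable (Function.uncurry fun σ (ξ : Rn n) => lowPiece δ γ c σ ξ)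
      ((volume.restrict (Ioc 0 s)).prod volume) := by
  have hn1 : (1 : ℝ) ≤ n := by exact_mod_cast hn
  obtain ⟨Θ, hΘ, h0, h1⟩ := exists_lowPiece_profile (n := n) δ hγ c
  have hK : IsCompact (Icc (0 : ℝ) 1 ×ˢ Metric.closedBall (0 : Rn n) (3 / 2)) :=
    isCompact_Icc.prod (isCompact_closedBall _ _)
  obtain ⟨M, hM⟩ := hK.exists_bound_of_continuousOn hΘ.continuous.continuousOn
  have hbd : ∀ σ ∈ Ioc 0 s, ∀ ξ : Rn n, ‖lowPiece δ γ c σ ξ‖ ≤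
      σ ^ (γ - c - 1) * (Metric.closedBall (0 : Rn n) (3 / 2)).indicator (fun _ => max M 0)
        (σ⁻¹ • ξ) := by
    intro σ hσ ξ
    rw [h1 σ hσ.1 (hσ.2.trans hs2), norm_mul, Complex.norm_real,
      Real.norm_of_nonneg (Real.rpow_nonneg hσ.1.le _)]
    refine mul_le_mul_of_nonneg_left ?_ (Real.rpow_nonneg hσ.1.le _)
    by_cases hζ : σ⁻¹ • ξ ∈ Metric.closedBall (0 : Rn n) (3 / 2)
    · rw [indicator_of_mem hζ]
      refine (hM (σ ^ γ, _) ⟨⟨Real.rpow_nonneg hσ.1.le _, ?_⟩, hζ⟩).trans (le_max_left _ _)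
      exact Real.rpow_le_one hσ.1.le (by linarith [hσ.2]) hγ.le
    · rw [indicator_of_notMem hζ]
      rw [mem_closedBall_zero_iff, not_le] at hζ
      rw [h0 _ _ hζ.le, norm_zero]
  set I : Rn n → ℝ := (Metric.closedBall (0 : Rn n) (3 / 2)).indicator (fun _ => max M 0) with hI
  have hII : Integrable I :=
    (integrable_indicator_iff Metric.isClosed_closedBall.measurableSet).2
      (integrableOn_const (isCompact_closedBall _ _).measure_ne_top)
  have hm := (measurable_lowPiece (n := n) hδ hγ.le c)
  refine (integrable_prod_iff hm.aestronglyMeasurable).2 ⟨?_, ?_⟩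
  · filter_upwards [ae_restrict_mem measurableSet_Ioc] with σ hσ
    obtain ⟨φ, hφ⟩ := exists_schwartz_lowPiece (n := n) δ hγ c hσ.1 (hσ.2.trans hs2)
    exact φ.integrable.congr (.of_forall fun ξ => congrFun hφ ξ)
  · have h2 : IntegrableOn (fun σ : ℝ => σ ^ (n + γ - c - 1) * ∫ ξ : Rn n, I ξ) (Ioc 0 s) := by
      refine Integrable.mul_const ?_ _
      refine (ContinuousOn.integrableOn_Icc (a := 0) (b := s) ?_).mono_set Ioc_subset_Icc_self
      exact continuousOn_id.rpow_const fun _ _ => Or.inr (by linarith)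
    refine h2.mono' hm.norm.aestronglyMeasurable.integral_prod_right' ?_
    filter_upwards [ae_restrict_mem measurableSet_Ioc] with σ hσ
    rw [Real.norm_of_nonneg (integral_nonneg fun ξ => norm_nonneg _)]
    refine (integral_mono_of_nonneg (.of_forall fun ξ => norm_nonneg _)
      ((hII.comp_smul (inv_ne_zero hσ.1.ne')).const_mul _) (.of_forall (hbd σ hσ))).trans
      (le_of_eq ?_)
    have h3 := Measure.integral_comp_inv_smul_of_nonneg (volume : Measure (Rn n)) I hσ.1.le
    rw [finrank_euclideanSpace_fin, smul_eq_mul] at h3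
    rw [integral_const_mul, h3, ← mul_assoc, ← Real.rpow_natCast, ← Real.rpow_add hσ.1]
    congr 2
    ring

theorem integral_lowPiece {δ γ c s : ℝ} (hs : 0 < s) {ξ : Rn n} (hξ : ξ ≠ 0) :
    ∫ σ in Ioc 0 s, lowPiece δ γ c σ ξ =
      ((cutoff s ξ * (bochnerRieszMultiplier δ γ 1 ξ - 1) * ‖ξ‖ ^ (-c) : ℝ) : ℂ) := by
  unfold lowPiece
  rw [integral_complex_ofReal, integral_mul_const, integral_mul_const, integral_Ioc_annulus hs hξ]

theorem lowKernel_ae_symbol (hn : 0 < n) {δ γ c s : ℝ} (hs : 0 < s) :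
    (fun ξ : Rn n => ∫ σ in Ioc 0 s, lowPiece δ γ c σ ξ) =ᵐ[volume] fun ξ =>
      ((cutoff s ξ * (bochnerRieszMultiplier δ γ 1 ξ - 1) * ‖ξ‖ ^ (-c) : ℝ) : ℂ) := by
  have : Nonempty (Fin n) := ⟨⟨0, hn⟩⟩
  filter_upwards [compl_mem_ae_iff.2 (measure_singleton (0 : Rn n))] with ξ hξ
  exact integral_lowPiece hs hξ

theorem integrable_lowSymbol (hn : 0 < n) {δ γ c s : ℝ} (hδ : 0 ≤ δ) (hγ : 0 < γ) (hc : c ≤ γ)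
    (hs : 0 < s) (hs2 : s ≤ 1 / 2) : Integrable fun ξ : Rn n =>
      ((cutoff s ξ * (bochnerRieszMultiplier δ γ 1 ξ - 1) * ‖ξ‖ ^ (-c) : ℝ) : ℂ) :=
  (integrable_lowPiece_prod hn hδ hγ hc hs2).integral_prod_right.congr
    (lowKernel_ae_symbol hn hs)

theorem lowKernel_eq (hn : 0 < n) {δ γ c s : ℝ} (hδ : 0 ≤ δ) (hγ : 0 < γ) (hc : c ≤ γ)
    (hs : 0 < s) (hs2 : s ≤ 1 / 2) (y : Rn n) :
    lowKernel δ γ c s y = 𝓕⁻ (fun ξ : Rn n =>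
      ((cutoff s ξ * (bochnerRieszMultiplier δ γ 1 ξ - 1) * ‖ξ‖ ^ (-c) : ℝ) : ℂ)) y := by
  rw [lowKernel, ← fourierInv_integral (integrable_lowPiece_prod hn hδ hγ hc hs2)]
  rw [Real.fourierInv_eq, Real.fourierInv_eq]
  refine integral_congr_ae ?_
  filter_upwards [lowKernel_ae_symbol (δ := δ) (γ := γ) (c := c) hn hs] with ξ hξ
  rw [hξ]

/-- The symbol of `lowKernel` need not be smooth at 0, so the kernel need not be Schwartz. Fubini
reduces pairings with it to the individual pieces, which have Schwartz symbols. -/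
theorem integral_mul_lowKernel (hn : 0 < n) {δ γ c s : ℝ} (hδ : 0 ≤ δ) (hγ : 0 < γ) (hc : c ≤ γ)
    (hs : 0 ≤ s) (hs2 : s ≤ 1 / 2) {f : Rn n → ℂ}
    (hf : Integrable fun y => (((1 + ‖y‖) ^ (-(n + γ - c)) : ℝ) : ℂ) * f y) :
    ∫ y, f y * lowKernel δ γ c s y =
      ∫ σ in Ioc 0 s, ∫ y, f y * 𝓕⁻ (lowPiece δ γ c σ : Rn n → ℂ) y := by
  obtain ⟨C, hC0, hC⟩ := integral_norm_fourierInv_lowPiece_le (n := n) hn hδ hγ hc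
  have hfm : AEStronglyMeasurable f := by
    have hc : Continuous fun y : Rn n => (((1 + ‖y‖) ^ (n + γ - c) : ℝ) : ℂ) :=
      Complex.continuous_ofReal.comp (continuous_one_add_norm_rpow _)
    refine (hc.aestronglyMeasurable.mul hf.1).congr (.of_forall fun y => ?_)
    simp only [Pi.mul_apply]
    rw [← mul_assoc, ← Complex.ofReal_mul, ← Real.rpow_add (by positivity)]
    simp
  have hm : AEStronglyMeasurable (fun p : ℝ × Rn n =>
      f p.2 * 𝓕⁻ (lowPiece δ γ c p.1 : Rn n → ℂ) p.2) ((volume.restrict (Ioc 0 s)).prod volume) :=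
    hfm.comp_snd.mul (stronglyMeasurable_fourierInv_lowPiece hδ hγ.le c).aestronglyMeasurable
  have hI : Integrable (Function.uncurry fun (σ : ℝ) (y : Rn n) =>
      f y * 𝓕⁻ (lowPiece δ γ c σ : Rn n → ℂ) y) ((volume.restrict (Ioc 0 s)).prod volume) := by
    refine (integrable_prod_iff' hm).2 ⟨.of_forall fun y => (hC s hs hs2 y).1.const_mul (f y), ?_⟩
    refine (hf.norm.const_mul C).mono' hm.norm.prod_swap.integral_prod_right' (.of_forall fun y => ?_)
    rw [Real.norm_of_nonneg (integral_nonneg fun _ => norm_nonneg _)]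
    simp only [norm_mul]
    rw [integral_const_mul, Complex.norm_real, Real.norm_of_nonneg (by positivity), ← mul_assoc,
      mul_comm]
    exact mul_le_mul_of_nonneg_right (hC s hs hs2 y).2 (norm_nonneg _)
  rw [integral_integral_swap hI]
  congr 1; ext y
  rw [lowKernel, integral_const_mul]

end LowFrequency

/-! ### Gaussians as Schwartz functions. -/

section Gaussian

open scoped ContDiff

variable {n : ℕ}

theorem one_add_pow_mul_exp_neg_sq_le {ε : ℝ} (hε : 0 < ε) (k : ℕ) :
    ∃ C, ∀ t : ℝ, 0 ≤ t → (1 + t) ^ k * Real.exp (-ε * t ^ 2) ≤ C := by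
  refine ⟨k.factorial * Real.exp (1 + 1 / (4 * ε)), fun t ht => ?_⟩
  have h1 : (1 + t) ^ k ≤ k.factorial * Real.exp (1 + t) := by
    have := Real.pow_div_factorial_le_exp (x := 1 + t) (by positivity) k
    rwa [div_le_iff₀ (by positivity), mul_comm] at this
  have h2 : t - ε * t ^ 2 ≤ 1 / (4 * ε) := by
    rw [le_div_iff₀ (by positivity)]
    nlinarith [sq_nonneg (2 * ε * t - 1)]
  calc (1 + t) ^ k * Real.exp (-ε * t ^ 2)
      ≤ k.factorial * Real.exp (1 + t) * Real.exp (-ε * t ^ 2) := by gcongr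
    _ = k.factorial * Real.exp (1 + t - ε * t ^ 2) := by
        rw [mul_assoc, ← Real.exp_add]; congr 2; ring
    _ ≤ _ := by
        gcongr
        linarith

theorem exists_schwartz_gaussian {ε : ℝ} (hε : 0 < ε) :
    ∃ φ : 𝓢(Rn n, ℂ), ∀ y, φ y = (Real.exp (-ε * ‖y‖ ^ 2) : ℂ) := by
  have hq : (fun y : Rn n => -ε * ‖y‖ ^ 2).HasTemperateGrowth :=
    (Function.HasTemperateGrowth.const (-ε)).mul
      (Function.hasTemperateGrowth_norm_sq (H := Rn n))
  have hsm : ContDiff ℝ ∞ fun y : Rn n => Real.exp (-ε * ‖y‖ ^ 2) :=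
    Real.contDiff_exp.comp hq.1
  refine ⟨⟨fun y => (Real.exp (-ε * ‖y‖ ^ 2) : ℂ), Complex.ofRealCLM.contDiff.comp hsm,
    fun k m => ?_⟩, fun y => rfl⟩
  obtain ⟨j, C, hC0, hC⟩ := hq.norm_iteratedFDeriv_le_uniform m
  obtain ⟨M, hM⟩ := one_add_pow_mul_exp_neg_sq_le hε (k + j * m)
  refine ⟨m.factorial * max C 1 ^ m * M, fun y => ?_⟩
  have h1 : ‖iteratedFDeriv ℝ m (fun y : Rn n => (Real.exp (-ε * ‖y‖ ^ 2) : ℂ)) y‖ =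
      ‖iteratedFDeriv ℝ m (fun y : Rn n => Real.exp (-ε * ‖y‖ ^ 2)) y‖ :=
    Complex.ofRealLI.norm_iteratedFDeriv_comp_left (hsm.contDiffAt (x := y))
      (by exact_mod_cast le_top)
  have h2 : ‖iteratedFDeriv ℝ m (Real.exp ∘ fun y : Rn n => -ε * ‖y‖ ^ 2) y‖ ≤
      m.factorial * Real.exp (-ε * ‖y‖ ^ 2) * (max C 1 * (1 + ‖y‖) ^ j) ^ m := by
    refine norm_iteratedFDeriv_comp_le (N := ∞) Real.contDiff_exp hq.1 (by exact_mod_cast le_top)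
      y (fun i _ => ?_) fun i hi him => ?_
    · rw [norm_iteratedFDeriv_eq_norm_iteratedDeriv, iteratedDeriv_eq_iterate, Real.iter_deriv_exp,
        Real.norm_of_nonneg (Real.exp_pos _).le]
    · refine (hC i him y).trans ?_
      have h3 : (1 : ℝ) ≤ max C 1 * (1 + ‖y‖) ^ j :=
        one_le_mul_of_one_le_of_one_le (le_max_right _ _)
          (one_le_pow₀ (by linarith [norm_nonneg y]))
      calc C * (1 + ‖y‖) ^ j ≤ max C 1 * (1 + ‖y‖) ^ j := by
            gcongr; exact le_max_left _ _
        _ ≤ _ := le_self_pow₀ h3 (by omega)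
  rw [h1]
  calc ‖y‖ ^ k * _ ≤ (1 + ‖y‖) ^ k *
        (m.factorial * Real.exp (-ε * ‖y‖ ^ 2) * (max C 1 * (1 + ‖y‖) ^ j) ^ m) := by
        gcongr
        · linarith
        · exact h2
    _ = m.factorial * max C 1 ^ m *
        ((1 + ‖y‖) ^ (k + j * m) * Real.exp (-ε * ‖y‖ ^ 2)) := by
        rw [mul_pow, ← pow_mul, pow_add]; ring
    _ ≤ _ := by gcongr; exact hM _ (norm_nonneg y)

end Gaussian

/-! ### Linearity and inversion for Fourier integrals. -/

section Linearity

variable {n : ℕ}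

theorem integrable_fourierChar_mul {u : Rn n → ℂ} (hu : Integrable u) (y : Rn n) :
    Integrable fun ξ : Rn n => (Real.fourierChar (inner ℝ ξ y) : ℂ) * u ξ :=
  hu.bdd_mul (c := 1) (continuous_coe_fourierChar.comp (by fun_prop)).aestronglyMeasurable
    (.of_forall fun p => (Circle.norm_coe _).le)

theorem fourierInv_add_apply {u v : Rn n → ℂ} (hu : Integrable u) (hv : Integrable v) (y : Rn n) :
    𝓕⁻ (fun ξ => u ξ + v ξ) y = 𝓕⁻ u y + 𝓕⁻ v y := by
  simp only [Real.fourierInv_eq, Circle.smul_def, smul_eq_mul, mul_add]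
  exact integral_add (integrable_fourierChar_mul hu y) (integrable_fourierChar_mul hv y)

theorem fourierInv_sub_apply {u v : Rn n → ℂ} (hu : Integrable u) (hv : Integrable v) (y : Rn n) :
    𝓕⁻ (fun ξ => u ξ - v ξ) y = 𝓕⁻ u y - 𝓕⁻ v y := by
  simp only [Real.fourierInv_eq, Circle.smul_def, smul_eq_mul, mul_sub]
  exact integral_sub (integrable_fourierChar_mul hu y) (integrable_fourierChar_mul hv y)

theorem fourierInv_const_mul_apply (c : ℂ) (u : Rn n → ℂ) (y : Rn n) :
    𝓕⁻ (fun ξ => c * u ξ) y = c * 𝓕⁻ u y := by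
  simp only [Real.fourierInv_eq, Circle.smul_def, smul_eq_mul]
  rw [← integral_const_mul]
  congr 1; ext ξ; ring

theorem integrable_cutoff {s : ℝ} (hs : 0 < s) : Integrable fun ξ : Rn n => (cutoff s ξ : ℂ) :=
  (Complex.continuous_ofReal.comp (contDiff_cutoff (k := 0) s).continuous).integrable_of_hasCompactSupport
    (hasCompactSupport_of_norm (r := 3 / 2 * s) fun ξ h => by simp [cutoff_of_le_norm hs h])

theorem fourierInv_fourier_schwartz (Φ : 𝓢(Rn n, ℂ)) (y : Rn n) :
    𝓕⁻ (𝓕 (Φ : Rn n → ℂ)) y = Φ y := by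
  rw [← SchwartzMap.fourier_coe, ← SchwartzMap.fourierInv_coe,
    FourierTransform.fourierInv_fourier_eq]

theorem fourier_fourierInv_schwartz (Φ : 𝓢(Rn n, ℂ)) (y : Rn n) :
    𝓕 (𝓕⁻ (Φ : Rn n → ℂ)) y = Φ y := by
  rw [← SchwartzMap.fourierInv_coe, ← SchwartzMap.fourier_coe,
    FourierTransform.fourier_fourierInv_eq]

end Linearity

/-! ### Decay of the Bochner-Riesz kernel at R = 1. -/

section KernelDecay

open scoped ContDiff

variable {n : ℕ}

/-- The part of the Bochner-Riesz kernel with frequencies in `|ξ| ≤ 3/4`. -/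
def lowKernelPart (δ γ : ℝ) (y : Rn n) : ℂ :=
  lowPass (1 / 2) one_half_pos y + lowKernel δ γ 0 (1 / 2) y

/-- The multiplier of the part of the Bochner-Riesz kernel with frequencies in `|ξ| ≥ 1/2`. -/
def highSymbol (δ γ : ℝ) (ξ : Rn n) : ℂ :=
  (((1 - cutoff (1 / 2) ξ) * bochnerRieszMultiplier δ γ 1 ξ : ℝ) : ℂ)

theorem integrable_bochnerRieszMultiplier_one {δ γ : ℝ} (hδ : 0 < δ) (hγ : 0 ≤ γ) :
    Integrable fun ξ : Rn n => (bochnerRieszMultiplier δ γ 1 ξ : ℂ) :=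
  (Complex.continuous_ofReal.comp
    (continuous_bochnerRieszMultiplier_one hδ.le hγ)).integrable_of_hasCompactSupport
    (hasCompactSupport_of_norm (r := 1) fun ξ h => by
      simp [bochnerRieszMultiplier_one_of_one_le hδ hγ h])

theorem integrable_highSymbol {δ γ : ℝ} (hδ : 0 < δ) (hγ : 0 ≤ γ) :
    Integrable (highSymbol δ γ : Rn n → ℂ) :=
  (Complex.continuous_ofReal.comp
    ((continuous_const.sub (contDiff_cutoff (k := 0) _).continuous).mul
      (continuous_bochnerRieszMultiplier_one hδ.le hγ))).integrable_of_hasCompactSupport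
    (hasCompactSupport_of_norm (r := 1) fun ξ h => by
      simp [bochnerRieszMultiplier_one_of_one_le hδ hγ h])

theorem bochnerRieszKernel_one_eq (hn : 0 < n) {δ γ : ℝ} (hδ : 0 < δ) (hγ : 0 < γ) (y : Rn n) :
    bochnerRieszKernel δ γ 1 y = lowKernelPart δ γ y + 𝓕⁻ (highSymbol δ γ) y := by
  have h1 := integrable_lowSymbol (n := n) (c := 0) hn hδ.le hγ hγ.le one_half_pos le_rfl
  have h2 := fourierInv_add_apply (integrable_cutoff one_half_pos) h1 y
  have h3 := fourierInv_add_apply (u := fun ξ : Rn n => (cutoff (1 / 2) ξ : ℂ) +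
      ((cutoff (1 / 2) ξ * (bochnerRieszMultiplier δ γ 1 ξ - 1) * ‖ξ‖ ^ (-(0 : ℝ)) : ℝ) : ℂ))
    ((integrable_cutoff one_half_pos).add h1) (integrable_highSymbol hδ hγ.le) y
  rw [lowKernelPart, lowPass_eq, lowKernel_eq hn hδ.le hγ hγ.le one_half_pos le_rfl, ← h2, ← h3,
    bochnerRieszKernel]
  refine congrArg (fun u : Rn n → ℂ => 𝓕⁻ u y) (funext fun ξ => ?_)
  simp only [highSymbol]
  rw [neg_zero, Real.rpow_zero]
  push_cast
  ring

theorem norm_lowKernelPart_le (hn : 0 < n) {δ γ : ℝ} (hδ : 0 < δ) (hγ : 0 < γ) :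
    ∃ C, 0 ≤ C ∧ ∀ y : Rn n, ‖lowKernelPart δ γ y‖ ≤ C * (1 + ‖y‖) ^ (-(n + γ)) := by
  obtain ⟨C, hC0, hC⟩ := norm_lowKernel_le (n := n) (c := 0) hn hδ.le hγ hγ.le
  obtain ⟨D, hD0, hD⟩ := schwartz_decay (lowPass (n := n) (1 / 2) one_half_pos) (n + γ)
  refine ⟨D + C, by positivity, fun y => (norm_add_le _ _).trans ?_⟩
  have := hC (1 / 2) (by norm_num) le_rfl y
  rw [sub_zero] at this
  linarith [hD y]

/-- Away from 0 the factor (1 - |ξ|^γ)₊^δ equals (1 - |ξ|²)₊^δ times a smooth function, namely the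
quotient of `exists_smooth_quotient` with t = |ξ|² and c = γ/2. Hence the kernel is a Schwartz
function convolved with the ball kernel, and inherits its decay. -/
theorem norm_fourierInv_highSymbol_le (hn : 0 < n) {δ γ : ℝ} (hδ : 0 < δ) (hγ : 0 < γ) :
    ∃ C, 0 ≤ C ∧ ∀ y : Rn n,
      ‖𝓕⁻ (highSymbol δ γ) y‖ ≤ C * (1 + ‖y‖) ^ (-(δ + (n + 1) / 2)) := by
  obtain ⟨Q, hQ, hQe⟩ := exists_smooth_quotient (half_pos hγ) δ
  set q : Rn n → ℝ := fun ξ => (1 - cutoff (1 / 2) ξ) * cutoff 1 ξ * Q (‖ξ‖ ^ 2) with hq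
  have hqs : ContDiff ℝ ∞ q := by
    rw [contDiff_iff_contDiffAt]
    intro ξ
    rcases eq_or_ne ξ 0 with rfl | hξ
    · have : q =ᶠ[𝓝 0] fun _ => 0 := by
        filter_upwards [Metric.ball_mem_nhds (0 : Rn n) one_half_pos] with ζ hζ
        rw [mem_ball_zero_iff] at hζ
        simp only [hq, cutoff_of_norm_le one_half_pos hζ.le]
        ring
      exact contDiffAt_const.congr_of_eventuallyEq this
    · have h1 : ContDiffAt ℝ ∞ (fun ξ : Rn n => Q (‖ξ‖ ^ 2)) ξ :=
        (hQ _ (by positivity)).comp ξ (contDiff_norm_sq ℝ).contDiffAt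
      exact ((contDiffAt_const.sub (contDiff_cutoff (k := ⊤) _).contDiffAt).mul
        (contDiff_cutoff (k := ⊤) _).contDiffAt).mul h1
  let k0 : 𝓢(Rn n, ℂ) := HasCompactSupport.toSchwartzMap (f := fun ξ : Rn n => (q ξ : ℂ))
    (hasCompactSupport_of_norm (r := 3 / 2) fun ξ h => by
      simp [hq, cutoff_of_le_norm one_pos (by simpa using h)])
    (Complex.ofRealCLM.contDiff.comp hqs)
  have hk : ∀ ξ, 𝓕 ((𝓕⁻ k0 : 𝓢(Rn n, ℂ)) : Rn n → ℂ) ξ = (q ξ : ℂ) := fun ξ => by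
    rw [SchwartzMap.fourierInv_coe, fourier_fourierInv_schwartz]; rfl
  have hw := integrable_ballProfile_norm n hδ
  obtain ⟨C, hC0, hC⟩ := fourierInv_ballProfile_decay hn hδ
  have hsym : ∀ ξ : Rn n, highSymbol δ γ ξ = (q ξ : ℂ) * ((ballProfile δ ‖ξ‖ : ℝ) : ℂ) := by
    intro ξ
    rw [highSymbol, ← Complex.ofReal_mul]
    congr 1
    rcases eq_or_ne ξ 0 with rfl | hξ
    · have h0 : cutoff (1 / 2) (0 : Rn n) = 1 := cutoff_of_norm_le one_half_pos (by simp)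
      simp only [hq, h0]
      ring
    have h1 := hQe (‖ξ‖ ^ 2) (by positivity)
    have h2 : (‖ξ‖ ^ 2) ^ (γ / 2) = ‖ξ‖ ^ γ := by
      rw [← Real.rpow_natCast, ← Real.rpow_mul (norm_nonneg ξ)]
      congr 1; push_cast; ring
    rw [h2] at h1
    rw [bochnerRieszMultiplier_one, h1]
    rcases le_or_gt ‖ξ‖ 1 with h | h
    · simp only [hq, cutoff_of_norm_le one_pos h, ballProfile]
      ring
    · rw [max_eq_right (by nlinarith), Real.zero_rpow hδ.ne', ballProfile, max_eq_right
        (by nlinarith), Real.zero_rpow hδ.ne']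
      ring
  have ha : 0 ≤ δ + (n + 1) / 2 := by positivity
  refine ⟨C * ∫ z, ‖(𝓕⁻ k0 : 𝓢(Rn n, ℂ)) z‖ * (1 + ‖z‖) ^ (δ + ((n : ℝ) + 1) / 2),
    mul_nonneg hC0 (integral_nonneg fun z => by positivity), fun y => ?_⟩
  have h3 := integral_mul_fourierInv_sub (𝓕⁻ k0 : 𝓢(Rn n, ℂ)).integrable hw y
  simp only [hk, ← hsym] at h3
  rw [← h3]
  exact norm_integral_mul_sub_le ha (schwartz_integrable_weight _ _) hC y

/-- The sphere dominates: δ < (n-1)/2 gives δ + (n+1)/2 < n, whereas the origin contributes decay of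
order n + γ. -/
theorem norm_bochnerRieszKernel_one_le (hn : 0 < n) {δ γ : ℝ} (hδ : 0 < δ)
    (hδn : δ < ((n : ℝ) - 1) / 2) (hγ : 0 < γ) :
    ∃ C, 0 ≤ C ∧ ∀ y : Rn n,
      ‖bochnerRieszKernel δ γ 1 y‖ ≤ C * (1 + ‖y‖) ^ (-(δ + (n + 1) / 2)) := by
  obtain ⟨C, hC0, hC⟩ := norm_lowKernelPart_le hn hδ hγ
  obtain ⟨D, hD0, hD⟩ := norm_fourierInv_highSymbol_le hn hδ hγ
  refine ⟨C + D, by positivity, fun y => ?_⟩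
  rw [bochnerRieszKernel_one_eq hn hδ hγ]
  have h1 : (1 + ‖y‖) ^ (-(n + γ)) ≤ (1 + ‖y‖) ^ (-(δ + (n + 1) / 2)) :=
    Real.rpow_le_rpow_of_exponent_le (by linarith [norm_nonneg y]) (by linarith)
  calc _ ≤ C * (1 + ‖y‖) ^ (-(n + γ)) + D * (1 + ‖y‖) ^ (-(δ + (n + 1) / 2)) :=
        (norm_add_le _ _).trans (add_le_add (hC y) (hD y))
    _ ≤ C * (1 + ‖y‖) ^ (-(δ + (n + 1) / 2)) + D * (1 + ‖y‖) ^ (-(δ + (n + 1) / 2)) := by gcongr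
    _ = _ := by ring

theorem continuous_bochnerRieszKernel_one {δ γ : ℝ} (hδ : 0 < δ) (hγ : 0 ≤ γ) :
    Continuous (bochnerRieszKernel δ γ 1 : Rn n → ℂ) :=
  continuous_fourierInv_of_integrable (integrable_bochnerRieszMultiplier_one hδ hγ)

end KernelDecay

/-! ### Convolutions and the splitting of test functions by frequency. -/

section Convolve

variable {n : ℕ}

/-- The convolution of two functions. -/
def convolve (k b : Rn n → ℂ) (y : Rn n) : ℂ := ∫ z, k z * b (y - z)

theorem norm_convolve_le {k b : Rn n → ℂ} {a C : ℝ} (ha : 0 ≤ a)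
    (hk : Integrable fun z => ‖k z‖ * (1 + ‖z‖) ^ a)
    (hb : ∀ y, ‖b y‖ ≤ C * (1 + ‖y‖) ^ (-a)) (y : Rn n) :
    ‖convolve k b y‖ ≤ C * (∫ z, ‖k z‖ * (1 + ‖z‖) ^ a) * (1 + ‖y‖) ^ (-a) :=
  norm_integral_mul_sub_le ha hk hb y

theorem convolve_fourierInv {k w : Rn n → ℂ} (hk : Integrable k) (hw : Integrable w) :
    convolve k (𝓕⁻ w) = 𝓕⁻ (fun ξ => 𝓕 k ξ * w ξ) :=
  funext fun y => integral_mul_fourierInv_sub hk hw y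

theorem continuous_fourier_of_integrable {k : Rn n → ℂ} (hk : Integrable k) :
    Continuous (𝓕 k) :=
  VectorFourier.fourierIntegral_continuous Real.continuous_fourierChar
    (by exact continuous_inner) hk

theorem norm_fourier_le_integral (k : Rn n → ℂ) (ξ : Rn n) : ‖𝓕 k ξ‖ ≤ ∫ z, ‖k z‖ :=
  VectorFourier.norm_fourierIntegral_le_integral_norm _ _ _ _ _

theorem integrable_fourier_mul {k w : Rn n → ℂ} (hk : Integrable k) (hw : Integrable w) :
    Integrable fun ξ => 𝓕 k ξ * w ξ :=
  hw.bdd_mul (continuous_fourier_of_integrable hk).aestronglyMeasurable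
    (.of_forall fun ξ => norm_fourier_le_integral k ξ)

theorem continuous_convolve_fourierInv {k w : Rn n → ℂ} (hk : Integrable k) (hw : Integrable w) :
    Continuous (convolve k (𝓕⁻ w)) := by
  rw [convolve_fourierInv hk hw]
  exact continuous_fourierInv_of_integrable (integrable_fourier_mul hk hw)

theorem integrable_fourier_schwartz (Φ : 𝓢(Rn n, ℂ)) : Integrable (𝓕 (Φ : Rn n → ℂ)) := by
  rw [← SchwartzMap.fourier_coe]
  exact (𝓕 Φ).integrable

theorem fourierInv_fourier_schwartz_fun (Φ : 𝓢(Rn n, ℂ)) :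
    𝓕⁻ (𝓕 (Φ : Rn n → ℂ)) = (Φ : Rn n → ℂ) :=
  funext (fourierInv_fourier_schwartz Φ)

theorem convolve_schwartz {k : Rn n → ℂ} (hk : Integrable k) (Φ : 𝓢(Rn n, ℂ)) :
    convolve k Φ = 𝓕⁻ (fun ξ => 𝓕 k ξ * 𝓕 (Φ : Rn n → ℂ) ξ) := by
  rw [← convolve_fourierInv hk (integrable_fourier_schwartz Φ), fourierInv_fourier_schwartz_fun]

theorem continuous_convolve_schwartz {k : Rn n → ℂ} (hk : Integrable k) (Φ : 𝓢(Rn n, ℂ)) :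
    Continuous (convolve k Φ) := by
  rw [← fourierInv_fourier_schwartz_fun Φ]
  exact continuous_convolve_fourierInv hk (integrable_fourier_schwartz Φ)

theorem integrable_mul_comp_sub {k b : Rn n → ℂ} (hk : Integrable k) (hb : Continuous b) {C : ℝ}
    (hC : ∀ y, ‖b y‖ ≤ C) (y : Rn n) : Integrable fun z => k z * b (y - z) :=
  hk.mul_bdd (c := C) (hb.comp (continuous_const.sub continuous_id)).aestronglyMeasurable
    (.of_forall fun _ => hC _)

theorem aestronglyMeasurable_of_weight {a : ℝ} {f : Rn n → ℂ}
    (hf : Integrable fun y => (((1 + ‖y‖) ^ (-a) : ℝ) : ℂ) * f y) : AEStronglyMeasurable f := by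
  have hc : Continuous fun y : Rn n => (((1 + ‖y‖) ^ a : ℝ) : ℂ) :=
    Complex.continuous_ofReal.comp (continuous_one_add_norm_rpow _)
  refine (hc.aestronglyMeasurable.mul hf.1).congr (.of_forall fun y => ?_)
  simp only [Pi.mul_apply]
  rw [← mul_assoc, ← Complex.ofReal_mul, ← Real.rpow_add (by positivity)]
  simp

theorem norm_mul_le_weight {a C : ℝ} {f b : Rn n → ℂ} {y : Rn n}
    (h : ‖b y‖ ≤ C * (1 + ‖y‖) ^ (-a)) :
    ‖f y * b y‖ ≤ C * ‖(((1 + ‖y‖) ^ (-a) : ℝ) : ℂ) * f y‖ := by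
  rw [norm_mul, norm_mul, Complex.norm_real, Real.norm_of_nonneg (by positivity)]
  calc ‖f y‖ * ‖b y‖ ≤ ‖f y‖ * (C * (1 + ‖y‖) ^ (-a)) := by gcongr
    _ = _ := by ring

theorem integrable_mul_of_weight {a C : ℝ} {f b : Rn n → ℂ}
    (hf : Integrable fun y => (((1 + ‖y‖) ^ (-a) : ℝ) : ℂ) * f y) (hb : AEStronglyMeasurable b)
    (h : ∀ y, ‖b y‖ ≤ C * (1 + ‖y‖) ^ (-a)) : Integrable fun y => f y * b y :=
  (hf.norm.const_mul C).mono' ((aestronglyMeasurable_of_weight hf).mul hb)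
    (.of_forall fun y => norm_mul_le_weight (h y))

theorem rpow_norm_mul_highRiesz_symbol {lam : ℝ} {s : ℝ} (hs : 0 < s) (ξ : Rn n) :
    ‖ξ‖ ^ lam * (‖ξ‖ ^ (-lam) * (1 - cutoff s ξ)) = 1 - cutoff s ξ := by
  rcases eq_or_ne ξ 0 with rfl | hξ
  · rw [cutoff_of_norm_le hs (by simpa using hs.le)]; ring
  · rw [← mul_assoc, ← Real.rpow_add (norm_pos_iff.2 hξ)]; simp

/-- Splitting a test function into low and high frequencies, and moving the Riesz derivative
from the test function to `f` in the high frequencies. -/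
theorem IsRieszDerivative.integral_mul_schwartz {lam : ℝ} (hlam : 0 < lam) {f g : Rn n → ℂ}
    (h : IsRieszDerivative lam f g) {s : ℝ} (hs : 0 < s) (Φ : 𝓢(Rn n, ℂ)) :
    ∫ y, f y * Φ y = (∫ y, f y * convolve (lowPass s hs) Φ y) +
      ∫ y, g y * convolve (highRiesz lam s) Φ y := by
  have hW := integrable_highRiesz (n := n) hlam hs
  -- The definition of g is tested on φ = `highRiesz` * Φ, which is Schwartz and satisfies I_{-lam}
  -- φ = Φ - `lowPass` * Φ.
  set ψ : 𝓢(Rn n, ℂ) := SchwartzMap.smulLeftCLM ℂ (𝓕 (highRiesz lam s : Rn n → ℂ)) (𝓕 Φ) with hψ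
  have hψa : ∀ ξ, ψ ξ = 𝓕 (highRiesz lam s : Rn n → ℂ) ξ * 𝓕 (Φ : Rn n → ℂ) ξ := fun ξ => by
    rw [hψ, SchwartzMap.smulLeftCLM_apply_apply (hasTemperateGrowth_fourier_highRiesz hlam hs),
      smul_eq_mul, SchwartzMap.fourier_coe]
  have hφ : ((𝓕⁻ ψ : 𝓢(Rn n, ℂ)) : Rn n → ℂ) = convolve (highRiesz lam s) Φ := by
    rw [convolve_schwartz hW, SchwartzMap.fourierInv_coe]
    exact congrArg (fun u : Rn n → ℂ => 𝓕⁻ u) (funext hψa)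
  have hpot : ∀ y, rieszPotential (-lam) (𝓕⁻ ψ : 𝓢(Rn n, ℂ)) y =
      Φ y - convolve (lowPass s hs) Φ y := by
    intro y
    rw [convolve_schwartz (lowPass s hs).integrable, ← fourierInv_fourier_schwartz Φ y,
      ← fourierInv_sub_apply (integrable_fourier_schwartz Φ)
        (integrable_fourier_mul (lowPass s hs).integrable (integrable_fourier_schwartz Φ)),
      rieszPotential]
    refine congrArg (fun u : Rn n → ℂ => 𝓕⁻ u y) (funext fun ξ => ?_)
    rw [SchwartzMap.fourierInv_coe, fourier_fourierInv_schwartz, hψa, fourier_highRiesz hlam hs,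
      fourier_lowPass, neg_neg, ← mul_assoc, ← Complex.ofReal_mul,
      rpow_norm_mul_highRiesz_symbol hs]
    push_cast
    ring
  have h1 := h.2 (𝓕⁻ ψ)
  simp only [hpot] at h1
  rw [hφ] at h1
  obtain ⟨C, hC0, hC⟩ := schwartz_decay Φ (n + lam)
  have i1 : Integrable fun y => f y * Φ y :=
    integrable_mul_of_weight h.1 Φ.continuous.aestronglyMeasurable hC
  have i2 : Integrable fun y => f y * convolve (lowPass s hs) Φ y :=
    integrable_mul_of_weight h.1
      (continuous_convolve_schwartz (lowPass s hs).integrable Φ).aestronglyMeasurable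
      (norm_integral_mul_sub_le (by positivity) (schwartz_integrable_weight _ _) hC)
  rw [← h1]
  simp only [mul_sub]
  rw [integral_sub i1 i2]
  ring

end Convolve

/-! ### Frequency localization of Gaussians. -/

section GaussSplit

variable {n : ℕ}

/-- Up to a uniformly rapidly decreasing error, Gaussians with small variance in frequency have
frequencies in a fixed small ball. -/
theorem exists_gaussian_split {c : ℝ} (hc : 0 < c) (b : ℝ) :
    ∃ C, 0 ≤ C ∧ ∀ ε : ℝ, 0 < ε → ε ≤ 1 → ∃ u r : Rn n → ℂ, Integrable u ∧
      (∀ ξ, 3 / 2 * c ≤ ‖ξ‖ → u ξ = 0) ∧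
      ∀ y, (Real.exp (-ε * ‖y‖ ^ 2) : ℂ) = 𝓕⁻ u y + r y ∧ ‖r y‖ ≤ C * (1 + ‖y‖) ^ (-b) := by
  obtain ⟨k, hk⟩ := exists_nat_ge (max b 1)
  have hk1 : (1 : ℝ) ≤ k := (le_max_right _ _).trans hk
  have hkb : b ≤ 2 * k := by linarith [(le_max_left _ _).trans hk]
  have hk0 : (0 : ℝ) < 2 * k := by linarith
  obtain ⟨φ, hφ⟩ := exists_schwartz_gaussian (n := n) one_pos
  have htg : (fun ξ : Rn n => (((‖ξ‖ ^ 2) ^ k : ℝ) : ℂ)).HasTemperateGrowth :=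
    Complex.ofRealCLM.hasTemperateGrowth.comp
      ((Function.hasTemperateGrowth_norm_sq (H := Rn n)).pow k)
  set P : 𝓢(Rn n, ℂ) := SchwartzMap.smulLeftCLM ℂ (fun ξ : Rn n => (((‖ξ‖ ^ 2) ^ k : ℝ) : ℂ)) (𝓕 φ)
    with hP
  have hPa : ∀ ξ, P ξ = (((‖ξ‖ ^ 2) ^ k : ℝ) : ℂ) * (𝓕 φ : 𝓢(Rn n, ℂ)) ξ := fun ξ => by
    rw [hP, SchwartzMap.smulLeftCLM_apply_apply htg, smul_eq_mul]
  obtain ⟨C, hC0, hC⟩ := schwartz_decay (𝓕⁻ P : 𝓢(Rn n, ℂ)) (2 * k)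
  have hW := integrable_highRiesz (n := n) hk0 hc
  refine ⟨C * ∫ z : Rn n, ‖highRiesz (2 * k) c z‖ * (1 + ‖z‖) ^ (2 * k : ℝ),
    mul_nonneg hC0 (integral_nonneg fun z => by positivity), fun ε hε hε1 => ?_⟩
  set τ := √ε with hτ
  have hτ0 : 0 < τ := Real.sqrt_pos.2 hε
  have hτ1 : τ ≤ 1 := Real.sqrt_le_one.2 hε1
  have hτ2 : τ ^ 2 = ε := Real.sq_sqrt hε.le
  set v : Rn n → ℂ := fun ξ => (((τ ^ n)⁻¹ : ℝ) : ℂ) * (𝓕 φ : 𝓢(Rn n, ℂ)) (τ⁻¹ • ξ) with hv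
  have hvi : Integrable v :=
    (((𝓕 φ : 𝓢(Rn n, ℂ)).integrable (μ := volume)).comp_smul (inv_ne_zero hτ0.ne')).const_mul _
  have hvF : ∀ y, 𝓕⁻ v y = (Real.exp (-ε * ‖y‖ ^ 2) : ℂ) := by
    intro y
    rw [hv, fourierInv_const_mul_apply, fourierInv_comp_inv_smul _ hτ0, ← mul_assoc,
      ← Complex.ofReal_mul, inv_mul_cancel₀ (by positivity), SchwartzMap.fourier_coe,
      fourierInv_fourier_schwartz, hφ, norm_smul, Real.norm_of_nonneg hτ0.le, mul_pow, hτ2]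
    push_cast
    ring_nf
  have hcut : Continuous fun ξ : Rn n => (cutoff c ξ : ℂ) :=
    Complex.continuous_ofReal.comp (contDiff_cutoff (k := 0) c).continuous
  have hui : Integrable fun ξ => (cutoff c ξ : ℂ) * v ξ :=
    hvi.bdd_mul (c := 1) hcut.aestronglyMeasurable (.of_forall fun ξ => by
      rw [Complex.norm_real, Real.norm_of_nonneg (cutoff_nonneg _ _)]; exact cutoff_le_one _ _)
  -- This is |ξ|^(2k) v(ξ), so (1 - cutoff) v is w multiplied by the symbol of `highRiesz (2 * k)
  -- c`. The gained factor τ^(2k) pays for the spread of the dilated kernel: τ^(2k) (1 + τ‖y‖)^(-2k)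
  -- ≤ (1 + ‖y‖)^(-2k) when τ ≤ 1. This makes the bound uniform in ε.
  set w : Rn n → ℂ := fun ξ => (((τ ^ (2 * k)) * (τ ^ n)⁻¹ : ℝ) : ℂ) * P (τ⁻¹ • ξ) with hw
  have hwi : Integrable w :=
    ((P.integrable (μ := volume)).comp_smul (inv_ne_zero hτ0.ne')).const_mul _
  have hwF : ∀ y, ‖𝓕⁻ w y‖ ≤ C * (1 + ‖y‖) ^ (-(2 * k : ℝ)) := by
    intro y
    rw [hw, fourierInv_const_mul_apply, fourierInv_comp_inv_smul _ hτ0, ← mul_assoc,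
      ← Complex.ofReal_mul, mul_assoc, inv_mul_cancel₀ (by positivity), mul_one, norm_mul,
      Complex.norm_real, Real.norm_of_nonneg (by positivity), ← SchwartzMap.fourierInv_coe]
    refine (mul_le_mul_of_nonneg_left (hC _) (by positivity)).trans ?_
    rw [norm_smul, Real.norm_of_nonneg hτ0.le, mul_left_comm]
    refine mul_le_mul_of_nonneg_left ?_ hC0
    have h1 : (τ : ℝ) ^ (2 * k) = τ ^ (2 * k : ℝ) := by
      rw [← Real.rpow_natCast]; push_cast; rfl
    rw [h1, Real.rpow_neg (by positivity), Real.rpow_neg (by positivity), ← div_eq_mul_inv,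
      div_le_iff₀ (by positivity), inv_mul_eq_div, le_div_iff₀ (by positivity),
      ← Real.mul_rpow hτ0.le (by positivity)]
    refine Real.rpow_le_rpow (by positivity) ?_ hk0.le
    nlinarith [norm_nonneg y]
  have hvw : ∀ ξ, v ξ - (cutoff c ξ : ℂ) * v ξ = 𝓕 (highRiesz (2 * k) c : Rn n → ℂ) ξ * w ξ := by
    intro ξ
    simp only [fourier_highRiesz hk0 hc, hw, hv, hPa]
    have h2 : ((‖τ⁻¹ • ξ‖ ^ 2) ^ k : ℝ) = (τ ^ (2 * k))⁻¹ * ‖ξ‖ ^ (2 * k : ℝ) := by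
      rw [norm_smul, norm_inv, Real.norm_of_nonneg hτ0.le, ← pow_mul, mul_pow, inv_pow]
      congr 1
      rw [← Real.rpow_natCast]; push_cast; rfl
    rw [h2]
    have h3 := rpow_norm_mul_highRiesz_symbol (lam := 2 * k) hc ξ
    have h4 : (τ ^ (2 * k)) * (τ ^ (2 * k))⁻¹ = 1 := mul_inv_cancel₀ (by positivity)
    have h5 : ‖ξ‖ ^ (-(2 * k : ℝ)) * (1 - cutoff c ξ) * (τ ^ (2 * k) * (τ ^ n)⁻¹ *
        ((τ ^ (2 * k))⁻¹ * ‖ξ‖ ^ (2 * k : ℝ))) = (1 - cutoff c ξ) * (τ ^ n)⁻¹ := by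
      linear_combination (‖ξ‖ ^ (-(2 * k : ℝ)) * (1 - cutoff c ξ) * (τ ^ n)⁻¹ *
        ‖ξ‖ ^ (2 * k : ℝ)) * h4 + (τ ^ n)⁻¹ * h3
    calc _ = (((1 - cutoff c ξ) * (τ ^ n)⁻¹ : ℝ) : ℂ) * (𝓕 φ : 𝓢(Rn n, ℂ)) (τ⁻¹ • ξ) := by
          push_cast; ring
      _ = _ := by
          rw [← h5]; push_cast; ring
  refine ⟨fun ξ => (cutoff c ξ : ℂ) * v ξ, convolve (highRiesz (2 * k) c) (𝓕⁻ w), hui,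
    fun ξ hξ => by simp [cutoff_of_le_norm hc hξ], fun y => ⟨?_, ?_⟩⟩
  · rw [convolve_fourierInv hW hwi, ← hvF]
    simp only [← hvw]
    rw [fourierInv_sub_apply hvi hui]
    ring
  · refine (norm_integral_mul_sub_le hk0.le (integrable_highRiesz_weight hk0 hc _) hwF y).trans ?_
    refine mul_le_mul_of_nonneg_left ?_
      (mul_nonneg hC0 (integral_nonneg fun z => by positivity))
    exact Real.rpow_le_rpow_of_exponent_le (by linarith [norm_nonneg y]) (by linarith)

end GaussSplit

/-! ### Convergence of the Gauss regularizations at R = 1. -/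

section GaussLimit

variable {n : ℕ}

/-- Disjoint frequencies: u lives in ‖η‖ < 3/32, `highSymbol` in ‖ξ‖ ≥ 1/2, the low pass in ‖ξ‖ <
3/8, and 3/8 + 3/32 < 1/2. -/
theorem convolve_lowPass_mul_highSymbol_eq_zero {δ γ : ℝ} (hδ : 0 < δ) (hγ : 0 ≤ γ) {u : Rn n → ℂ}
    (hu : Integrable u) (h0 : ∀ ξ, 3 / 2 * (1 / 16) ≤ ‖ξ‖ → u ξ = 0) (y : Rn n) :
    convolve (lowPass (1 / 4) (by norm_num)) (fun y => 𝓕⁻ u y * 𝓕⁻ (highSymbol δ γ) y) y = 0 := by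
  have hb := integrable_highSymbol (n := n) hδ hγ
  have hc : Integrable fun ξ => ∫ η, u η * highSymbol δ γ (ξ - η) :=
    hu.integrable_convolution (ContinuousLinearMap.mul ℂ ℂ) hb
  have h1 : (fun y => 𝓕⁻ u y * 𝓕⁻ (highSymbol δ γ) y) =
      𝓕⁻ (fun ξ => ∫ η, u η * highSymbol δ γ (ξ - η)) :=
    funext fun y => fourierInv_mul_fourierInv hu hb y
  rw [h1, convolve_fourierInv (lowPass (1 / 4) (by norm_num)).integrable hc]
  have h2 : ∀ ξ : Rn n, 𝓕 (lowPass (1 / 4) (by norm_num) : Rn n → ℂ) ξ *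
      ∫ η, u η * highSymbol δ γ (ξ - η) = 0 := by
    intro ξ
    rw [fourier_lowPass]
    rcases le_or_gt (3 / 8) ‖ξ‖ with hξ | hξ
    · rw [cutoff_of_le_norm (by norm_num) (by linarith)]; simp
    · have : ∀ η, u η * highSymbol δ γ (ξ - η) = 0 := by
        intro η
        rcases le_or_gt (3 / 2 * (1 / 16)) ‖η‖ with hη | hη
        · rw [h0 η hη, zero_mul]
        · have h3 : ‖ξ - η‖ ≤ 1 / 2 := (norm_sub_le _ _).trans (by linarith)
          rw [highSymbol, cutoff_of_norm_le one_half_pos h3]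
          simp
      simp [this]
  simp only [h2]
  rw [Real.fourierInv_eq]
  simp

theorem norm_exp_neg_mul_sq_le {ε : ℝ} (hε : 0 ≤ ε) (y : Rn n) :
    ‖(Real.exp (-ε * ‖y‖ ^ 2) : ℂ)‖ ≤ 1 := by
  rw [Complex.norm_real, Real.norm_of_nonneg (Real.exp_pos _).le, Real.exp_le_one_iff]
  have := mul_nonneg hε (sq_nonneg ‖y‖)
  linarith

/-- The low frequencies of the Gauss regularization of the Bochner-Riesz kernel decrease as fast
as the smooth part of the kernel, uniformly in the regularization. -/
theorem exists_norm_convolve_lowPass_gauss_le (hn : 0 < n) {δ γ d : ℝ} (hδ : 0 < δ) (hγ : 0 < γ)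
    (hd : 0 ≤ d) (hdn : d ≤ n + γ) :
    ∃ C, 0 ≤ C ∧ ∀ ε : ℝ, 0 < ε → ε ≤ 1 → ∀ y : Rn n,
      ‖convolve (lowPass (1 / 4) (by norm_num))
        (fun y => (Real.exp (-ε * ‖y‖ ^ 2) : ℂ) * bochnerRieszKernel δ γ 1 y) y‖ ≤
        C * (1 + ‖y‖) ^ (-d) := by
  obtain ⟨C₁, hC₁0, hC₁⟩ := norm_lowKernelPart_le (n := n) hn hδ hγ
  obtain ⟨C₂, hC₂0, hC₂⟩ := exists_gaussian_split (n := n) (c := 1 / 16) (by norm_num) d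
  set M := ∫ ξ : Rn n, ‖highSymbol δ γ ξ‖ with hM
  have hM0 : 0 ≤ M := integral_nonneg fun _ => norm_nonneg _
  set ρ : 𝓢(Rn n, ℂ) := lowPass (1 / 4) (by norm_num) with hρ
  refine ⟨(C₁ + C₂ * M) * ∫ z, ‖ρ z‖ * (1 + ‖z‖) ^ d, mul_nonneg (by positivity)
    (integral_nonneg fun z => by positivity), fun ε hε hε1 y => ?_⟩
  obtain ⟨u, r, hu, hu0, hur⟩ := hC₂ ε hε hε1
  -- The subtracted product is annihilated by the low pass. What remains is the Gaussian times the
  -- smooth part of the kernel plus the rapidly decreasing error r times a bounded function, so it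
  -- has the required decay uniformly in ε.
  set S : Rn n → ℂ := fun y => (Real.exp (-ε * ‖y‖ ^ 2) : ℂ) * bochnerRieszKernel δ γ 1 y -
    𝓕⁻ u y * 𝓕⁻ (highSymbol δ γ) y with hS
  have hSle : ∀ y, ‖S y‖ ≤ (C₁ + C₂ * M) * (1 + ‖y‖) ^ (-d) := by
    intro y
    have h1 : S y = (Real.exp (-ε * ‖y‖ ^ 2) : ℂ) * lowKernelPart δ γ y +
        r y * 𝓕⁻ (highSymbol δ γ) y := by
      simp only [hS]
      rw [bochnerRieszKernel_one_eq hn hδ hγ, mul_add]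
      linear_combination (𝓕⁻ (highSymbol δ γ) y) * (hur y).1
    have h2 : (1 + ‖y‖) ^ (-(n + γ)) ≤ (1 + ‖y‖) ^ (-d) :=
      Real.rpow_le_rpow_of_exponent_le (by linarith [norm_nonneg y]) (by linarith)
    rw [h1]
    refine (norm_add_le _ _).trans ?_
    rw [norm_mul, norm_mul, add_mul]
    gcongr ?_ + ?_
    · calc _ ≤ 1 * (C₁ * (1 + ‖y‖) ^ (-(n + γ))) := by
            gcongr
            · exact norm_exp_neg_mul_sq_le hε.le y
            · exact hC₁ y
        _ ≤ _ := by rw [one_mul]; gcongr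
    · calc _ ≤ (C₂ * (1 + ‖y‖) ^ (-d)) * M := by
            gcongr
            · exact (hur y).2
            · exact norm_fourierInv_le_integral _ _
        _ = _ := by ring
  have hBc := continuous_bochnerRieszKernel_one (n := n) hδ hγ.le
  have hEc : Continuous fun y : Rn n => (Real.exp (-ε * ‖y‖ ^ 2) : ℂ) := by fun_prop
  have hUc : Continuous fun y => 𝓕⁻ u y * 𝓕⁻ (highSymbol δ γ) y :=
    (continuous_fourierInv_of_integrable hu).mul
      (continuous_fourierInv_of_integrable (integrable_highSymbol hδ hγ.le))
  have hi1 : Integrable fun z => ρ z * S (y - z) := by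
    refine integrable_mul_comp_sub ρ.integrable ((hEc.mul hBc).sub hUc) (C := C₁ + C₂ * M)
      (fun y => (hSle y).trans ?_) y
    exact mul_le_of_le_one_right (by positivity)
      (Real.rpow_le_one_of_one_le_of_nonpos (by linarith [norm_nonneg y]) (by linarith))
  have hi2 : Integrable fun z => ρ z * (𝓕⁻ u (y - z) * 𝓕⁻ (highSymbol δ γ) (y - z)) := by
    refine integrable_mul_comp_sub ρ.integrable hUc (C := (∫ ξ, ‖u ξ‖) * M) (fun y => ?_) y
    rw [norm_mul]
    gcongr
    · exact norm_fourierInv_le_integral _ _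
    · exact norm_fourierInv_le_integral _ _
  have h3 : convolve ρ (fun y => (Real.exp (-ε * ‖y‖ ^ 2) : ℂ) * bochnerRieszKernel δ γ 1 y) y =
      convolve ρ S y := by
    have h4 := convolve_lowPass_mul_highSymbol_eq_zero hδ hγ.le hu hu0 y
    rw [← add_zero (convolve ρ S y), ← h4, convolve, convolve, convolve, ← integral_add hi1 hi2]
    congr 1
    ext z
    simp only [hS, hρ]
    ring
  rw [h3]
  exact norm_integral_mul_sub_le hd (schwartz_integrable_weight _ _) hSle y

/-- The kernel is band limited, hence smooth of temperate growth, and the Gaussian supplies the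
decay. -/
theorem exists_schwartz_gauss_kernel {δ γ : ℝ} (hδ : 0 < δ) (hγ : 0 ≤ γ) {ε : ℝ} (hε : 0 < ε) :
    ∃ Φ : 𝓢(Rn n, ℂ), (Φ : Rn n → ℂ) =
      fun y => (Real.exp (-ε * ‖y‖ ^ 2) : ℂ) * bochnerRieszKernel δ γ 1 y := by
  obtain ⟨φ, hφ⟩ := exists_schwartz_gaussian (n := n) hε
  have hc : Continuous fun ξ : Rn n => (bochnerRieszMultiplier δ γ 1 ξ : ℂ) :=
    Complex.continuous_ofReal.comp (continuous_bochnerRieszMultiplier_one hδ.le hγ)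
  have hB : (bochnerRieszKernel δ γ 1 : Rn n → ℂ).HasTemperateGrowth := by
    refine hasTemperateGrowth_fourierInv hc.aestronglyMeasurable fun k => ?_
    refine ((continuous_norm.pow k).mul hc.norm).integrable_of_hasCompactSupport
      (hasCompactSupport_of_norm (r := 1) fun ξ h => ?_)
    simp [bochnerRieszMultiplier_one_of_one_le hδ hγ h]
  refine ⟨SchwartzMap.smulLeftCLM ℂ (bochnerRieszKernel δ γ 1) φ, funext fun y => ?_⟩
  rw [SchwartzMap.smulLeftCLM_apply_apply hB, hφ, smul_eq_mul, mul_comm]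

theorem tendsto_exp_neg_mul_sq (y : Rn n) :
    Tendsto (fun ε : ℝ => (Real.exp (-ε * ‖y‖ ^ 2) : ℂ)) (𝓝[>] 0) (𝓝 1) := by
  have h : Continuous fun ε : ℝ => (Real.exp (-ε * ‖y‖ ^ 2) : ℂ) := by fun_prop
  have := (h.tendsto 0).mono_left (nhdsWithin_le_nhds (s := Set.Ioi 0))
  simpa using this

theorem tendsto_convolve_gauss {k b : Rn n → ℂ} (hk : Integrable k) (hb : Continuous b) {C : ℝ}
    (hC : ∀ y, ‖b y‖ ≤ C) (y : Rn n) :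
    Tendsto (fun ε : ℝ => convolve k (fun y => (Real.exp (-ε * ‖y‖ ^ 2) : ℂ) * b y) y) (𝓝[>] 0)
      (𝓝 (convolve k b y)) := by
  refine tendsto_integral_filter_of_dominated_convergence (fun z => ‖k z‖ * C) ?_ ?_
    (hk.norm.mul_const C) (.of_forall fun z => ?_)
  · refine .of_forall fun ε => hk.1.mul ?_
    have : Continuous fun z : Rn n => (Real.exp (-ε * ‖y - z‖ ^ 2) : ℂ) * b (y - z) :=
      (by fun_prop : Continuous fun z : Rn n => (Real.exp (-ε * ‖y - z‖ ^ 2) : ℂ)).mul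
        (hb.comp (continuous_const.sub continuous_id))
    exact this.aestronglyMeasurable
  · filter_upwards [self_mem_nhdsWithin] with ε hε
    refine .of_forall fun z => ?_
    rw [norm_mul, norm_mul]
    gcongr
    calc _ ≤ 1 * C := mul_le_mul (norm_exp_neg_mul_sq_le (le_of_lt hε) _) (hC _) (norm_nonneg _)
          zero_le_one
      _ = C := one_mul C
  · simpa using ((tendsto_exp_neg_mul_sq (y - z)).mul_const (b (y - z))).const_mul (k z)

/-- The Gauss regularizations of the pairing of the Bochner-Riesz kernel with `f` converge. -/
theorem tendsto_integral_mul_gauss (hn : 0 < n) {δ γ lam : ℝ} (hδ : 0 < δ)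
    (hδn : δ < ((n : ℝ) - 1) / 2) (hlam : 0 < lam) (hlamγ : lam ≤ γ) {f g : Rn n → ℂ}
    (h : IsRieszDerivative lam f g)
    (hg : Integrable fun y => (((1 + ‖y‖) ^ (-(δ + (n + 1) / 2)) : ℝ) : ℂ) * g y) :
    Tendsto (fun ε : ℝ => ∫ y, f y * ((Real.exp (-ε * ‖y‖ ^ 2) : ℂ) * bochnerRieszKernel δ γ 1 y))
      (𝓝[>] 0)
      (𝓝 ((∫ y, f y * convolve (lowPass (1 / 4) (by norm_num)) (bochnerRieszKernel δ γ 1) y) +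
        ∫ y, g y * convolve (highRiesz lam (1 / 4)) (bochnerRieszKernel δ γ 1) y)) := by
  have hγ : 0 < γ := hlam.trans_le hlamγ
  have hs : (0 : ℝ) < 1 / 4 := by norm_num
  obtain ⟨C, hC0, hC⟩ := norm_bochnerRieszKernel_one_le (n := n) hn hδ hδn hγ
  -- The order n + lam matches the weight against which f is integrable; it is available because lam
  -- ≤ γ.
  obtain ⟨D, hD0, hD⟩ := exists_norm_convolve_lowPass_gauss_le (n := n) hn (d := n + lam) hδ hγ
    (by positivity) (by linarith)
  have hBc := continuous_bochnerRieszKernel_one (n := n) hδ hγ.le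
  have hB : ∀ y : Rn n, ‖bochnerRieszKernel δ γ 1 y‖ ≤ C := fun y =>
    (hC y).trans (mul_le_of_le_one_right hC0
      (Real.rpow_le_one_of_one_le_of_nonpos (by linarith [norm_nonneg y])
        (neg_nonpos.2 (by positivity))))
  have hW := integrable_highRiesz (n := n) hlam hs
  have h01 : ∀ᶠ ε : ℝ in 𝓝[>] 0, 0 < ε ∧ ε ≤ 1 := by
    filter_upwards [Ioc_mem_nhdsGT (zero_lt_one (α := ℝ))] with ε hε using hε
  have hcont : ∀ {k : Rn n → ℂ}, Integrable k → ∀ ε : ℝ, 0 < ε → Continuous (convolve k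
      fun y => (Real.exp (-ε * ‖y‖ ^ 2) : ℂ) * bochnerRieszKernel δ γ 1 y) := by
    intro k hk ε hε
    obtain ⟨Φ, hΦ⟩ := exists_schwartz_gauss_kernel (n := n) hδ hγ.le hε
    rw [← hΦ]
    exact continuous_convolve_schwartz hk Φ
  have key : ∀ᶠ ε : ℝ in 𝓝[>] 0,
      (∫ y, f y * convolve (lowPass (1 / 4) hs)
        (fun y => (Real.exp (-ε * ‖y‖ ^ 2) : ℂ) * bochnerRieszKernel δ γ 1 y) y) +
      (∫ y, g y * convolve (highRiesz lam (1 / 4))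
        (fun y => (Real.exp (-ε * ‖y‖ ^ 2) : ℂ) * bochnerRieszKernel δ γ 1 y) y) =
      ∫ y, f y * ((Real.exp (-ε * ‖y‖ ^ 2) : ℂ) * bochnerRieszKernel δ γ 1 y) := by
    filter_upwards [h01] with ε hε
    obtain ⟨Φ, hΦ⟩ := exists_schwartz_gauss_kernel (n := n) hδ hγ.le hε.1
    have := h.integral_mul_schwartz hlam hs Φ
    rw [hΦ] at this
    exact this.symm
  refine Tendsto.congr' key (Tendsto.add ?_ ?_)
  · refine tendsto_integral_filter_of_dominated_convergence
      (fun y => D * ‖(((1 + ‖y‖) ^ (-(n + lam)) : ℝ) : ℂ) * f y‖) ?_ ?_ (h.1.norm.const_mul D)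
      (.of_forall fun y => ?_)
    · filter_upwards [h01] with ε hε
      exact (aestronglyMeasurable_of_weight h.1).mul
        (hcont (lowPass (1 / 4) hs).integrable ε hε.1).aestronglyMeasurable
    · filter_upwards [h01] with ε hε
      exact .of_forall fun y => norm_mul_le_weight (hD ε hε.1 hε.2 y)
    · exact (tendsto_convolve_gauss (lowPass (1 / 4) hs).integrable hBc hB y).const_mul _
  · refine tendsto_integral_filter_of_dominated_convergence
      (fun y => (C * ∫ z : Rn n, ‖highRiesz lam (1 / 4) z‖ * (1 + ‖z‖) ^ (δ + ((n : ℝ) + 1) / 2)) *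
        ‖(((1 + ‖y‖) ^ (-(δ + ((n : ℝ) + 1) / 2)) : ℝ) : ℂ) * g y‖) ?_ ?_ (hg.norm.const_mul _)
      (.of_forall fun y => ?_)
    · filter_upwards [h01] with ε hε
      exact (aestronglyMeasurable_of_weight hg).mul (hcont hW ε hε.1).aestronglyMeasurable
    · filter_upwards [h01] with ε hε
      refine .of_forall fun y => norm_mul_le_weight ?_
      refine norm_convolve_le (a := δ + ((n : ℝ) + 1) / 2) (by positivity)
        (integrable_highRiesz_weight hlam hs _)
        (fun y => ?_) y
      rw [norm_mul]
      calc _ ≤ 1 * (C * (1 + ‖y‖) ^ (-(δ + ((n : ℝ) + 1) / 2))) := by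
            gcongr
            · exact norm_exp_neg_mul_sq_le hε.1.le y
            · exact hC y
        _ = _ := one_mul _
    · exact (tendsto_convolve_gauss hW hBc hB y).const_mul _

end GaussLimit

/-! ### Reduction to R = 1 and to the origin by affine changes of variable. -/

section AffineChange

variable {n : ℕ}

theorem integral_comp_sub_inv_smul (F : Rn n → ℂ) (x : Rn n) {R : ℝ} (hR : 0 < R) :
    ∫ y, F (x - R⁻¹ • y) = ((R ^ n : ℝ) : ℂ) * ∫ u, F u := by
  have h := Measure.integral_comp_inv_smul_of_nonneg (volume : Measure (Rn n))
    (fun z => F (x - z)) hR.le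
  rw [finrank_euclideanSpace_fin, integral_sub_left_eq_self, Complex.real_smul] at h
  exact h

theorem rieszPotential_comp_smul (lam : ℝ) (φ : Rn n → ℂ) {R : ℝ} (hR : 0 < R) (y : Rn n) :
    rieszPotential (-lam) (fun y => φ (R • y)) y =
      ((R ^ lam : ℝ) : ℂ) * rieszPotential (-lam) φ (R • y) := by
  have h : (fun ξ : Rn n => ((‖ξ‖ ^ (-(-lam)) : ℝ) : ℂ) * 𝓕 (fun y => φ (R • y)) ξ) =
      fun ξ => ((R ^ lam * (R ^ n)⁻¹ : ℝ) : ℂ) *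
        (fun ζ : Rn n => ((‖ζ‖ ^ (-(-lam)) : ℝ) : ℂ) * 𝓕 φ ζ) (R⁻¹ • ξ) := by
    ext ξ
    simp only
    rw [fourier_comp_smul φ hR, norm_smul, norm_inv, Real.norm_of_nonneg hR.le,
      Real.mul_rpow (by positivity) (norm_nonneg _), Real.inv_rpow hR.le, neg_neg]
    push_cast
    have h1 : ((R ^ lam : ℝ) : ℂ) ≠ 0 := by
      exact_mod_cast (Real.rpow_pos_of_pos hR lam).ne'
    field_simp
  rw [rieszPotential, h, fourierInv_const_mul_apply, fourierInv_comp_inv_smul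
    (fun ζ : Rn n => ((‖ζ‖ ^ (-(-lam)) : ℝ) : ℂ) * 𝓕 φ ζ) hR, ← mul_assoc,
    ← Complex.ofReal_mul, mul_assoc, inv_mul_cancel₀ (by positivity), mul_one]
  rfl

theorem rieszPotential_comp_const_sub (lam : ℝ) (φ : Rn n → ℂ) (x y : Rn n) :
    rieszPotential (-lam) (fun y => φ (x - y)) y = rieszPotential (-lam) φ (x - y) := by
  have h : ∀ ξ : Rn n, 𝓕 (fun y => φ (x - y)) ξ =
      (Real.fourierChar (-inner ℝ x ξ) : ℂ) * 𝓕 φ (-ξ) := by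
    intro ξ
    rw [Real.fourier_eq, ← integral_sub_left_eq_self _ volume x, Real.fourier_eq,
      ← integral_const_mul]
    congr 1
    ext y
    rw [sub_sub_cancel, Circle.smul_def, Circle.smul_def, smul_eq_mul, smul_eq_mul, ← mul_assoc,
      ← Circle.coe_mul, ← AddChar.map_add_eq_mul, inner_sub_left, inner_neg_right]
    congr 4
    ring
  rw [rieszPotential, rieszPotential, Real.fourierInv_eq, ← integral_neg_eq_self,
    Real.fourierInv_eq]
  congr 1
  ext ξ
  rw [h, norm_neg, neg_neg, Circle.smul_def, Circle.smul_def, smul_eq_mul, smul_eq_mul,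
    inner_sub_right, sub_eq_add_neg, AddChar.map_add_eq_mul, Circle.coe_mul, inner_neg_left,
    inner_neg_right, neg_neg, real_inner_comm x ξ, AddChar.map_neg_eq_inv]
  rw [neg_neg ξ]
  ring

theorem exists_schwartz_comp_smul_const_sub (φ : 𝓢(Rn n, ℂ)) (x : Rn n) {R : ℝ} (hR : 0 < R) :
    ∃ ψ : 𝓢(Rn n, ℂ), (ψ : Rn n → ℂ) = fun u => φ (R • (x - u)) := by
  have hg : (fun u : Rn n => R • (x - u)).HasTemperateGrowth := by fun_prop
  have ha : AntilipschitzWith (Real.toNNReal R⁻¹) fun u : Rn n => R • (x - u) := by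
    refine AntilipschitzWith.of_le_mul_dist fun u v => ?_
    rw [dist_smul₀, dist_sub_left, Real.coe_toNNReal _ (by positivity), Real.norm_of_nonneg hR.le,
      inv_mul_cancel_left₀ hR.ne']
  exact ⟨SchwartzMap.compCLMOfAntilipschitz ℂ hg ha φ, rfl⟩

/-- Riesz derivatives under a reflection, a translation and a dilation of the variable. -/
theorem IsRieszDerivative.comp_sub_inv_smul {lam : ℝ} (hlam : 0 ≤ lam) {f g : Rn n → ℂ}
    (h : IsRieszDerivative lam f g) (x : Rn n) {R : ℝ} (hR : 0 < R) :
    IsRieszDerivative lam (fun y => f (x - R⁻¹ • y))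
      (fun y => ((R ^ (-lam) : ℝ) : ℂ) * g (x - R⁻¹ • y)) := by
  refine ⟨integrable_weight_comp_sub_smul (by positivity) h.1 x (inv_pos.2 hR), fun φ => ?_⟩
  obtain ⟨ψ, hψ⟩ := exists_schwartz_comp_smul_const_sub φ x hR
  have h1 := h.2 ψ
  have h2 : ∀ u, rieszPotential (-lam) ψ u =
      ((R ^ lam : ℝ) : ℂ) * rieszPotential (-lam) φ (R • (x - u)) := fun u => by
    rw [hψ, rieszPotential_comp_const_sub lam (fun v => φ (R • v)) x u,
      rieszPotential_comp_smul _ _ hR]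
  have hxy : ∀ y : Rn n, R • (x - (x - R⁻¹ • y)) = y := fun y => by
    rw [sub_sub_cancel, smul_inv_smul₀ hR.ne']
  have h3 := integral_comp_sub_inv_smul (fun u => f u * rieszPotential (-lam) φ (R • (x - u))) x hR
  have h4 := integral_comp_sub_inv_smul (fun u => g u * φ (R • (x - u))) x hR
  simp only [hxy] at h3 h4
  simp only [mul_assoc]
  rw [integral_const_mul, h3, h4]
  simp only [h2] at h1
  simp only [hψ] at h1
  rw [← h1]
  simp only [mul_left_comm (f _)]
  rw [integral_const_mul, Real.rpow_neg hR.le]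
  have h5 : ((R ^ lam : ℝ) : ℂ) ≠ 0 := by exact_mod_cast (Real.rpow_pos_of_pos hR lam).ne'
  push_cast
  field_simp

theorem bochnerRieszKernel_smul (δ γ : ℝ) {R : ℝ} (hR : 0 < R) (y : Rn n) :
    bochnerRieszKernel δ γ R y = ((R ^ n : ℝ) : ℂ) * bochnerRieszKernel δ γ 1 (R • y) := by
  rw [bochnerRieszKernel, bochnerRieszKernel,
    ← fourierInv_comp_inv_smul (fun ξ : Rn n => (bochnerRieszMultiplier δ γ 1 ξ : ℂ)) hR]
  refine congrArg (fun u : Rn n → ℂ => 𝓕⁻ u y) (funext fun ξ => ?_)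
  rw [bochnerRieszMultiplier, bochnerRieszMultiplier, norm_smul, norm_inv,
    Real.norm_of_nonneg hR.le, Real.mul_rpow (by positivity) (norm_nonneg _), Real.inv_rpow hR.le,
    Real.one_rpow, div_one, inv_mul_eq_div]

/-- The dilation only replaces ε by ε / R², which is harmless in the limit; kernel estimates are
thus needed at R = 1 alone. -/
theorem bochnerRieszGauss_eq (δ γ : ℝ) {R : ℝ} (hR : 0 < R) (f : Rn n → ℂ) (x : Rn n) (ε : ℝ) :
    bochnerRieszGauss δ γ R f x ε = ∫ y, f (x - R⁻¹ • y) *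
      ((Real.exp (-(ε / R ^ 2) * ‖y‖ ^ 2) : ℂ) * bochnerRieszKernel δ γ 1 y) := by
  have h := integral_comp_sub_inv_smul (fun z => (Real.exp (-ε * ‖z‖ ^ 2) : ℂ) *
    bochnerRieszKernel δ γ 1 (R • z) * f (x - z)) 0 hR
  rw [bochnerRieszGauss]
  simp only [bochnerRieszKernel_smul δ γ hR]
  rw [show (∫ y : Rn n, (Real.exp (-ε * ‖y‖ ^ 2) : ℂ) *
      (((R ^ n : ℝ) : ℂ) * bochnerRieszKernel δ γ 1 (R • y)) * f (x - y)) =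
      ((R ^ n : ℝ) : ℂ) * ∫ z : Rn n, (Real.exp (-ε * ‖z‖ ^ 2) : ℂ) *
        bochnerRieszKernel δ γ 1 (R • z) * f (x - z) by
    rw [← integral_const_mul]; congr 1; ext z; ring, ← h, ← integral_neg_eq_self]
  congr 1
  ext y
  rw [zero_sub, smul_neg, neg_neg, smul_inv_smul₀ hR.ne', norm_smul, norm_inv,
    Real.norm_of_nonneg hR.le]
  have : -ε * (R⁻¹ * ‖y‖) ^ 2 = -(ε / R ^ 2) * ‖y‖ ^ 2 := by field_simp
  rw [this]
  ring

end AffineChange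

/-! ### Recovering a value of f at a variable cutoff scale. -/

section SmoothMean

variable {n : ℕ}

theorem integrable_weight_mono {a b : ℝ} (hab : a ≤ b) {f : Rn n → ℂ}
    (hf : Integrable fun y => (((1 + ‖y‖) ^ (-a) : ℝ) : ℂ) * f y) :
    Integrable fun y => (((1 + ‖y‖) ^ (-b) : ℝ) : ℂ) * f y := by
  refine hf.mono ((Complex.continuous_ofReal.comp
    (continuous_one_add_norm_rpow (-b))).aestronglyMeasurable.mul (aestronglyMeasurable_of_weight hf))
    (.of_forall fun y => ?_)
  rw [norm_mul, norm_mul, Complex.norm_real, Complex.norm_real,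
    Real.norm_of_nonneg (by positivity), Real.norm_of_nonneg (by positivity)]
  gcongr
  linarith [norm_nonneg y]

theorem one_add_norm_rpow_neg_le {a : ℝ} (ha : 0 ≤ a) {y : Rn n} (hy : y ≠ 0) :
    (1 + ‖y‖) ^ (-a) ≤ ‖y‖ ^ (-a) :=
  Real.rpow_le_rpow_of_nonpos (norm_pos_iff.2 hy) (by linarith) (by linarith)

theorem ae_ne_zero (hn : 0 < n) : ∀ᵐ y : Rn n, y ≠ 0 := by
  have : Nonempty (Fin n) := ⟨⟨0, hn⟩⟩
  exact compl_mem_ae_iff.2 (measure_singleton (0 : Rn n))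

theorem norm_mul_le_riesz_weight {a C : ℝ} {g b : Rn n → ℂ} {y : Rn n}
    (h : ‖b y‖ ≤ C * ‖y‖ ^ (-a)) :
    ‖g y * b y‖ ≤ C * ‖((‖y‖ ^ (-a) : ℝ) : ℂ) * g y‖ := by
  rw [norm_mul, norm_mul, Complex.norm_real, Real.norm_of_nonneg (by positivity)]
  calc ‖g y‖ * ‖b y‖ ≤ ‖g y‖ * (C * ‖y‖ ^ (-a)) := by gcongr
    _ = _ := by ring

theorem integrable_mul_of_riesz_weight (hn : 0 < n) {a C : ℝ} {g b : Rn n → ℂ}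
    (hgm : AEStronglyMeasurable g)
    (hg : Integrable fun y => ((‖y‖ ^ (-a) : ℝ) : ℂ) * g y) (hb : AEStronglyMeasurable b)
    (h : ∀ y, y ≠ 0 → ‖b y‖ ≤ C * ‖y‖ ^ (-a)) : Integrable fun y => g y * b y := by
  refine (hg.norm.const_mul C).mono' (hgm.mul hb) ?_
  filter_upwards [ae_ne_zero hn] with y hy
  exact norm_mul_le_riesz_weight (h y hy)

theorem integrable_mul_highRiesz (hn : 0 < n) {lam a s : ℝ} (hlam : 0 < lam) (hs : 0 < s)
    (ha : 0 ≤ a) (hna : n - lam < a) {g : Rn n → ℂ} (hgm : AEStronglyMeasurable g)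
    (hg : Integrable fun y => ((‖y‖ ^ (-a) : ℝ) : ℂ) * g y) :
    Integrable fun y => g y * highRiesz lam s y := by
  obtain ⟨C, -, hC⟩ := norm_highRiesz_le (n := n) hs ha hna
  exact integrable_mul_of_riesz_weight hn hgm hg (integrable_highRiesz hlam hs).1 hC

/-- The value at the origin of `f`, recovered from the low frequencies of `f` and the high
frequencies of its Riesz derivative `g`. -/
def smoothMean (lam s : ℝ) (hs : 0 < s) (f g : Rn n → ℂ) : ℂ :=
  (∫ y, f y * lowPass s hs y) + ∫ y, g y * highRiesz lam s y

theorem contDiff_rpow_mul_cutoff_sub (a : ℝ) {s t : ℝ} (hs : 0 < s) (hst : s ≤ t) {k : ℕ∞} :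
    ContDiff ℝ k fun ξ : Rn n => (cutoff t ξ - cutoff s ξ) * ‖ξ‖ ^ a :=
  contDiff_mul_norm_rpow ((contDiff_cutoff t).sub (contDiff_cutoff s)) hs
    (fun ξ h => by
      rw [cutoff_of_norm_le hs h.le, cutoff_of_norm_le (hs.trans_le hst) (h.le.trans hst),
        sub_self]) a

/-- The symbol (cutoff t - cutoff s)|ξ|^(-lam) vanishes near 0, hence is Schwartz. Testing the
definition of g on its inverse transform compares the two scales; integrability of g against both
high frequency kernels is what lets the difference be separated. -/
theorem IsRieszDerivative.smoothMean_eq {lam : ℝ} (hn : 0 < n) (hlam : 0 < lam) {f g : Rn n → ℂ}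
    (h : IsRieszDerivative lam f g) {s t : ℝ} (hs : 0 < s) (ht : 0 < t) (hst : s ≤ t)
    (hgs : Integrable fun y => g y * highRiesz lam s y)
    (hgt : Integrable fun y => g y * highRiesz lam t y) :
    smoothMean lam s hs f g = smoothMean lam t ht f g := by
  let ψ : 𝓢(Rn n, ℂ) := HasCompactSupport.toSchwartzMap
    (f := fun ξ : Rn n => (((cutoff t ξ - cutoff s ξ) * ‖ξ‖ ^ (-lam) : ℝ) : ℂ))
    (hasCompactSupport_of_norm (r := 3 / 2 * t) fun ξ hξ => by
      rw [cutoff_of_le_norm ht hξ, cutoff_of_le_norm hs (le_trans (by linarith) hξ)]; simp)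
    (Complex.ofRealCLM.contDiff.comp (contDiff_rpow_mul_cutoff_sub (k := ⊤) _ hs hst))
  have hψ : ∀ ξ, ψ ξ = (((cutoff t ξ - cutoff s ξ) * ‖ξ‖ ^ (-lam) : ℝ) : ℂ) := fun ξ => rfl
  have h1 := h.2 (𝓕⁻ ψ)
  have hpot : ∀ y, rieszPotential (-lam) (𝓕⁻ ψ : 𝓢(Rn n, ℂ)) y =
      lowPass t ht y - lowPass s hs y := by
    intro y
    rw [lowPass_eq, lowPass_eq, ← fourierInv_sub_apply (integrable_cutoff ht) (integrable_cutoff hs),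
      rieszPotential]
    refine congrArg (fun u : Rn n → ℂ => 𝓕⁻ u y) (funext fun ξ => ?_)
    rw [SchwartzMap.fourierInv_coe, fourier_fourierInv_schwartz, hψ, neg_neg, ← Complex.ofReal_mul,
      ← Complex.ofReal_sub]
    congr 1
    have e1 := rpow_norm_mul_highRiesz_symbol (lam := lam) hs ξ
    have e2 := rpow_norm_mul_highRiesz_symbol (lam := lam) ht ξ
    linear_combination e1 - e2
  have hW : ∀ y, y ≠ 0 → (𝓕⁻ ψ : 𝓢(Rn n, ℂ)) y = highRiesz lam s y - highRiesz lam t y := by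
    intro y hy
    rw [highRiesz_sub hlam hs hst hy, SchwartzMap.fourierInv_coe]
    refine congrArg (fun u : Rn n → ℂ => 𝓕⁻ u y) (funext fun ξ => ?_)
    rw [hψ, mul_comm]
  have h2 : ∫ y, g y * (𝓕⁻ ψ : 𝓢(Rn n, ℂ)) y =
      ∫ y, (g y * highRiesz lam s y - g y * highRiesz lam t y) := by
    refine integral_congr_ae ?_
    filter_upwards [ae_ne_zero hn] with y hy
    rw [hW y hy, mul_sub]
  have hf : ∀ (r : ℝ) (hr : 0 < r), Integrable fun y => f y * lowPass r hr y := fun r hr => by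
    obtain ⟨C, -, hC⟩ := schwartz_decay (lowPass (n := n) r hr) (n + lam)
    exact integrable_mul_of_weight h.1 (lowPass r hr).continuous.aestronglyMeasurable hC
  simp only [hpot, mul_sub] at h1
  rw [h2, integral_sub (hf t ht) (hf s hs), integral_sub hgs hgt] at h1
  rw [smoothMean, smoothMean]
  linear_combination -h1

theorem smoothMean_comp_sub_inv_smul (lam : ℝ) {s : ℝ} (hs : 0 < s) (f g : Rn n → ℂ) (x : Rn n)
    {R : ℝ} (hR : 0 < R) :
    smoothMean lam s hs (fun y => f (x - R⁻¹ • y))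
        (fun y => ((R ^ (-lam) : ℝ) : ℂ) * g (x - R⁻¹ • y)) =
      smoothMean lam (s * R) (mul_pos hs hR) (fun y => f (x - y)) (fun y => g (x - y)) := by
  have hxy : ∀ y : Rn n, R • (x - (x - R⁻¹ • y)) = y := fun y => by
    rw [sub_sub_cancel, smul_inv_smul₀ hR.ne']
  have h3 := integral_comp_sub_inv_smul (fun u => f u * lowPass s hs (R • (x - u))) x hR
  have h4 := integral_comp_sub_inv_smul (fun u => g u * highRiesz lam s (R • (x - u))) x hR
  simp only [hxy] at h3 h4
  rw [smoothMean, smoothMean, h3]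
  simp only [mul_assoc]
  rw [integral_const_mul, h4, ← integral_const_mul, ← mul_assoc, ← integral_const_mul,
    ← integral_sub_left_eq_self _ volume x, ← integral_sub_left_eq_self (fun u =>
      ((R ^ (-lam) : ℝ) : ℂ) * ((R ^ n : ℝ) : ℂ) * (g u * highRiesz lam s (R • (x - u)))) volume x]
  congr 2
  · ext y
    rw [lowPass_smul hs hR, sub_sub_cancel]
    ring
  · ext y
    rw [sub_sub_cancel, highRiesz_smul lam s hR hs, ← Complex.ofReal_mul]
    have : R ^ (-lam) * R ^ n * R ^ (lam - n) = 1 := by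
      rw [← Real.rpow_natCast, ← Real.rpow_add hR, ← Real.rpow_add hR]
      simp
    calc _ = ((R ^ (-lam) * R ^ n * R ^ (lam - n) : ℝ) : ℂ) *
          (g (x - y) * highRiesz lam (s * R) y) := by push_cast; ring
      _ = _ := by rw [this]; simp

end SmoothMean

/-! ### Almost everywhere reconstruction of f. -/

section Reconstruction

open scoped ContDiff

variable {n : ℕ}

/-- Convolution with an even kernel is symmetric under the pairing. The weighted bounds provide the
absolute convergence for Fubini. -/
theorem integral_mul_convolve_even {k b F : Rn n → ℂ} {a C : ℝ} (ha : 0 ≤ a)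
    (hkm : AEStronglyMeasurable k) (hk : Integrable fun z => ‖k z‖ * (1 + ‖z‖) ^ a)
    (hke : ∀ z, k (-z) = k z) (hb : Continuous b) (hbC : ∀ y, ‖b y‖ ≤ C * (1 + ‖y‖) ^ (-a))
    (hF : Integrable fun y => (((1 + ‖y‖) ^ (-a) : ℝ) : ℂ) * F y) :
    (Integrable fun x => b x * ∫ y, F (x - y) * k y) ∧
      ∫ x, b x * (∫ y, F (x - y) * k y) = ∫ u, F u * convolve k b u := by
  have hFm := aestronglyMeasurable_of_weight hF
  have hki := integrable_of_integrable_weight ha hkm hk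
  have hbb : ∀ y, ‖b y‖ ≤ |C| := fun y => (hbC y).trans ((le_abs_self _).trans (by
    rw [abs_mul, abs_of_nonneg (Real.rpow_nonneg (by positivity : (0 : ℝ) ≤ 1 + ‖y‖) _)]
    exact mul_le_of_le_one_right (abs_nonneg _)
      (Real.rpow_le_one_of_one_le_of_nonpos (by linarith [norm_nonneg y]) (by linarith))))
  have hm : AEStronglyMeasurable (Function.uncurry fun u x : Rn n => F u * (b x * k (x - u)))
      (volume.prod volume) := by
    refine hFm.comp_fst.mul ((hb.comp continuous_snd).aestronglyMeasurable.mul ?_)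
    have h1 : AEStronglyMeasurable (fun p : Rn n × Rn n => k (p.1 - p.2)) (volume.prod volume) :=
      hkm.comp_quasiMeasurePreserving (quasiMeasurePreserving_sub_of_right_invariant volume volume)
    exact h1.prod_swap
  have hsub : ∀ (G : Rn n → ℝ) u, ∫ x, G (u - x) = ∫ x, G x := fun G u =>
    integral_sub_left_eq_self _ volume u
  have hI : Integrable (Function.uncurry fun u x : Rn n => F u * (b x * k (x - u)))
      (volume.prod volume) := by
    refine (integrable_prod_iff hm).2 ⟨.of_forall fun u => ?_, ?_⟩
    · exact ((hki.comp_sub_right u).bdd_mul (c := |C|) hb.aestronglyMeasurable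
        (.of_forall hbb)).const_mul (F u)
    · refine (hF.norm.const_mul (C * ∫ z, ‖k z‖ * (1 + ‖z‖) ^ a)).mono'
        hm.norm.integral_prod_right' (.of_forall fun u => ?_)
      rw [Real.norm_of_nonneg (integral_nonneg fun _ => norm_nonneg _)]
      simp only [Function.uncurry, norm_mul]
      rw [integral_const_mul, ← hsub _ u, Complex.norm_real, Real.norm_of_nonneg (by positivity)]
      have h2 := integral_norm_mul_norm_sub_le ha hk hbC u
      have h3 : ∀ z, ‖b (u - z)‖ * ‖k (u - z - u)‖ = ‖k z‖ * ‖b (u - z)‖ := fun z => by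
        rw [show u - z - u = -z by abel, hke, mul_comm]
      simp only [h3]
      calc _ ≤ ‖F u‖ * _ := mul_le_mul_of_nonneg_left h2 (norm_nonneg _)
        _ = _ := by ring
  have e1 : ∀ x, b x * (∫ y, F (x - y) * k y) = ∫ u, F u * (b x * k (x - u)) := fun x => by
    rw [← integral_const_mul, ← integral_sub_left_eq_self _ volume x]
    congr 1; ext u
    rw [sub_sub_cancel]; ring
  have e2 : ∀ u, F u * convolve k b u = ∫ x, F u * (b x * k (x - u)) := fun u => by
    rw [integral_const_mul, convolve, ← integral_sub_left_eq_self (fun x => b x * k (x - u)) volume u]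
    congr 2; ext z
    rw [show u - z - u = -z by abel, hke, mul_comm]
  simp only [e1, e2]
  exact ⟨hI.integral_prod_right, (integral_integral_swap hI).symm⟩

theorem locallyIntegrable_of_weight {a : ℝ} {f : Rn n → ℂ}
    (hf : Integrable fun y => (((1 + ‖y‖) ^ (-a) : ℝ) : ℂ) * f y) : LocallyIntegrable f := by
  have hc : Continuous fun y : Rn n => (((1 + ‖y‖) ^ a : ℝ) : ℂ) :=
    Complex.continuous_ofReal.comp (continuous_one_add_norm_rpow _)
  have h := (hf.locallyIntegrable.locallyIntegrableOn Set.univ).continuousOn_mul hc.continuousOn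
    isOpen_univ.isLocallyClosed
  refine locallyIntegrableOn_univ.1 (h.congr ?_)
  refine .of_forall fun y => ?_
  simp only
  rw [← mul_assoc, ← Complex.ofReal_mul, ← Real.rpow_add (by positivity)]
  simp

/-- At almost every point, a function is recovered from its low frequencies and the high
frequencies of its Riesz derivative. -/
theorem IsRieszDerivative.ae_smoothMean_eq {lam : ℝ} (hlam : 0 < lam) {f g : Rn n → ℂ}
    (h : IsRieszDerivative lam f g) {a : ℝ} (ha : 0 ≤ a)
    (hg : Integrable fun y => (((1 + ‖y‖) ^ (-a) : ℝ) : ℂ) * g y) {s : ℝ} (hs : 0 < s) :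
    ∀ᵐ x, smoothMean lam s hs (fun y => f (x - y)) (fun y => g (x - y)) = f x := by
  have hW := integrable_highRiesz (n := n) hlam hs
  have hwt : ∀ e : ℝ, Continuous fun y : Rn n => (((1 + ‖y‖) ^ e : ℝ) : ℂ) := fun e =>
    Complex.continuous_ofReal.comp (continuous_one_add_norm_rpow e)
  have hwn : ∀ (e : ℝ) (y : Rn n), ‖(((1 + ‖y‖) ^ e : ℝ) : ℂ)‖ ≤ 1 * (1 + ‖y‖) ^ e := fun e y => by
    rw [Complex.norm_real, Real.norm_of_nonneg (by positivity), one_mul]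
  have f1 : ∀ {b : Rn n → ℂ} {C : ℝ}, Continuous b → _ → _ := fun {b C} hb hbC =>
    integral_mul_convolve_even (b := b) (C := C) (by positivity : (0 : ℝ) ≤ n + lam)
      (lowPass s hs).continuous.aestronglyMeasurable (schwartz_integrable_weight _ _)
      (lowPass_neg hs) hb hbC h.1
  have f2 : ∀ {b : Rn n → ℂ} {C : ℝ}, Continuous b → _ → _ := fun {b C} hb hbC =>
    integral_mul_convolve_even (b := b) (C := C) ha hW.1 (integrable_highRiesz_weight hlam hs a)
      (highRiesz_neg lam s) hb hbC hg
  refine ae_eq_of_integral_contDiff_smul_eq ?_ (locallyIntegrable_of_weight h.1) fun θ hθ hθc => ?_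
  -- Taking the weight itself for b shows that each of the two convolutions is integrable against a
  -- positive continuous weight, hence locally integrable.
  · exact (locallyIntegrable_of_weight (f1 (hwt _) (hwn _)).1).add
      (locallyIntegrable_of_weight (f2 (hwt _) (hwn _)).1)
  · let Φ : 𝓢(Rn n, ℂ) := HasCompactSupport.toSchwartzMap (f := fun x : Rn n => (θ x : ℂ))
      (hθc.comp_left (g := fun t : ℝ => (t : ℂ)) Complex.ofReal_zero)
      (Complex.ofRealCLM.contDiff.comp hθ)
    obtain ⟨C, -, hC⟩ := schwartz_decay Φ (n + lam)
    obtain ⟨D, -, hD⟩ := schwartz_decay Φ a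
    have g1 := f1 Φ.continuous hC
    have g2 := f2 Φ.continuous hD
    have hΦ : ∀ x, Φ x = (θ x : ℂ) := fun x => rfl
    simp only [smoothMean, Complex.real_smul, ← hΦ, mul_add]
    -- Against a test function the reconstruction formula is the frequency splitting of Φ.
    rw [integral_add g1.1 g2.1, g1.2, g2.2, ← h.integral_mul_schwartz hlam hs Φ]
    congr 1; ext x; ring

end Reconstruction

/-! ### The error kernel: formula, decay and boundedness of its pairings. -/

section ErrorKernel

variable {n : ℕ}

/-- The limit of the Gauss regularizations of the pairing of the Bochner-Riesz kernel with `f`,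
where `g` is the Riesz derivative of `f`. -/
def gaussLimit (δ γ lam : ℝ) (f g : Rn n → ℂ) : ℂ :=
  (∫ y, f y * convolve (lowPass (1 / 4) (by norm_num)) (bochnerRieszKernel δ γ 1) y) +
    ∫ y, g y * convolve (highRiesz lam (1 / 4)) (bochnerRieszKernel δ γ 1) y

/-- The kernel which applied to the Riesz derivative of `f` gives the error of the Bochner-Riesz
mean of `f`. -/
def errorKernel (δ γ lam : ℝ) (y : Rn n) : ℂ :=
  lowKernel δ γ lam (1 / 4) y + convolve (highRiesz lam (1 / 4)) (bochnerRieszKernel δ γ 1) y -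
    highRiesz lam (1 / 4) y

theorem convolve_lowPass_kernel_sub (hn : 0 < n) {δ γ : ℝ} (hδ : 0 < δ) (hγ : 0 < γ) (y : Rn n) :
    convolve (lowPass (1 / 4) (by norm_num)) (bochnerRieszKernel δ γ 1) y =
      lowPass (1 / 4) (by norm_num) y + lowKernel δ γ 0 (1 / 4) y := by
  have h4 : (0 : ℝ) < 1 / 4 := by norm_num
  have h1 := integrable_lowSymbol (n := n) (c := 0) hn hδ.le hγ hγ.le h4 (by norm_num)
  have h2 := fourierInv_add_apply (integrable_cutoff h4) h1 y
  rw [bochnerRieszKernel, convolve_fourierInv (lowPass (1 / 4) h4).integrable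
    (integrable_bochnerRieszMultiplier_one hδ hγ.le), lowPass_eq,
    lowKernel_eq hn hδ.le hγ hγ.le h4 (by norm_num), ← h2, ← lowPass_eq h4]
  refine congrArg (fun u : Rn n → ℂ => 𝓕⁻ u y) (funext fun ξ => ?_)
  rw [fourier_lowPass, neg_zero, Real.rpow_zero]
  push_cast
  ring

theorem rpow_norm_mul_lowPiece {δ γ lam σ : ℝ} (hσ : 0 < σ) (ξ : Rn n) :
    ((‖ξ‖ ^ lam : ℝ) : ℂ) * lowPiece δ γ lam σ ξ = lowPiece δ γ 0 σ ξ := by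
  rw [lowPiece, lowPiece, ← Complex.ofReal_mul]
  congr 1
  rcases eq_or_ne ξ 0 with rfl | hξ
  · rw [annulus_inv_smul_of_lt hσ (by simpa using hσ)]; ring
  · have h : ‖ξ‖ ^ lam * ‖ξ‖ ^ (-lam) = 1 := by
      rw [← Real.rpow_add (norm_pos_iff.2 hξ)]; simp
    rw [neg_zero, Real.rpow_zero]
    linear_combination (annulus (σ⁻¹ • ξ) / σ * (bochnerRieszMultiplier δ γ 1 ξ - 1)) * h

/-- `lowKernel` itself need not be an admissible test function, but each frequency piece is: its
symbol with c = lam, multiplied by |ξ|^lam, is the symbol with c = 0. -/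
theorem IsRieszDerivative.integral_mul_lowKernel_eq (hn : 0 < n) {δ γ lam : ℝ} (hδ : 0 ≤ δ)
    (hlam : 0 < lam) (hlamγ : lam ≤ γ) {f g : Rn n → ℂ} (h : IsRieszDerivative lam f g)
    (hg : Integrable fun y => (((1 + ‖y‖) ^ (-(n : ℝ)) : ℝ) : ℂ) * g y) {s : ℝ} (hs : 0 ≤ s)
    (hs2 : s ≤ 1 / 2) :
    ∫ y, f y * lowKernel δ γ 0 s y = ∫ y, g y * lowKernel δ γ lam s y := by
  have hγ : 0 < γ := hlam.trans_le hlamγ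
  rw [integral_mul_lowKernel hn hδ hγ hγ.le hs hs2 (integrable_weight_mono (by linarith) h.1),
    integral_mul_lowKernel hn hδ hγ hlamγ hs hs2 (integrable_weight_mono (by linarith) hg)]
  refine setIntegral_congr_fun measurableSet_Ioc fun σ hσ => ?_
  obtain ⟨φ, hφ⟩ := exists_schwartz_lowPiece (n := n) δ hγ lam hσ.1 (hσ.2.trans hs2)
  have h1 := h.2 (𝓕⁻ φ)
  have h2 : rieszPotential (-lam) (𝓕⁻ φ : 𝓢(Rn n, ℂ)) = 𝓕⁻ (lowPiece δ γ 0 σ : Rn n → ℂ) := by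
    rw [rieszPotential]
    refine congrArg (fun u : Rn n → ℂ => 𝓕⁻ u) (funext fun ξ => ?_)
    rw [SchwartzMap.fourierInv_coe, fourier_fourierInv_schwartz, hφ, neg_neg,
      rpow_norm_mul_lowPiece hσ.1]
  rw [h2, SchwartzMap.fourierInv_coe, hφ] at h1
  exact h1

/-- Each term decays at least with order a = δ + (n+1)/2: the low frequencies with order n + γ - lam
≥ n > a, the convolution with the order a of the Bochner-Riesz kernel, and `highRiesz` because n -
lam < a, which is the lower bound on lam. -/
theorem norm_errorKernel_le (hn : 0 < n) {δ γ lam : ℝ} (hδ : 0 < δ)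
    (hδn : δ < ((n : ℝ) - 1) / 2) (hlam : ((n : ℝ) - 1) / 2 - δ < lam) (hlamγ : lam ≤ γ) :
    ∃ C, 0 ≤ C ∧ ∀ y : Rn n, y ≠ 0 →
      ‖errorKernel δ γ lam y‖ ≤ C * ‖y‖ ^ (-(δ + ((n : ℝ) + 1) / 2)) := by
  have hlam0 : 0 < lam := by linarith
  have hγ : 0 < γ := by linarith
  have h4 : (0 : ℝ) < 1 / 4 := by norm_num
  have ha : 0 ≤ δ + ((n : ℝ) + 1) / 2 := by positivity
  obtain ⟨C₁, hC₁0, hC₁⟩ := norm_lowKernel_le (n := n) hn hδ.le hγ hlamγ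
  obtain ⟨C₂, hC₂0, hC₂⟩ := norm_bochnerRieszKernel_one_le (n := n) hn hδ hδn hγ
  obtain ⟨C₃, hC₃0, hC₃⟩ := norm_highRiesz_le (n := n) (a := lam) h4 ha (by linarith)
  set I := ∫ z : Rn n, ‖highRiesz lam (1 / 4) z‖ * (1 + ‖z‖) ^ (δ + ((n : ℝ) + 1) / 2) with hI
  have hI0 : 0 ≤ I := integral_nonneg fun z => by positivity
  refine ⟨C₁ + C₂ * I + C₃, by positivity, fun y hy => ?_⟩
  have h1 := one_add_norm_rpow_neg_le ha hy
  have h2 : (1 + ‖y‖) ^ (-(n + γ - lam)) ≤ (1 + ‖y‖) ^ (-(δ + ((n : ℝ) + 1) / 2)) :=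
    Real.rpow_le_rpow_of_exponent_le (by linarith [norm_nonneg y]) (by linarith)
  have e1 : ‖lowKernel δ γ lam (1 / 4) y‖ ≤ C₁ * ‖y‖ ^ (-(δ + ((n : ℝ) + 1) / 2)) :=
    (hC₁ _ h4.le (by norm_num) y).trans (mul_le_mul_of_nonneg_left (h2.trans h1) hC₁0)
  have e2 : ‖convolve (highRiesz lam (1 / 4)) (bochnerRieszKernel δ γ 1) y‖ ≤
      C₂ * I * ‖y‖ ^ (-(δ + ((n : ℝ) + 1) / 2)) :=
    (norm_convolve_le ha (integrable_highRiesz_weight hlam0 h4 _) hC₂ y).trans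
      (mul_le_mul_of_nonneg_left h1 (by positivity))
  rw [errorKernel]
  refine (norm_sub_le _ _).trans ?_
  have := norm_add_le (lowKernel δ γ lam (1 / 4) y)
    (convolve (highRiesz lam (1 / 4)) (bochnerRieszKernel δ γ 1) y)
  linarith [hC₃ y hy]

theorem continuous_lowKernel (hn : 0 < n) {δ γ c s : ℝ} (hδ : 0 ≤ δ) (hγ : 0 < γ) (hc : c ≤ γ)
    (hs : 0 < s) (hs2 : s ≤ 1 / 2) : Continuous (lowKernel δ γ c s : Rn n → ℂ) := by
  rw [funext (lowKernel_eq hn hδ hγ hc hs hs2)]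
  exact continuous_fourierInv_of_integrable (integrable_lowSymbol hn hδ hγ hc hs hs2)

theorem continuous_convolve_kernel {δ γ : ℝ} (hδ : 0 < δ) (hγ : 0 ≤ γ) {k : Rn n → ℂ}
    (hk : Integrable k) : Continuous (convolve k (bochnerRieszKernel δ γ 1)) :=
  continuous_convolve_fourierInv hk (integrable_bochnerRieszMultiplier_one hδ hγ)

/-- The error of the Bochner-Riesz mean of `f` in terms of the Riesz derivative of `f`. -/
theorem IsRieszDerivative.gaussLimit_sub_smoothMean (hn : 0 < n) {δ γ lam : ℝ} (hδ : 0 < δ)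
    (hδn : δ < ((n : ℝ) - 1) / 2) (hlam : ((n : ℝ) - 1) / 2 - δ < lam) (hlamγ : lam ≤ γ)
    {f g : Rn n → ℂ} (h : IsRieszDerivative lam f g)
    (hg : Integrable fun y => (((1 + ‖y‖) ^ (-(δ + ((n : ℝ) + 1) / 2)) : ℝ) : ℂ) * g y)
    (hga : Integrable fun y => ((‖y‖ ^ (-(δ + ((n : ℝ) + 1) / 2)) : ℝ) : ℂ) * g y) :
    gaussLimit δ γ lam f g - smoothMean lam (1 / 4) (by norm_num) f g =
      ∫ y, g y * errorKernel δ γ lam y := by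
  have hlam0 : 0 < lam := by linarith
  have hγ : 0 < γ := by linarith
  have h4 : (0 : ℝ) < 1 / 4 := by norm_num
  have ha : 0 ≤ δ + ((n : ℝ) + 1) / 2 := by positivity
  have hgm := aestronglyMeasurable_of_weight hg
  obtain ⟨C₀, -, hC₀⟩ := norm_lowKernel_le (n := n) (c := 0) hn hδ.le hγ hγ.le
  obtain ⟨C₁, -, hC₁⟩ := norm_lowKernel_le (n := n) hn hδ.le hγ hlamγ
  obtain ⟨C₂, -, hC₂⟩ := norm_bochnerRieszKernel_one_le (n := n) hn hδ hδn hγ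
  obtain ⟨D, -, hD⟩ := schwartz_decay (lowPass (n := n) (1 / 4) h4) (n + lam)
  have i1 : Integrable fun y => f y * lowPass (1 / 4) h4 y :=
    integrable_mul_of_weight h.1 (lowPass (1 / 4) h4).continuous.aestronglyMeasurable hD
  have i2 : Integrable fun y => f y * lowKernel δ γ 0 (1 / 4) y :=
    integrable_mul_of_weight (integrable_weight_mono (by linarith) h.1)
      (continuous_lowKernel hn hδ.le hγ hγ.le h4 (by norm_num)).aestronglyMeasurable
      (hC₀ _ h4.le (by norm_num))
  have i3 : Integrable fun y => g y * lowKernel δ γ lam (1 / 4) y :=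
    integrable_mul_of_weight (integrable_weight_mono (by linarith) hg)
      (continuous_lowKernel hn hδ.le hγ hlamγ h4 (by norm_num)).aestronglyMeasurable
      (hC₁ _ h4.le (by norm_num))
  have hW := integrable_highRiesz (n := n) hlam0 h4
  have i4 : Integrable fun y =>
      g y * convolve (highRiesz lam (1 / 4)) (bochnerRieszKernel δ γ 1) y :=
    integrable_mul_of_weight hg (continuous_convolve_kernel hδ hγ.le hW).aestronglyMeasurable
      (norm_convolve_le ha (integrable_highRiesz_weight hlam0 h4 _) hC₂)
  have i5 : Integrable fun y => g y * highRiesz lam (1 / 4) y :=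
    integrable_mul_highRiesz hn hlam0 h4 ha (by linarith) hgm hga
  have h5 := h.integral_mul_lowKernel_eq hn hδ.le hlam0 hlamγ (integrable_weight_mono
    (by linarith) hg) h4.le (by norm_num : (1 : ℝ) / 4 ≤ 1 / 2)
  simp only [gaussLimit, smoothMean, convolve_lowPass_kernel_sub hn hδ hγ, errorKernel, mul_sub,
    mul_add]
  have i34 : Integrable fun y => g y * lowKernel δ γ lam (1 / 4) y +
      g y * convolve (highRiesz lam (1 / 4)) (bochnerRieszKernel δ γ 1) y := i3.add i4
  rw [integral_add i1 i2, h5, integral_sub i34 i5, integral_add i3 i4]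
  ring

/-- Near 0, m - 1 is O(|ξ|^γ), and |ξ|^(γ-lam) is bounded because lam ≤ γ. At ξ = 0 the factor m - 1
vanishes. -/
theorem exists_lowSymbol_bound {δ γ lam : ℝ} (hγ : 0 < γ) (hlamγ : lam ≤ γ) :
    ∃ M, 0 ≤ M ∧ ∀ ξ : Rn n,
      ‖((cutoff (1 / 4) ξ * (bochnerRieszMultiplier δ γ 1 ξ - 1) * ‖ξ‖ ^ (-lam) : ℝ) : ℂ)‖ ≤ M := by
  have hu₀ : (1 / 2 : ℝ) ^ γ < 1 := Real.rpow_lt_one (by norm_num) (by norm_num) hγ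
  obtain ⟨H, hH, hH1⟩ := exists_smooth_low_profile δ hu₀
  obtain ⟨M, hM⟩ := (isCompact_Icc (a := (0 : ℝ)) (b := 1)).exists_bound_of_continuousOn
    hH.continuous.continuousOn
  have hM0 : 0 ≤ M := (norm_nonneg _).trans (hM 0 (by simp))
  refine ⟨M, hM0, fun ξ => ?_⟩
  rw [Complex.norm_real]
  rcases le_or_gt (1 / 2) ‖ξ‖ with hξ | hξ
  · rw [cutoff_of_le_norm (by norm_num) (by linarith)]; simpa using hM0
  rcases eq_or_ne ξ 0 with rfl | h0
  · rw [bochnerRieszMultiplier_one, norm_zero, Real.zero_rpow hγ.ne']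
    simpa using hM0
  have hpos := norm_pos_iff.2 h0
  have h1 : ‖ξ‖ ^ γ ≤ (1 / 2 : ℝ) ^ γ := Real.rpow_le_rpow hpos.le hξ.le hγ.le
  have h2 : 0 ≤ ‖ξ‖ ^ γ := by positivity
  rw [bochnerRieszMultiplier_one, max_eq_left (by linarith), hH1 _ h1, norm_mul, norm_mul,
    norm_mul, Real.norm_of_nonneg (cutoff_nonneg _ _), Real.norm_of_nonneg h2,
    Real.norm_of_nonneg (by positivity : 0 ≤ ‖ξ‖ ^ (-lam))]
  have h3 : ‖ξ‖ ^ γ * ‖ξ‖ ^ (-lam) ≤ 1 := by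
    rw [← Real.rpow_add hpos]
    exact Real.rpow_le_one hpos.le (by linarith) (by linarith)
  have h4 := hM (‖ξ‖ ^ γ) ⟨h2, by linarith⟩
  calc cutoff (1 / 4) ξ * (‖ξ‖ ^ γ * ‖H (‖ξ‖ ^ γ)‖) * ‖ξ‖ ^ (-lam)
      = cutoff (1 / 4) ξ * (‖ξ‖ ^ γ * ‖ξ‖ ^ (-lam)) * ‖H (‖ξ‖ ^ γ)‖ := by ring
    _ ≤ 1 * 1 * M := by
        gcongr
        exact cutoff_le_one _ _
    _ = M := by ring

theorem integral_norm_fourierInv_comp_inv_smul (h : Rn n → ℂ) {R : ℝ} (hR : 0 < R) :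
    ∫ ξ, ‖𝓕⁻ (fun y => h (R⁻¹ • y)) ξ‖ = ∫ ξ, ‖𝓕⁻ h ξ‖ := by
  have h1 := Measure.integral_comp_smul_of_nonneg (volume : Measure (Rn n))
    (fun ξ => ‖𝓕⁻ h ξ‖) R (hR := hR.le)
  simp only [fourierInv_comp_inv_smul h hR, norm_mul, Complex.norm_real]
  rw [integral_const_mul, h1, finrank_euclideanSpace_fin, Real.norm_of_nonneg (by positivity),
    smul_eq_mul, mul_inv_cancel_left₀ (by positivity)]

/-- Apart from an integrable term, the kernel has a bounded symbol k. Moving the transform to the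
dilate of h leaves k against a function whose L¹ norm is invariant under dilation; the integrable
term is paired with the bounded function h. -/
theorem exists_norm_integral_errorKernel_le (hn : 0 < n) {δ γ lam : ℝ} (hδ : 0 < δ)
    (hlam : 0 < lam) (hlamγ : lam ≤ γ) (h : 𝓢(Rn n, ℂ)) :
    ∃ C, ∀ R : ℝ, 0 < R → (Integrable fun y => h (R⁻¹ • y) * errorKernel δ γ lam y) ∧
      ‖∫ y, h (R⁻¹ • y) * errorKernel δ γ lam y‖ ≤ C := by
  have hγ : 0 < γ := hlam.trans_le hlamγ
  have h4 : (0 : ℝ) < 1 / 4 := by norm_num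
  have hW := integrable_highRiesz (n := n) hlam h4
  have hm := integrable_bochnerRieszMultiplier_one (n := n) hδ hγ.le
  have h1 := integrable_lowSymbol (n := n) hn hδ.le hγ hlamγ h4 (by norm_num)
  have h2 := integrable_fourier_mul hW hm
  set k : Rn n → ℂ := fun ξ =>
    ((cutoff (1 / 4) ξ * (bochnerRieszMultiplier δ γ 1 ξ - 1) * ‖ξ‖ ^ (-lam) : ℝ) : ℂ) +
      𝓕 (highRiesz lam (1 / 4) : Rn n → ℂ) ξ * (bochnerRieszMultiplier δ γ 1 ξ : ℂ) with hk
  have hki : Integrable k := h1.add h2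
  have hE : ∀ y, errorKernel δ γ lam y = 𝓕⁻ k y - highRiesz lam (1 / 4) y := fun y => by
    rw [errorKernel, hk, fourierInv_add_apply h1 h2, lowKernel_eq hn hδ.le hγ hlamγ h4 (by norm_num),
      ← convolve_fourierInv hW hm, bochnerRieszKernel]
  obtain ⟨M, hM0, hM⟩ := exists_lowSymbol_bound (n := n) (δ := δ) hγ hlamγ
  set V := ∫ z : Rn n, ‖highRiesz lam (1 / 4) z‖ with hV
  have hkb : ∀ ξ, ‖k ξ‖ ≤ M + V * 1 := fun ξ => by
    refine (norm_add_le _ _).trans (add_le_add (hM ξ) ?_)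
    rw [norm_mul, Complex.norm_real, Real.norm_of_nonneg (bochnerRieszMultiplier_nonneg _ _ _ _)]
    exact mul_le_mul (norm_fourier_le_integral _ _) (bochnerRieszMultiplier_one_le_one hδ _)
      (bochnerRieszMultiplier_nonneg _ _ _ _) (integral_nonneg fun _ => norm_nonneg _)
  obtain ⟨D, hD0, hD⟩ := schwartz_decay h 0
  simp only [neg_zero, Real.rpow_zero, mul_one] at hD hkb
  refine ⟨(M + V) * (∫ ξ, ‖𝓕⁻ (h : Rn n → ℂ) ξ‖) + D * V, fun R hR => ?_⟩
  have hhi : Integrable fun y => h (R⁻¹ • y) :=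
    (h.integrable (μ := volume)).comp_smul (inv_ne_zero hR.ne')
  have hhc : Continuous fun y : Rn n => h (R⁻¹ • y) :=
    h.continuous.comp (continuous_const_smul _)
  have i1 : Integrable fun y => 𝓕⁻ k y * h (R⁻¹ • y) :=
    hhi.bdd_mul (continuous_fourierInv_of_integrable hki).aestronglyMeasurable
      (.of_forall fun y => norm_fourierInv_le_integral k y)
  have i2 : Integrable fun y => h (R⁻¹ • y) * highRiesz lam (1 / 4) y :=
    hW.bdd_mul hhc.aestronglyMeasurable (.of_forall fun y => hD _)
  have e : (fun y => h (R⁻¹ • y) * errorKernel δ γ lam y) =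
      fun y => 𝓕⁻ k y * h (R⁻¹ • y) - h (R⁻¹ • y) * highRiesz lam (1 / 4) y := by
    ext y; rw [hE]; ring
  rw [e]
  refine ⟨i1.sub i2, ?_⟩
  rw [integral_sub i1 i2, integral_fourierInv_mul_eq_flip hki hhi]
  refine (norm_sub_le _ _).trans (add_le_add ?_ ?_)
  · have hFi : Integrable (𝓕⁻ fun y : Rn n => h (R⁻¹ • y)) := by
      have : (𝓕⁻ fun y : Rn n => h (R⁻¹ • y)) =
          fun ξ => ((R ^ n : ℝ) : ℂ) * (𝓕⁻ h : 𝓢(Rn n, ℂ)) (R • ξ) := by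
        ext ξ
        rw [fourierInv_comp_inv_smul (h : Rn n → ℂ) hR, SchwartzMap.fourierInv_coe]
      rw [this]
      exact (((𝓕⁻ h : 𝓢(Rn n, ℂ)).integrable (μ := volume)).comp_smul hR.ne').const_mul _
    refine (norm_integral_le_of_norm_le (hFi.norm.const_mul (M + V)) (.of_forall fun ξ => ?_)).trans
      (le_of_eq ?_)
    · rw [norm_mul]
      exact mul_le_mul_of_nonneg_right (hkb ξ) (norm_nonneg _)
    · rw [integral_const_mul, integral_norm_fourierInv_comp_inv_smul (h : Rn n → ℂ) hR]
  · refine (norm_integral_le_of_norm_le (hW.norm.const_mul D) (.of_forall fun y => ?_)).trans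
      (le_of_eq (integral_const_mul _ _))
    rw [norm_mul]
    exact mul_le_mul_of_nonneg_right (hD _) (norm_nonneg _)

end ErrorKernel

/-! ### Density of test functions in L¹ with the Riesz weight. -/

section Approximation

variable {n : ℕ}

/-- Because a < n, the measure |z|^(-a) dz is finite on compact sets, so smooth compactly supported
functions are dense in its L¹. -/
theorem exists_schwartz_approx_riesz_weight (hn : 0 < n) {a : ℝ} (han : a < n) {G : Rn n → ℂ}
    (hG : Integrable fun z => ((‖z‖ ^ (-a) : ℝ) : ℂ) * G z) {η : ℝ} (hη : 0 < η) :
    ∃ h : 𝓢(Rn n, ℂ), (Integrable fun z => ((‖z‖ ^ (-a) : ℝ) : ℂ) * (G z - h z)) ∧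
      ∫ z, ‖((‖z‖ ^ (-a) : ℝ) : ℂ) * (G z - h z)‖ ≤ η := by
  set w : Rn n → NNReal := fun z => Real.toNNReal (‖z‖ ^ (-a)) with hw
  have hwm : Measurable w := (measurable_norm.pow_const _).real_toNNReal
  set μ : Measure (Rn n) := volume.withDensity fun z => (w z : ENNReal) with hμ
  have hwsm : ∀ (z : Rn n) (c : ℂ), w z • c = ((‖z‖ ^ (-a) : ℝ) : ℂ) * c := fun z c => by
    rw [hw, NNReal.smul_def, Real.coe_toNNReal _ (by positivity), Complex.real_smul]
  have : IsFiniteMeasureOnCompacts μ := by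
    refine ⟨fun K hK => ?_⟩
    have h1 := (locallyIntegrable_norm_rpow_neg hn han).integrableOn_isCompact hK
    rw [hμ, withDensity_apply _ hK.measurableSet]
    exact h1.lintegral_lt_top
  have hGμ : MemLp G 1 μ := by
    rw [memLp_one_iff_integrable, hμ, integrable_withDensity_iff_integrable_smul hwm]
    simpa only [hwsm] using hG
  obtain ⟨g, hgc, hgs, hg⟩ := hGμ.exist_eLpNorm_sub_le ENNReal.one_ne_top le_rfl hη
  have hgμ : MemLp g 1 μ := hgs.continuous.memLp_of_hasCompactSupport hgc
  have hi : Integrable (G - g) μ := memLp_one_iff_integrable.1 (hGμ.sub hgμ)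
  refine ⟨hgc.toSchwartzMap hgs, ?_, ?_⟩
  · rw [hμ, integrable_withDensity_iff_integrable_smul hwm] at hi
    simp only [hwsm] at hi
    exact hi
  · have h1 : ∫ z, ‖(G - g) z‖ ∂μ ≤ η := by
      rw [integral_norm_eq_lintegral_enorm hi.1, ← eLpNorm_one_eq_lintegral_enorm]
      exact ENNReal.toReal_le_of_le_ofReal hη.le hg
    rw [hμ, integral_withDensity_eq_integral_smul hwm] at h1
    refine le_trans (le_of_eq ?_) h1
    congr 1; ext z
    rw [norm_mul, Complex.norm_real, Real.norm_of_nonneg (by positivity), hw, NNReal.smul_def,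
      Real.coe_toNNReal _ (by positivity)]
    rfl

end Approximation

/-! ### The error of the means and its rate. -/

section Means

variable {n : ℕ}

theorem aestronglyMeasurable_errorKernel (hn : 0 < n) {δ γ lam : ℝ} (hδ : 0 < δ) (hlam : 0 < lam)
    (hlamγ : lam ≤ γ) : AEStronglyMeasurable (errorKernel δ γ lam : Rn n → ℂ) := by
  have hγ : 0 < γ := hlam.trans_le hlamγ
  have h4 : (0 : ℝ) < 1 / 4 := by norm_num
  have hW := integrable_highRiesz (n := n) hlam h4
  exact ((continuous_lowKernel hn hδ.le hγ hlamγ h4 (by norm_num)).aestronglyMeasurable.add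
    (continuous_convolve_kernel hδ hγ.le hW).aestronglyMeasurable).sub hW.1

theorem IsRieszDerivative.tendsto_bochnerRieszGauss (hn : 0 < n) {δ γ lam : ℝ} (hδ : 0 < δ)
    (hδn : δ < ((n : ℝ) - 1) / 2) (hlam : 0 < lam) (hlamγ : lam ≤ γ) {f g : Rn n → ℂ}
    (h : IsRieszDerivative lam f g)
    (hg : Integrable fun y => (((1 + ‖y‖) ^ (-(δ + ((n : ℝ) + 1) / 2)) : ℝ) : ℂ) * g y)
    {R : ℝ} (hR : 0 < R) (x : Rn n) :
    Tendsto (bochnerRieszGauss δ γ R f x) (𝓝[>] 0)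
      (𝓝 (gaussLimit δ γ lam (fun y => f (x - R⁻¹ • y))
        (fun y => ((R ^ (-lam) : ℝ) : ℂ) * g (x - R⁻¹ • y)))) := by
  have h1 := h.comp_sub_inv_smul hlam.le x hR
  have hg1 : Integrable fun y => (((1 + ‖y‖) ^ (-(δ + ((n : ℝ) + 1) / 2)) : ℝ) : ℂ) *
      (((R ^ (-lam) : ℝ) : ℂ) * g (x - R⁻¹ • y)) := by
    refine ((integrable_weight_comp_sub_smul (by positivity) hg x (inv_pos.2 hR)).const_mul
      ((R ^ (-lam) : ℝ) : ℂ)).congr (.of_forall fun y => ?_)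
    simp only
    ring
  have h2 := tendsto_integral_mul_gauss hn hδ hδn hlam hlamγ h1 hg1
  have h3 : Tendsto (fun ε : ℝ => ε / R ^ 2) (𝓝[>] 0) (𝓝[>] 0) := by
    refine tendsto_nhdsWithin_iff.2 ⟨?_, ?_⟩
    · have : Tendsto (fun ε : ℝ => ε / R ^ 2) (𝓝 0) (𝓝 (0 / R ^ 2)) :=
        tendsto_id.div_const _
      rw [zero_div] at this
      exact this.mono_left nhdsWithin_le_nhds
    · filter_upwards [self_mem_nhdsWithin] with ε hε
      exact div_pos (Set.mem_Ioi.1 hε) (pow_pos hR 2)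
  refine (h2.comp h3).congr fun ε => ?_
  rw [bochnerRieszGauss_eq δ γ hR]
  rfl

/-- Homogeneity of the weight. With a = δ + (n+1)/2, the exponent n - a is (n-1)/2 - δ, the loss in
the final rate. -/
theorem integrable_riesz_weight_comp_inv_smul {a : ℝ} {G : Rn n → ℂ}
    (hG : Integrable fun z => ((‖z‖ ^ (-a) : ℝ) : ℂ) * G z) {R : ℝ} (hR : 0 < R) :
    (Integrable fun y => ((‖y‖ ^ (-a) : ℝ) : ℂ) * G (R⁻¹ • y)) ∧
      ∫ y, ‖((‖y‖ ^ (-a) : ℝ) : ℂ) * G (R⁻¹ • y)‖ =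
        R ^ (n - a) * ∫ z, ‖((‖z‖ ^ (-a) : ℝ) : ℂ) * G z‖ := by
  have e : ∀ y : Rn n, ((‖y‖ ^ (-a) : ℝ) : ℂ) * G (R⁻¹ • y) =
      ((R ^ (-a) : ℝ) : ℂ) * (((‖R⁻¹ • y‖ ^ (-a) : ℝ) : ℂ) * G (R⁻¹ • y)) := fun y => by
    rw [norm_smul, norm_inv, Real.norm_of_nonneg hR.le,
      Real.mul_rpow (by positivity) (norm_nonneg _), Real.inv_rpow hR.le, ← mul_assoc,
      ← Complex.ofReal_mul, mul_inv_cancel_left₀ (Real.rpow_pos_of_pos hR _).ne']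
  simp only [e]
  refine ⟨(hG.comp_smul (inv_ne_zero hR.ne')).const_mul _, ?_⟩
  have h1 := Measure.integral_comp_inv_smul_of_nonneg (volume : Measure (Rn n))
    (fun z => ‖((‖z‖ ^ (-a) : ℝ) : ℂ) * G z‖) hR.le
  rw [finrank_euclideanSpace_fin, smul_eq_mul] at h1
  simp only [norm_mul _ (_ * _)]
  rw [integral_const_mul, h1, Complex.norm_real, Real.norm_of_nonneg (by positivity), ← mul_assoc,
    ← Real.rpow_natCast, ← Real.rpow_add hR]
  congr 2
  ring

/-- The error of the Bochner-Riesz mean at a point where the Riesz potential of the Riesz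
derivative converges absolutely. -/
theorem IsRieszDerivative.bochnerRieszMean_sub_eq (hn : 0 < n) {δ γ lam : ℝ} (hδ : 0 < δ)
    (hδn : δ < ((n : ℝ) - 1) / 2) (hlam : ((n : ℝ) - 1) / 2 - δ < lam) (hlamγ : lam ≤ γ)
    {f g : Rn n → ℂ} (h : IsRieszDerivative lam f g)
    (hg : Integrable fun y => (((1 + ‖y‖) ^ (-(δ + ((n : ℝ) + 1) / 2)) : ℝ) : ℂ) * g y) {x : Rn n}
    (hx : Integrable fun z => ((‖z‖ ^ (-(δ + ((n : ℝ) + 1) / 2)) : ℝ) : ℂ) * g (x - z))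
    (hfx : smoothMean lam (1 / 4) (by norm_num) (fun y => f (x - y)) (fun y => g (x - y)) = f x)
    {R : ℝ} (hR : 0 < R) :
    bochnerRieszMean δ γ R f x - f x =
      ((R ^ (-lam) : ℝ) : ℂ) * ∫ y, g (x - R⁻¹ • y) * errorKernel δ γ lam y := by
  have hlam0 : 0 < lam := by linarith
  have h4 : (0 : ℝ) < 1 / 4 := by norm_num
  have ha : 0 ≤ δ + ((n : ℝ) + 1) / 2 := by positivity
  rw [bochnerRieszMean, (h.tendsto_bochnerRieszGauss hn hδ hδn hlam0 hlamγ hg hR x).limUnder_eq]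
  have h1 := h.comp_sub_inv_smul hlam0.le x hR
  have hg1 : Integrable fun y => (((1 + ‖y‖) ^ (-(δ + ((n : ℝ) + 1) / 2)) : ℝ) : ℂ) *
      (((R ^ (-lam) : ℝ) : ℂ) * g (x - R⁻¹ • y)) := by
    refine ((integrable_weight_comp_sub_smul ha hg x (inv_pos.2 hR)).const_mul
      ((R ^ (-lam) : ℝ) : ℂ)).congr (.of_forall fun y => ?_)
    simp only
    ring
  have hx1 : Integrable fun y => ((‖y‖ ^ (-(δ + ((n : ℝ) + 1) / 2)) : ℝ) : ℂ) *
      (((R ^ (-lam) : ℝ) : ℂ) * g (x - R⁻¹ • y)) := by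
    refine ((integrable_riesz_weight_comp_inv_smul (G := fun z => g (x - z)) hx hR).1.const_mul
      ((R ^ (-lam) : ℝ) : ℂ)).congr (.of_forall fun y => ?_)
    simp only
    ring
  have h2 := h1.gaussLimit_sub_smoothMean hn hδ hδn hlam hlamγ hg1 hx1
  rw [smoothMean_comp_sub_inv_smul lam h4 f g x hR] at h2
  have h0 : IsRieszDerivative lam (fun y => f (x - y)) (fun y => g (x - y)) := by
    simpa using h.comp_sub_inv_smul hlam0.le x one_pos
  have hgm : AEStronglyMeasurable fun y => g (x - y) :=
    (aestronglyMeasurable_of_weight hg).comp_quasiMeasurePreserving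
      (quasiMeasurePreserving_sub_left volume x)
  have hi : ∀ s : ℝ, 0 < s → Integrable fun y => g (x - y) * highRiesz lam s y := fun s hs =>
    integrable_mul_highRiesz hn hlam0 hs ha (by linarith) hgm hx
  -- Rescaling has moved the cutoff to R/4. Independence of the scale brings it back to 1/4, so the
  -- exceptional set of x does not depend on R.
  have h3 : smoothMean lam (1 / 4 * R) (mul_pos h4 hR) (fun y => f (x - y))
      (fun y => g (x - y)) = f x := by
    rw [← hfx]
    rcases le_total (1 / 4) (1 / 4 * R) with hle | hle
    · exact (h0.smoothMean_eq hn hlam0 h4 (mul_pos h4 hR) hle (hi _ h4)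
        (hi _ (mul_pos h4 hR))).symm
    · exact h0.smoothMean_eq hn hlam0 (mul_pos h4 hR) h4 hle (hi _ (mul_pos h4 hR)) (hi _ h4)
  rw [h3] at h2
  rw [h2, ← integral_const_mul]
  congr 1; ext y; ring

/-- Integrals of the error kernel against dilates of a function which is integrable with respect
to the Riesz weight. -/
theorem isLittleO_integral_errorKernel (hn : 0 < n) {δ γ lam : ℝ} (hδ : 0 < δ)
    (hδn : δ < ((n : ℝ) - 1) / 2) (hlam : ((n : ℝ) - 1) / 2 - δ < lam) (hlamγ : lam ≤ γ)
    {G : Rn n → ℂ} (hGm : AEStronglyMeasurable G)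
    (hG : Integrable fun z => ((‖z‖ ^ (-(δ + ((n : ℝ) + 1) / 2)) : ℝ) : ℂ) * G z) :
    (fun R : ℝ => ∫ y, G (R⁻¹ • y) * errorKernel δ γ lam y) =o[atTop]
      fun R : ℝ => R ^ (((n : ℝ) - 1) / 2 - δ) := by
  have hlam0 : 0 < lam := by linarith
  obtain ⟨C, hC0, hC⟩ := norm_errorKernel_le (n := n) hn hδ hδn hlam hlamγ
  have hKm := aestronglyMeasurable_errorKernel (n := n) hn hδ hlam0 hlamγ
  rw [isLittleO_iff]
  intro c hc
  -- The tolerance makes C times the weighted error at most c/2; C + 1 avoids a division by zero.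
  -- The other half absorbs the bounded contribution of h, as R^((n-1)/2 - δ) tends to infinity.
  obtain ⟨h, hh, hhη⟩ := exists_schwartz_approx_riesz_weight hn (by linarith) hG
    (η := c / (2 * (C + 1))) (by positivity)
  obtain ⟨D, hD⟩ := exists_norm_integral_errorKernel_le hn hδ hlam0 hlamγ h
  have hlim : Tendsto (fun R : ℝ => c / 2 * R ^ (((n : ℝ) - 1) / 2 - δ)) atTop atTop :=
    (tendsto_rpow_atTop (by linarith)).const_mul_atTop (by positivity)
  filter_upwards [eventually_gt_atTop 0, hlim.eventually_ge_atTop D] with R hR hRD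
  obtain ⟨hhK, hhD⟩ := hD R hR
  obtain ⟨hi, hie⟩ := integrable_riesz_weight_comp_inv_smul hh hR
  have hqm : Measure.QuasiMeasurePreserving (fun y : Rn n => R⁻¹ • y) volume volume :=
    Measure.quasiMeasurePreserving_smul _ (inv_ne_zero hR.ne')
  have hGK : Integrable fun y => G (R⁻¹ • y) * errorKernel δ γ lam y :=
    integrable_mul_of_riesz_weight hn (hGm.comp_quasiMeasurePreserving hqm)
      (integrable_riesz_weight_comp_inv_smul hG hR).1 hKm hC
  have e : ∫ y, G (R⁻¹ • y) * errorKernel δ γ lam y =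
      (∫ y, (G (R⁻¹ • y) - h (R⁻¹ • y)) * errorKernel δ γ lam y) +
        ∫ y, h (R⁻¹ • y) * errorKernel δ γ lam y := by
    simp only [sub_mul]
    rw [integral_sub hGK hhK]
    ring
  have h1 : ‖∫ y, (G (R⁻¹ • y) - h (R⁻¹ • y)) * errorKernel δ γ lam y‖ ≤
      c / 2 * R ^ (((n : ℝ) - 1) / 2 - δ) := by
    refine (norm_integral_le_of_norm_le (hi.norm.const_mul C) ?_).trans ?_
    · filter_upwards [ae_ne_zero hn] with y hy
      exact norm_mul_le_riesz_weight (g := fun y => G (R⁻¹ • y) - h (R⁻¹ • y)) (hC y hy)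
    · rw [integral_const_mul, hie, show (n : ℝ) - (δ + ((n : ℝ) + 1) / 2) =
        ((n : ℝ) - 1) / 2 - δ by ring, mul_left_comm, mul_comm]
      refine mul_le_mul_of_nonneg_right ?_ (by positivity)
      calc C * _ ≤ C * (c / (2 * (C + 1))) := mul_le_mul_of_nonneg_left hhη hC0
        _ ≤ (C + 1) * (c / (2 * (C + 1))) := by gcongr; linarith
        _ = c / 2 := by field_simp
  rw [e, Real.norm_of_nonneg (by positivity : 0 ≤ R ^ (((n : ℝ) - 1) / 2 - δ))]
  refine (norm_add_le _ _).trans ?_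
  linarith

end Means

end

theorem theorem1p3 (n : ℕ) (δ γ lam p : ℝ)
    (hδ₀ : 0 < δ) (hδ : δ < ((n : ℝ) - 1) / 2)
    (hp₁ : 1 ≤ p) (hp : p < 2 * (n : ℝ) / ((n : ℝ) - 1 - 2 * δ))
    (hlam : ((n : ℝ) - 1) / 2 - δ < lam) (hlamγ : lam ≤ γ)
    (f : Rn n → ℂ) (hf : MemRieszSobolev lam p f) :
    (∀ R : ℝ, 0 < R → ∀ x : Rn n,
      Tendsto (bochnerRieszGauss δ γ R f x) (𝓝[>] 0) (𝓝 (bochnerRieszMean δ γ R f x))) ∧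
    ∀ᵐ x : Rn n,
      (fun R : ℝ => bochnerRieszMean δ γ R f x - f x) =o[atTop]
        (fun R : ℝ => R ^ (-(lam + δ - ((n : ℝ) - 1) / 2))) := by
  obtain ⟨g, hgp, h⟩ := hf
  have hn1 : (1 : ℝ) < n := by linarith
  have hn : 0 < n := by exact_mod_cast (zero_lt_one.trans hn1)
  have hlam0 : 0 < lam := by linarith
  have ha : 0 ≤ δ + ((n : ℝ) + 1) / 2 := by positivity
  -- Since n - a = (n - 1 - 2δ)/2, this is the bound on p.
  have hpa : p * ((n : ℝ) - (δ + ((n : ℝ) + 1) / 2)) < n := by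
    rw [lt_div_iff₀ (by linarith)] at hp
    linarith
  have hg := MemLp.integrable_one_add_norm_rpow_mul hp₁ ha hpa hgp
  refine ⟨fun R hR x => tendsto_nhds_limUnder
    ⟨_, h.tendsto_bochnerRieszGauss hn hδ₀ hδ hlam0 hlamγ hg hR x⟩, ?_⟩
  filter_upwards [ae_integrable_riesz hn ha (by linarith) hg,
    h.ae_smoothMean_eq hlam0 ha hg (s := 1 / 4) (by norm_num)] with x hx hfx
  have hgm : AEStronglyMeasurable fun y => g (x - y) :=
    (aestronglyMeasurable_of_weight hg).comp_quasiMeasurePreserving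
      (quasiMeasurePreserving_sub_left volume x)
  have h1 := isLittleO_integral_errorKernel hn hδ₀ hδ hlam hlamγ hgm hx
  have h2 : (fun R : ℝ => ((R ^ (-lam) : ℝ) : ℂ)) =O[atTop] fun R : ℝ => R ^ (-lam) :=
    isBigO_of_le _ fun R => by rw [Complex.norm_real]
  -- The factor R^(-lam) from the formula for the error multiplies o(R^((n-1)/2 - δ)).
  refine (h2.mul_isLittleO h1).congr' ?_ ?_
  · filter_upwards [eventually_gt_atTop 0] with R hR
    exact (h.bochnerRieszMean_sub_eq hn hδ₀ hδ hlam hlamγ hg hx hfx hR).symm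
  · filter_upwards [eventually_gt_atTop 0] with R hR
    rw [← Real.rpow_add hR]
    congr 1
    ring
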